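/- Let $d\ge 1$, let $\Omega\subset\mathbb R^d$ be a bounded Lipschitz domain, $Y=(0,1)^d$, $0<r<1$ and $1<p<\infty$. Let $D:\mathbb R^d\to\mathbb R^{d\times d}$ be a field of invertible matrices such that $D$ and $D^{-1}$ are Lipschitz on $\mathbb R^d$ and $0<D_1\le|\det D(x)|\le D_2<\infty$ for all $x\in\overline\Omega$; write $D_x=D(x)$ and $Y_x=D_xY$. For each $\varepsilon$ of a sequence of positive numbers tending to $0$, let $\Omega$ be covered by the closures of finitely many pairwise disjoint open axis-parallel cubes $\Omega_n^\varepsilon$, $1\le n\le N_\varepsilon$, of side $\varepsilon^r$, each meeting $\Omega$, and let $x_n^\varepsilon\in\Omega_n^\varepsilon\cap\Omega$ be arbitrary chosen points. Put $$\hat\Xi_n^\varepsilon=\{\xi\in\mathbb Z^d:\ \varepsilon D_{x_n^\varepsilon}(Y+\xi)\subset\Omega_n^\varepsilon\cap\Omega\},\qquad \hat\Omega_n^\varepsilon=\mathrm{Int}\Big(\bigcup_{\xi\in\hat\Xi_n^\varepsilon}\varepsilon D_{x_n^\varepsilon}(\overline Y+\xi)\Big).$$ With $[z]_Y\in\mathbb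 Z^d$ the vector of componentwise integer parts of $z\in\mathbb R^d$, the locally periodic unfolding operator is, for $\psi$ measurable on $\Omega$ (with scalar or vector values), $$\mathcal T^\varepsilon_{\mathcal L}(\psi)(x,y)=\sum_{n=1}^{N_\varepsilon}\psi\Big(\varepsilon D_{x_n^\varepsilon}\big[D_{x_n^\varepsilon}^{-1}x/\varepsilon\big]_Y+\varepsilon D_{x_n^\varepsilon}y\Big)\chi_{\hat\Omega_n^\varepsilon}(x),\qquad x\in\Omega,\ y\in Y.$$ Let $W^{1,p}_{\rm per}(Y)$ be the space of those $v\in W^{1,p}(Y)$ whose $Y$-periodic extension lies in $W^{1,p}_{\rm loc}(\mathbb R^d)$, and let $w_1\in L^p(\Omega;W^{1,p}_{\rm per}(Y_x))$ mean that $w_1(x,y)=\widetilde w_1(x,D_x^{-1}y)$, $x\in\Omega$, $y\in Y_x$, for some $\widetilde w_1\in L^p(\Omega;W^{1,p}_{\rm per}(Y))$. **Theorem.** If $w^\varepsilon\rightharpoonup w$ weakly in $W^{1,p}(\Omega)$ as $\varepsilon\to0$, then there exist a subsequence (not relabelled) and a function $w_1\in L^p(\Omega;W^{1,p}_{\rm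 per}(Y_x))$ such that $$\mathcal T^\varepsilon_{\mathcal L}(w^\varepsilon)\rightharpoonup w\quad\text{weakly in }L^p(\Omega;W^{1,p}(Y)),$$ $$\mathcal T^\varepsilon_{\mathcal L}(\nabla w^\varepsilon)\rightharpoonup\nabla w+D_x^{-T}\nabla_y\big[w_1(x,D_xy)\big]\quad\text{weakly in }L^p(\Omega\times Y)^d,$$ where $w$ is regarded as a function of $(x,y)$ that is constant in $y$, and $\nabla_y[w_1(x,D_xy)]$ is the gradient of the composed function $y\mapsto w_1(x,D_xy)$, that is, of $\widetilde w_1(x,\cdot)$. -/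

import Mathlib

open Set Filter Topology MeasureTheory
open scoped ENNReal NNReal

noncomputable section

namespace LPUnfold

/-- `ℝ^d` with the Euclidean norm. -/
abbrev E (d : ℕ) : Type := EuclideanSpace ℝ (Fin d)

/-- `d × d` real matrices. -/
abbrev Mat (d : ℕ) : Type := Matrix (Fin d) (Fin d) ℝ

/-- The matrix-vector product `A z` on `ℝ^d`. -/
def act {d : ℕ} (A : Mat d) (z : E d) : E d := WithLp.toLp 2 (A.mulVec z.ofLp)

/-- The open unit cell `Y = (0,1)^d`. -/
def unitCell (d : ℕ) : Set (E d) := {y | ∀ i, y i ∈ Ioo (0 : ℝ) 1}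

/-! ### Weak convergence -/

/-- Weak convergence `u k ⇀ v` of a sequence in a normed space. -/
def WeakTendsto {X : Type*} [NormedAddCommGroup X] [NormedSpace ℝ X] (u : ℕ → X) (v : X) : Prop :=
  Tendsto (fun k => toWeakSpace ℝ X (u k)) atTop (𝓝 (toWeakSpace ℝ X v))

theorem weakTendsto_iff {X : Type*} [NormedAddCommGroup X] [NormedSpace ℝ X] (u : ℕ → X) (v : X) :
    WeakTendsto u v ↔ ∀ F : X →L[ℝ] ℝ, Tendsto (fun k => F (u k)) atTop (𝓝 (F v)) := by
  have hinj : Function.Injective (topDualPairing ℝ X).flip := by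
    intro x y hxy
    by_contra hne
    obtain ⟨F, hF⟩ := SeparatingDual.exists_separating_of_ne (R := ℝ) (V := X) hne
    exact hF (DFunLike.congr_fun hxy F)
  exact WeakBilin.tendsto_iff_forall_eval_tendsto (B := (topDualPairing ℝ X).flip)
    (l := atTop) (f := fun k => toWeakSpace ℝ X (u k)) (x := toWeakSpace ℝ X v) hinj

/-- The functions `f k` and `g` belong to `L^p(μ)`, and `f k ⇀ g` weakly in `L^p(μ)`. -/
def WeakTendstoLp {α : Type*} [MeasurableSpace α] {F : Type*} [NormedAddCommGroup F]
    [NormedSpace ℝ F] (p : ℝ≥0∞) [Fact (1 ≤ p)] (μ : Measure α) (f : ℕ → α → F) (g : α → F) :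
    Prop :=
  ∃ (hf : ∀ k, MemLp (f k) p μ) (hg : MemLp g p μ),
    WeakTendsto (fun k => (hf k).toLp (f k)) (hg.toLp g)

/-! ### Sobolev spaces -/

/-- Test functions `C_c^∞(U)`. -/
def IsTestFunction {d : ℕ} (U : Set (E d)) (φ : E d → ℝ) : Prop :=
  ContDiff ℝ ((⊤ : ℕ∞) : WithTop ℕ∞) φ ∧ HasCompactSupport φ ∧ tsupport φ ⊆ U

/-- The `i`-th classical partial derivative. -/
def pderiv {d : ℕ} (i : Fin d) (φ : E d → ℝ) (x : E d) : ℝ :=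
  fderiv ℝ φ x (EuclideanSpace.single i 1)

/-- `G` is the weak gradient of `u` on `U` (for locally integrable `u`, `G`). -/
def HasWeakGradient {d : ℕ} (U : Set (E d)) (u : E d → ℝ) (G : E d → E d) : Prop :=
  ∀ φ : E d → ℝ, IsTestFunction U φ → ∀ i : Fin d,
    ∫ x in U, u x * pderiv i φ x = - ∫ x in U, G x i * φ x

theorem integrable_mul_test {d : ℕ} {U : Set (E d)} {p : ℝ≥0∞} [Fact (1 ≤ p)]
    (f : Lp ℝ p (volume.restrict U)) {g : E d → ℝ} (hg : Continuous g) (hs : HasCompactSupport g) :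
    Integrable (fun x => f x * g x) (volume.restrict U) := by
  have h := ((Lp.memLp f).locallyIntegrable
    Fact.out).integrable_smul_left_of_hasCompactSupport hg hs
  refine h.congr (Eventually.of_forall fun x => ?_)
  simp [mul_comm]

theorem integrable_coord_mul_test {d : ℕ} {U : Set (E d)} {p : ℝ≥0∞} [Fact (1 ≤ p)]
    (f : Lp (E d) p (volume.restrict U)) (i : Fin d) {g : E d → ℝ} (hg : Continuous g)
    (hs : HasCompactSupport g) :
    Integrable (fun x => f x i * g x) (volume.restrict U) := by
  have h := ((Lp.memLp f).locallyIntegrable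
    Fact.out).integrable_smul_left_of_hasCompactSupport hg hs
  have h2 := (EuclideanSpace.proj (𝕜 := ℝ) i).integrable_comp h
  refine h2.congr (Eventually.of_forall fun x => ?_)
  simp [mul_comm]

theorem continuous_pderiv {d : ℕ} {U : Set (E d)} {φ : E d → ℝ} (h : IsTestFunction U φ)
    (i : Fin d) : Continuous (pderiv i φ) :=
  (h.1.continuous_fderiv (by simp)).clm_apply continuous_const

theorem hasCompactSupport_pderiv {d : ℕ} {U : Set (E d)} {φ : E d → ℝ} (h : IsTestFunction U φ)
    (i : Fin d) : HasCompactSupport (pderiv i φ) :=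
  h.2.1.fderiv_apply (𝕜 := ℝ) (v := EuclideanSpace.single i 1)

/-- The Sobolev space `W^{1,p}(U)`, as the space of pairs `(u, ∇u)` in `L^p × L^p`. It carries the
norm `max (‖u‖_p) (‖∇u‖_p)`, which is equivalent to the usual one. -/
def sobolevSubmodule {d : ℕ} (U : Set (E d)) (p : ℝ≥0∞) [Fact (1 ≤ p)] :
    Submodule ℝ (Lp ℝ p (volume.restrict U) × Lp (E d) p (volume.restrict U)) where
  carrier := {v | HasWeakGradient U v.1 v.2}
  zero_mem' := by
    intro φ _ i
    have h1 : ∫ x in U, ((0 : Lp ℝ p (volume.restrict U)) : E d → ℝ) x * pderiv i φ x = 0 := by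
      rw [← integral_zero (E d) ℝ]
      refine integral_congr_ae ?_
      filter_upwards [Lp.coeFn_zero ℝ p (volume.restrict U)] with x hx
      simp only [hx, Pi.zero_apply, zero_mul]
    have h2 : ∫ x in U, ((0 : Lp (E d) p (volume.restrict U)) : E d → E d) x i * φ x = 0 := by
      rw [← integral_zero (E d) ℝ]
      refine integral_congr_ae ?_
      filter_upwards [Lp.coeFn_zero (E d) p (volume.restrict U)] with x hx
      simp only [hx, Pi.zero_apply, PiLp.zero_apply, zero_mul]
    simp only [Prod.fst_zero, Prod.snd_zero]
    rw [h1, h2, neg_zero]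
  add_mem' := by
    intro v w hv hw φ hφ i
    have h1 : ∫ x in U, (v + w).1 x * pderiv i φ x =
        ∫ x in U, v.1 x * pderiv i φ x + w.1 x * pderiv i φ x := by
      refine integral_congr_ae ?_
      filter_upwards [Lp.coeFn_add v.1 w.1] with x hx
      simp only [Prod.fst_add, hx, Pi.add_apply, add_mul]
    have h2 : ∫ x in U, (v + w).2 x i * φ x = ∫ x in U, v.2 x i * φ x + w.2 x i * φ x := by
      refine integral_congr_ae ?_
      filter_upwards [Lp.coeFn_add v.2 w.2] with x hx
      simp only [Prod.snd_add, hx, Pi.add_apply, PiLp.add_apply, add_mul]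
    have hc := continuous_pderiv hφ i
    have hs := hasCompactSupport_pderiv hφ i
    rw [h1, h2, integral_add (integrable_mul_test v.1 hc hs) (integrable_mul_test w.1 hc hs),
      integral_add (integrable_coord_mul_test v.2 i hφ.1.continuous hφ.2.1)
        (integrable_coord_mul_test w.2 i hφ.1.continuous hφ.2.1), hv φ hφ i, hw φ hφ i]
    ring
  smul_mem' := by
    intro c v hv φ hφ i
    have h1 : ∫ x in U, (c • v).1 x * pderiv i φ x = ∫ x in U, c * (v.1 x * pderiv i φ x) := by
      refine integral_congr_ae ?_
      filter_upwards [Lp.coeFn_smul c v.1] with x hx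
      simp [hx, mul_assoc]
    have h2 : ∫ x in U, (c • v).2 x i * φ x = ∫ x in U, c * (v.2 x i * φ x) := by
      refine integral_congr_ae ?_
      filter_upwards [Lp.coeFn_smul c v.2] with x hx
      simp [hx, mul_assoc]
    rw [h1, h2, integral_const_mul, integral_const_mul, hv φ hφ i]
    ring

/-- The Sobolev space `W^{1,p}(U)` as a normed space. -/
abbrev W1p {d : ℕ} (U : Set (E d)) (p : ℝ≥0∞) [Fact (1 ≤ p)] : Type := sobolevSubmodule U p

/-- The function `u` underlying an element of `W^{1,p}(U)`. -/
def W1p.fn {d : ℕ} {U : Set (E d)} {p : ℝ≥0∞} [Fact (1 ≤ p)] (v : W1p U p) : E d → ℝ :=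
  (v : Lp ℝ p (volume.restrict U) × Lp (E d) p (volume.restrict U)).1

/-- The weak gradient `∇u` of an element of `W^{1,p}(U)`. -/
def W1p.grad {d : ℕ} {U : Set (E d)} {p : ℝ≥0∞} [Fact (1 ≤ p)] (v : W1p U p) : E d → E d :=
  (v : Lp ℝ p (volume.restrict U) × Lp (E d) p (volume.restrict U)).2

/-- The integer part `[z]_Y ∈ ℤ^d`, for which `z - [z]_Y ∈ [0,1)^d`. -/
def intPart {d : ℕ} (z : E d) : E d := WithLp.toLp 2 fun i => (⌊z i⌋ : ℝ)

/-- `v ∈ W^{1,p}_per(Y)`: the `Y`-periodic extension of `v` to `ℝ^d` is weakly differentiable on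
`ℝ^d`, and its weak gradient is the `Y`-periodic extension of `∇v`. -/
def IsPeriodicW1p {d : ℕ} {p : ℝ≥0∞} [Fact (1 ≤ p)] (v : W1p (unitCell d) p) : Prop :=
  HasWeakGradient univ (fun y => v.fn (y - intPart y)) (fun y => v.grad (y - intPart y))

/-- The element `V` of the Bochner space `L^p(Ω; W^{1,p}(Y))` is the function `f` of `(x, y)`. -/
def Represents {d : ℕ} {Ω : Set (E d)} {p : ℝ≥0∞} [Fact (1 ≤ p)]
    (V : Lp (W1p (unitCell d) p) p (volume.restrict Ω)) (f : E d → E d → ℝ) : Prop :=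
  ∀ᵐ x ∂(volume.restrict Ω), (V x).fn =ᵐ[volume.restrict (unitCell d)] f x

/-! ### Geometry -/

/-- Lipschitz domains: nonempty connected open sets that, near each boundary point, lie on one side
of the graph of a Lipschitz function over the hyperplane orthogonal to some unit vector `ν`. -/
def IsLipschitzDomain {d : ℕ} (Ω : Set (E d)) : Prop :=
  IsOpen Ω ∧ IsConnected Ω ∧
    ∀ x₀ ∈ frontier Ω, ∃ (ν : E d) (γ : E d → ℝ) (L : ℝ≥0) (ρ : ℝ),
      ‖ν‖ = 1 ∧ LipschitzWith L γ ∧ 0 < ρ ∧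
        ∀ x ∈ Metric.ball x₀ ρ,
          (x ∈ Ω ↔ γ (x - (inner ℝ ν x : ℝ) • ν) < (inner ℝ ν x : ℝ))

/-- Entrywise (equivalently, in any matrix norm) Lipschitz continuity of a matrix field on `ℝ^d`. -/
def IsLipschitzField {d : ℕ} (A : E d → Mat d) : Prop :=
  ∃ C : ℝ, ∀ x x' : E d, ∀ i j, |A x i j - A x' i j| ≤ C * dist x x'

/-- The transformation matrices: `D, D⁻¹ ∈ Lip(ℝ^d; ℝ^{d×d})` and
`0 < D₁ ≤ |det D(x)| ≤ D₂ < ∞` on the closure of `Ω`. -/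
structure IsTransformation {d : ℕ} (Ω : Set (E d)) (D : E d → Mat d) : Prop where
  invertible : ∀ x, IsUnit (D x).det
  lipschitz : IsLipschitzField D
  lipschitz_inv : IsLipschitzField fun x => (D x)⁻¹
  det_bounds : ∃ D₁ D₂ : ℝ, 0 < D₁ ∧ ∀ x ∈ closure Ω, D₁ ≤ |(D x).det| ∧ |(D x).det| ≤ D₂

/-- The open axis-parallel cube of side `s` with lower corner `a`. -/
def cube {d : ℕ} (a : E d) (s : ℝ) : Set (E d) := {x | ∀ i, x i ∈ Ioo (a i) (a i + s)}

/-- A covering of `Ω` by finitely many non-intersecting open cubes `Ω_n` of side `ε^r`, with a point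
`x_n ∈ Ω_n ∩ Ω` chosen in each of them. -/
structure CubePartition {d : ℕ} (Ω : Set (E d)) (r ε : ℝ) where
  N : ℕ
  corner : Fin N → E d
  node : Fin N → E d
  disjoint : Pairwise fun m n => Disjoint (cube (corner m) (ε ^ r)) (cube (corner n) (ε ^ r))
  covers : Ω ⊆ ⋃ n, closure (cube (corner n) (ε ^ r))
  node_mem : ∀ n, node n ∈ cube (corner n) (ε ^ r) ∩ Ω

/-- `ε A (S + ξ)` for a matrix `A`, a set `S` and `ξ ∈ ℤ^d`. -/
def scaledCell {d : ℕ} (ε : ℝ) (A : Mat d) (S : Set (E d)) (ξ : Fin d → ℤ) : Set (E d) :=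
  (fun y => ε • act A (y + WithLp.toLp 2 fun i => (ξ i : ℝ))) '' S

namespace CubePartition

variable {d : ℕ} {Ω : Set (E d)} {r ε : ℝ}

/-- The cube `Ω_n`. -/
def sub (P : CubePartition Ω r ε) (n : Fin P.N) : Set (E d) := cube (P.corner n) (ε ^ r)

/-- The set `hat Ξ_n` of all `ξ ∈ ℤ^d` with `ε D(x_n) (Y + ξ) ⊆ Ω_n ∩ Ω`. -/
def hatXi (P : CubePartition Ω r ε) (D : E d → Mat d) (n : Fin P.N) : Set (Fin d → ℤ) :=
  {ξ | scaledCell ε (D (P.node n)) (unitCell d) ξ ⊆ P.sub n ∩ Ω}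

/-- `hat Ω_n`, the interior of the union of the closed cells `ε D(x_n) (closure Y + ξ)`,
`ξ ∈ hat Ξ_n`. -/
def hatSub (P : CubePartition Ω r ε) (D : E d → Mat d) (n : Fin P.N) : Set (E d) :=
  interior (⋃ ξ ∈ P.hatXi D n, scaledCell ε (D (P.node n)) (closure (unitCell d)) ξ)

/-- The locally periodic unfolding operator
`T(ψ)(x,y) = ∑_n ψ(ε D_{x_n} [D_{x_n}⁻¹ x / ε]_Y + ε D_{x_n} y) χ_{hat Ω_n}(x)`. -/
def unfolding {F : Type*} [AddCommMonoid F] (P : CubePartition Ω r ε) (D : E d → Mat d)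
    (ψ : E d → F) (x y : E d) : F :=
  ∑ n : Fin P.N, (P.hatSub D n).indicator
    (fun x => ψ (ε • act (D (P.node n)) (intPart (ε⁻¹ • act (D (P.node n))⁻¹ x))
      + ε • act (D (P.node n)) y)) x

end CubePartition

/-- `w₁ ∈ L^p(Ω; W^{1,p}_per(Y_x))`, where `Y_x = D(x) Y`: the function
`(x, y) ↦ w₁(x, D(x) y)` belongs to `L^p(Ω; W^{1,p}_per(Y))`. Moreover, `g(x, y)` is the gradient of
`w₁(x, D(x) y)` with respect to `y ∈ Y`. -/
def MemLpW1pPer {d : ℕ} (Ω : Set (E d)) (D : E d → Mat d) (p : ℝ≥0∞) [Fact (1 ≤ p)]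
    (w₁ : E d → E d → ℝ) (g : E d → E d → E d) : Prop :=
  ∃ V : Lp (W1p (unitCell d) p) p (volume.restrict Ω),
    Represents V (fun x y => w₁ x (act (D x) y)) ∧
    ∀ᵐ x ∂(volume.restrict Ω), IsPeriodicW1p (V x) ∧
      (V x).grad =ᵐ[volume.restrict (unitCell d)] g x

end LPUnfold

end

open LPUnfold

set_option autoImplicit false

/-! For x in an admissible cell, send (x, y) to the point of that cell with local coordinate y. This
map carries the product measure to Lebesgue measure on the union of the admissible cells
(`measurePreserving_foldPt`). Hence unfolding does not increase `L^p` norms. As 1 < p < ∞, along a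
subsequence the unfolded functions converge weakly to some W and the unfolded gradients to some G,
and it remains to identify both.

All identities come from one comparison (`exists_transfer`). For Φ periodic and a a test function on
Ω, the unfolded pairing ∫∫ a(x) Φ(y) m(x)·T(f)(x,y) is close to the sum over n of ∫ θ_n a
Φ(D(x_n)⁻¹z/ε) m(x_n)·f, where θ_n is a cutoff θ scaled to the cube Ω_n. The cutoff makes the
oscillating function smooth although the lattice changes from cube to cube. By Hölder, the layers
where θ_n < 1 contribute little, uniformly in ε; the limit ε → 0 is taken with θ fixed, and θ → 1
afterwards (`CutoffApprox.eq_zero_of_tendsto`). A derivative of θ_n costs ε^{-r}, while integrating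
by parts in the direction ε D(x_n) v gains ε, so the remainders are of order ε + ε^{1-r} and vanish.

Taking Φ = 1 shows that the means over Y of W and G are w and ∇w. Taking Φ = ∂_vΨ against w^ε shows
that W has no y-gradient, so W = w. Taking Φ = ∂_vΨ against ∇w^ε, together with the symmetry of the
second derivatives of the oscillating test function, shows that D_xᵀG is curl-free in y on the
torus.

So H = D_xᵀ(G - ∇w) is periodic, curl-free and of mean zero in y, and the average of line integrals
u(x,y) = ∫_Y ∫_0^1 s·H(x, y - ts) dt ds has ∇_y u = H (`integral_potential_mul_fderiv`). The formula
is explicit and linear, so u is jointly measurable and in `L^p`; the corrector is w₁(x,z) = u(x,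
D_x⁻¹z).

The y-gradient of T(w^ε) is ε times a bounded field and tends to 0. Convergence in L^p(Ω;
W^{1,p}(Y)) is then tested on the pair (function, gradient), through an isometric embedding and
Hahn–Banach. -/

namespace LPUnfold

/-! ### Riesz representation of functionals on `L^p` of a finite measure -/

section Riesz

variable {α : Type*} [MeasurableSpace α] {μ : Measure α} [IsFiniteMeasure μ] {p q : ℝ≥0∞}

/-- The signed measure `A ↦ F (1_A)` attached to a functional `F` on `L^p`. -/
noncomputable def functionalSignedMeasure [Fact (1 ≤ p)] (hp : p ≠ ⊤) (F : Lp ℝ p μ →L[ℝ] ℝ) :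
    SignedMeasure α := by
  classical
  exact
  { measureOf' := fun A => if hA : MeasurableSet A then
      F (indicatorConstLp p hA (measure_ne_top μ A) 1) else 0
    empty' := by simp
    not_measurable' := fun A hA => by simp [hA]
    m_iUnion' := by
      intro A hA hd
      simp only [hA, MeasurableSet.iUnion hA, dite_true]
      have hfin : ∀ s : Finset ℕ, MeasurableSet (⋃ i ∈ s, A i) :=
        fun s => s.measurableSet_biUnion fun i _ => hA i
      have hsum : ∀ s : Finset ℕ, ∑ i ∈ s, F (indicatorConstLp p (hA i) (measure_ne_top μ _) 1) =
          F (indicatorConstLp p (hfin s) (measure_ne_top μ _) 1) := by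
        intro s
        rw [← map_sum]
        congr 1
        induction s using Finset.induction_on with
        | empty => simp
        | insert i s his ih =>
          rw [Finset.sum_insert his, ih]
          have hdis : A i ∩ (⋃ j ∈ s, A j) = ∅ := by
            rw [← Set.disjoint_iff_inter_eq_empty]
            simp only [Set.disjoint_iUnion_right]
            intro j hj
            exact hd (fun h => his (h ▸ hj))
          rw [← indicatorConstLp_disjoint_union (hA i) (hfin s) (measure_ne_top μ _)
            (measure_ne_top μ _) (Set.disjoint_iff_inter_eq_empty.2 hdis)]
          congr 1
          simp
      unfold HasSum
      rw [SummationFilter.unconditional_filter]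
      simp only [hsum]
      -- Countable additivity: the finite unions miss sets of measure tending to 0, and for p < ∞
      -- this forces convergence of the indicators in `L^p`.
      refine (F.continuous.tendsto _).comp (tendsto_indicatorConstLp_set hp ?_)
      have h1 : Tendsto (fun s : Finset ℕ => μ (⋃ i ∈ s, A i)) atTop (𝓝 (μ (⋃ i, A i))) := by
        have := tendsto_measure_iUnion_atTop (μ := μ) (s := fun s : Finset ℕ => ⋃ i ∈ s, A i)
          (fun s t hst => Set.biUnion_mono hst fun _ _ => le_rfl)
        rwa [show (⋃ s : Finset ℕ, ⋃ i ∈ s, A i) = ⋃ i, A i from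
          (Set.iUnion_eq_iUnion_finset A).symm] at this
      have h2 : ∀ s : Finset ℕ, μ (symmDiff (⋃ i ∈ s, A i) (⋃ i, A i)) =
          μ (⋃ i, A i) - μ (⋃ i ∈ s, A i) := by
        intro s
        have hsub : (⋃ i ∈ s, A i) ⊆ ⋃ i, A i := Set.iUnion₂_subset_iUnion _ _
        rw [Set.symmDiff_def, Set.sdiff_eq_empty.2 hsub, Set.empty_union,
          measure_sdiff hsub (hfin s).nullMeasurableSet (measure_ne_top μ _)]
      simp only [h2]
      have := ENNReal.Tendsto.sub (tendsto_const_nhds (x := μ (⋃ i, A i)) (f := atTop)) h1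
        (Or.inl (measure_ne_top μ _))
      simpa using this }

/-- Radon–Nikodym: the signed measure of F is absolutely continuous because the indicator of a null
set is zero in `L^p`. -/
theorem exists_density [Fact (1 ≤ p)] (hp : p ≠ ⊤) (F : Lp ℝ p μ →L[ℝ] ℝ) :
    ∃ g : α → ℝ, Measurable g ∧ Integrable g μ ∧ ∀ (A : Set α) (hA : MeasurableSet A),
      F (indicatorConstLp p hA (measure_ne_top μ A) 1) = ∫ x in A, g x ∂μ := by
  set s := functionalSignedMeasure hp F with hs
  have hsA : ∀ (A : Set α) (hA : MeasurableSet A),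
      s A = F (indicatorConstLp p hA (measure_ne_top μ A) 1) := by
    intro A hA
    classical
    exact dif_pos hA
  have hac : s ≪ᵥ μ.toENNRealVectorMeasure := by
    refine VectorMeasure.AbsolutelyContinuous.mk fun A hA h0 => ?_
    rw [Measure.toENNRealVectorMeasure_apply_measurable hA] at h0
    rw [hsA A hA]
    have : indicatorConstLp p hA (measure_ne_top μ A) (1 : ℝ) = 0 := by
      rw [← indicatorConstLp_empty (μ := μ) (p := p) (c := (1 : ℝ))]
      exact (indicatorConstLp_inj hA (measure_ne_top μ _) _ _ one_ne_zero).2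
        (by simpa using ae_eq_empty.2 h0)
    rw [this, map_zero]
  refine ⟨s.rnDeriv μ, s.measurable_rnDeriv μ, s.integrable_rnDeriv μ, fun A hA => ?_⟩
  rw [← withDensityᵥ_apply (s.integrable_rnDeriv μ) hA, s.withDensityᵥ_rnDeriv_eq μ hac, hsA]

variable [Fact (1 ≤ p)] [Fact (1 ≤ q)]

/-- The functional `f ↦ ∫ f g`, as a bounded bilinear map on `L^q × L^p`. -/
noncomputable def lpDuality (μ : Measure α) (p q : ℝ≥0∞) [Fact (1 ≤ p)] [Fact (1 ≤ q)]
    [q.HolderConjugate p] : Lp ℝ q μ →L[ℝ] Lp ℝ p μ →L[ℝ] ℝ :=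
  (ContinuousLinearMap.mul ℝ ℝ).lpPairing μ q p

omit [IsFiniteMeasure μ] in
theorem lpDuality_apply [q.HolderConjugate p] (g : Lp ℝ q μ) (f : Lp ℝ p μ) :
    lpDuality μ p q g f = ∫ x, g x * f x ∂μ := by
  simp [lpDuality, ContinuousLinearMap.lpPairing_eq_integral]

/-- For p < ∞ the linear span of the indicators is dense. -/
theorem ext_of_indicator (hp : p ≠ ⊤) {F G : Lp ℝ p μ →L[ℝ] ℝ}
    (h : ∀ (A : Set α) (hA : MeasurableSet A),
      F (indicatorConstLp p hA (measure_ne_top μ A) 1) =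
        G (indicatorConstLp p hA (measure_ne_top μ A) 1)) : F = G := by
  ext f
  induction f using Lp.induction hp with
  | indicatorConst c hs hμs =>
    rename_i s
    have : indicatorConstLp p hs hμs.ne c = c • indicatorConstLp p hs hμs.ne (1 : ℝ) := by
      rw [indicatorConstLp, indicatorConstLp, ← MemLp.toLp_const_smul]
      congr 1
      ext x
      by_cases hx : x ∈ s <;> simp [hx]
    rw [Lp.simpleFunc.coe_indicatorConst, this, map_smul, map_smul, h]
  | add hf hg _ h1 h2 => rw [map_add, map_add, h1, h2]
  | isClosed => exact isClosed_eq F.continuous G.continuous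

/-- The Radon–Nikodym density is a priori only integrable. Its truncations are bounded, hence in
`L^q`, and testing F against their Hölder extremals bounds their `L^q` norms by ‖F‖; Fatou then puts
the density itself in `L^q`. -/
theorem exists_lp_representation [q.HolderConjugate p] (hp₁ : 1 < p) (hp : p ≠ ⊤) (hq : q ≠ ⊤)
    (F : Lp ℝ p μ →L[ℝ] ℝ) : ∃ g : Lp ℝ q μ, F = lpDuality μ p q g := by
  obtain ⟨g, hgm, hgi, hg⟩ := exists_density hp F
  have hpq : p.toReal.HolderConjugate q.toReal := by
    have : p.HolderConjugate q := ENNReal.HolderConjugate.symm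
    exact ENNReal.HolderConjugate.toReal_of_ne_top hp hq
  have hp0 : p ≠ 0 := (zero_lt_one.trans hp₁).ne'
  have hq0 : q ≠ 0 := (lt_of_lt_of_le zero_lt_one (Fact.out : 1 ≤ q)).ne'
  set B : ℕ → Set α := fun n => {x | |g x| ≤ n} with hB
  have hBm : ∀ n, MeasurableSet (B n) := fun n => measurableSet_le hgm.norm measurable_const
  have hgnm : ∀ n, Measurable ((B n).indicator g) := fun n => hgm.indicator (hBm n)
  have hgnb : ∀ n x, ‖(B n).indicator g x‖ ≤ n := by
    intro n x
    by_cases hx : x ∈ B n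
    · rw [indicator_of_mem hx]; exact hx
    · simp [hx]
  have hgnL : ∀ n, MemLp ((B n).indicator g) q μ := fun n =>
    MemLp.of_bound (hgnm n).aestronglyMeasurable n (Eventually.of_forall (hgnb n))
  have hbound : ∀ n, eLpNorm ((B n).indicator g) q μ ≤ ENNReal.ofReal ‖F‖ := by
    intro n
    -- Multiplication by the indicator of B n: composed with F it becomes the pairing with the
    -- truncated density.
    set M : Lp ℝ p μ →L[ℝ] Lp ℝ p μ := (ContinuousLinearMap.mul ℝ ℝ).holderL μ ⊤ p p
      (indicatorConstLp ⊤ (hBm n) (measure_ne_top μ _) (1 : ℝ)) with hM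
    have hMf : ∀ f : Lp ℝ p μ, M f =ᵐ[μ] (B n).indicator f := by
      intro f
      have h1 := ContinuousLinearMap.coeFn_holder (r := p) (ContinuousLinearMap.mul ℝ ℝ)
        (indicatorConstLp ⊤ (hBm n) (measure_ne_top μ _) (1 : ℝ)) f
      have h2 := indicatorConstLp_coeFn (p := ⊤) (hs := hBm n) (hμs := measure_ne_top μ _)
        (c := (1 : ℝ))
      filter_upwards [h1, h2] with x hx1 hx2
      refine hx1.trans ?_
      rw [hx2]
      by_cases hx : x ∈ B n <;> simp [hx]
    have hFM : F.comp M = lpDuality μ p q (hgnL n).toLp := by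
      refine ext_of_indicator hp fun A hA => ?_
      have hMA : M (indicatorConstLp p hA (measure_ne_top μ A) 1) =
          indicatorConstLp p (hA.inter (hBm n)) (measure_ne_top μ _) 1 := by
        refine Lp.ext ?_
        filter_upwards [hMf (indicatorConstLp p hA (measure_ne_top μ A) 1),
          indicatorConstLp_coeFn (p := p) (hs := hA) (hμs := measure_ne_top μ _) (c := (1 : ℝ)),
          indicatorConstLp_coeFn (p := p) (hs := hA.inter (hBm n)) (hμs := measure_ne_top μ _)
            (c := (1 : ℝ))] with x h1 h2 h3
        rw [h1, h3]
        by_cases hx : x ∈ B n <;> by_cases hxA : x ∈ A <;> simp [hx, hxA, h2]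
      rw [ContinuousLinearMap.comp_apply, hMA, hg, lpDuality_apply,
        ← integral_indicator (hA.inter (hBm n))]
      refine integral_congr_ae ?_
      filter_upwards [(hgnL n).coeFn_toLp, indicatorConstLp_coeFn (p := p) (hs := hA)
        (hμs := measure_ne_top μ _) (c := (1 : ℝ))] with x h1 h2
      rw [h1, h2]
      by_cases hx : x ∈ B n <;> by_cases hxA : x ∈ A <;> simp [hx, hxA]
    set gn := (B n).indicator g with hgn
    -- The Hölder extremal: |f|^p = |gn|^q and f · gn = |gn|^q.
    set f : α → ℝ := fun x => SignType.sign (gn x) * |gn x| ^ (q.toReal - 1) with hf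
    have hq1 : 0 < q.toReal - 1 := hpq.symm.sub_one_pos
    have habs : ∀ x, |f x| = |gn x| ^ (q.toReal - 1) := by
      intro x
      rw [hf]
      simp only [abs_mul, abs_of_nonneg (Real.rpow_nonneg (abs_nonneg _) _)]
      rcases eq_or_ne (gn x) 0 with h0 | h0
      · simp [h0, Real.zero_rpow hq1.ne']
      · rcases lt_or_gt_of_ne h0 with h | h <;> simp [h]
    have hfm : Measurable f := by
      have h1 : Measurable fun x => ((SignType.sign (gn x) : SignType) : ℝ) := by
        have : (fun x => ((SignType.sign (gn x) : SignType) : ℝ)) =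
            fun x => if 0 < gn x then 1 else if gn x < 0 then -1 else 0 := by
          funext x
          rw [sign_apply]
          split_ifs <;> simp
        rw [this]
        exact Measurable.ite (measurableSet_lt measurable_const (hgnm n)) measurable_const
          (Measurable.ite (measurableSet_lt (hgnm n) measurable_const) measurable_const
            measurable_const)
      exact h1.mul ((hgnm n).norm.pow_const _)
    have hfL : MemLp f p μ := by
      refine MemLp.of_bound hfm.aestronglyMeasurable ((n : ℝ) ^ (q.toReal - 1))
        (Eventually.of_forall fun x => ?_)
      rw [Real.norm_eq_abs, habs]
      exact Real.rpow_le_rpow (abs_nonneg _) (hgnb n x) hq1.le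
    have hMff : M hfL.toLp = hfL.toLp := by
      refine Lp.ext ?_
      filter_upwards [hMf hfL.toLp, hfL.coeFn_toLp] with x h1 h2
      rw [h1]
      by_cases hx : x ∈ B n
      · simp [hx]
      · rw [h2, indicator_of_notMem hx, hf]
        simp only [hgn, indicator_of_notMem hx, sign_zero, SignType.coe_zero, zero_mul]
    set I : ℝ≥0∞ := ∫⁻ x, ‖gn x‖ₑ ^ q.toReal ∂μ with hI
    have hnorm1 : eLpNorm gn q μ = I ^ (1 / q.toReal) :=
      eLpNorm_eq_lintegral_rpow_enorm_toReal hq0 hq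
    have hnorm2 : eLpNorm f p μ = I ^ (1 / p.toReal) := by
      rw [eLpNorm_eq_lintegral_rpow_enorm_toReal hp0 hp]
      congr 1
      refine lintegral_congr fun x => ?_
      rw [← ofReal_norm, ← ofReal_norm, Real.norm_eq_abs, Real.norm_eq_abs, habs,
        ENNReal.ofReal_rpow_of_nonneg (by positivity) hpq.nonneg,
        ENNReal.ofReal_rpow_of_nonneg (by positivity) hpq.symm.nonneg, ← Real.rpow_mul (abs_nonneg _),
        hpq.symm.sub_one_mul_conj]
    have hIfin : I ≠ ⊤ := by
      intro h
      have := (hgnL n).2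
      rw [hnorm1, h, ENNReal.top_rpow_of_pos (by simpa using hpq.symm.pos)] at this
      exact lt_irrefl _ this
    have hval : F hfL.toLp = I.toReal := by
      have h1 : F hfL.toLp = (F.comp M) hfL.toLp := by rw [ContinuousLinearMap.comp_apply, hMff]
      rw [h1, hFM, lpDuality_apply]
      have h2 : ∫ x, (hgnL n).toLp gn x * hfL.toLp f x ∂μ = ∫ x, |gn x| ^ q.toReal ∂μ := by
        refine integral_congr_ae ?_
        filter_upwards [(hgnL n).coeFn_toLp, hfL.coeFn_toLp] with x h1 h2
        rw [h1, h2, hf]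
        simp only
        rw [← mul_assoc, mul_comm (gn x), sign_mul_self]
        rcases eq_or_ne (gn x) 0 with h0 | h0
        · simp [h0, Real.zero_rpow hpq.symm.ne_zero]
        · rw [← Real.rpow_one_add' (abs_nonneg _) (by ring_nf; exact hpq.symm.ne_zero)]
          congr 1; ring
      rw [h2, integral_eq_lintegral_of_nonneg_ae (Eventually.of_forall fun x => by positivity)
        ((hgnm n).abs.pow_const _).aestronglyMeasurable]
      congr 1
      refine lintegral_congr fun x => ?_
      rw [← ofReal_norm, ENNReal.ofReal_rpow_of_nonneg (by positivity) hpq.symm.nonneg,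
        Real.norm_eq_abs]
    -- Here I is the q-th power of the `L^q` norm of gn, and F f = I. Dividing by I^(1/p) leaves
    -- I^(1/q), the norm to be bounded.
    have hle : I ≤ ENNReal.ofReal ‖F‖ * I ^ (1 / p.toReal) := by
      have h1 : I.toReal ≤ ‖F‖ * ‖hfL.toLp‖ := by
        rw [← hval]
        exact (le_abs_self _).trans (F.le_opNorm _)
      rw [Lp.norm_toLp, hnorm2] at h1
      rw [← ENNReal.ofReal_toReal hIfin]
      refine (ENNReal.ofReal_le_ofReal h1).trans ?_
      rw [ENNReal.ofReal_mul (norm_nonneg _), ENNReal.ofReal_toReal hIfin,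
        ENNReal.ofReal_toReal (ENNReal.rpow_ne_top_of_nonneg (by simp) hIfin)]
    rw [hnorm1]
    rcases eq_or_ne I 0 with h0 | h0
    · rw [h0, ENNReal.zero_rpow_of_pos (by simpa using hpq.symm.pos)]
      exact zero_le
    · have h1 : I = I ^ (1 / q.toReal) * I ^ (1 / p.toReal) := by
        rw [← ENNReal.rpow_add _ _ h0 hIfin, one_div, one_div, add_comm, hpq.inv_add_inv_eq_one,
          ENNReal.rpow_one]
      rw [h1] at hle
      have h3 : (I ^ (1 / q.toReal) * I ^ (1 / p.toReal)) ^ (1 / p.toReal) = I ^ (1 / p.toReal) := by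
        rw [← h1]
      rw [h3] at hle
      refine (ENNReal.mul_le_mul_iff_left ?_ ?_).1 hle
      · exact (ENNReal.rpow_pos (pos_iff_ne_zero.2 h0) hIfin).ne'
      · exact ENNReal.rpow_ne_top_of_nonneg (by simp) hIfin
  have hgL : MemLp g q μ := by
    refine ⟨hgm.aestronglyMeasurable, ?_⟩
    have hlim : ∀ x, Tendsto (fun n => (B n).indicator g x) atTop (𝓝 (g x)) := by
      intro x
      obtain ⟨N, hN⟩ := exists_nat_ge |g x|
      refine tendsto_const_nhds.congr' ?_
      filter_upwards [eventually_ge_atTop N] with n hn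
      have : x ∈ B n := hN.trans (by exact_mod_cast hn)
      simp [this]
    have := Lp.eLpNorm_lim_le_liminf_eLpNorm (p := q) (μ := μ)
      (fun n => (hgnm n).aestronglyMeasurable) g (Eventually.of_forall hlim)
    refine lt_of_le_of_lt (this.trans ?_) (ENNReal.ofReal_lt_top (r := ‖F‖))
    exact Filter.liminf_le_of_frequently_le' (Frequently.of_forall hbound)
  refine ⟨hgL.toLp, ext_of_indicator hp fun A hA => ?_⟩
  rw [hg, lpDuality_apply, ← integral_indicator hA]
  refine integral_congr_ae ?_
  filter_upwards [hgL.coeFn_toLp, indicatorConstLp_coeFn (p := p) (hs := hA)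
    (hμs := measure_ne_top μ _) (c := (1 : ℝ))] with x h1 h2
  rw [h1, h2]
  by_cases hxA : x ∈ A <;> simp [hxA]

end Riesz

/-! ### Weak convergence and weak sequential compactness -/

section WeakCompactness

variable {X Z : Type*} [NormedAddCommGroup X] [NormedSpace ℝ X] [NormedAddCommGroup Z]
  [NormedSpace ℝ Z]

theorem WeakTendsto.comp_strictMono {u : ℕ → X} {v : X} (h : WeakTendsto u v) {φ : ℕ → ℕ}
    (hφ : StrictMono φ) : WeakTendsto (fun k => u (φ k)) v :=
  Tendsto.comp (f := φ) (g := fun k => toWeakSpace ℝ X (u k)) h hφ.tendsto_atTop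

theorem WeakTendsto.map {u : ℕ → X} {v : X} (h : WeakTendsto u v) (T : X →L[ℝ] Z) :
    WeakTendsto (fun k => T (u k)) (T v) := by
  rw [weakTendsto_iff] at h ⊢
  exact fun F => h (F.comp T)

theorem WeakTendsto.add {u u' : ℕ → X} {v v' : X} (h : WeakTendsto u v) (h' : WeakTendsto u' v') :
    WeakTendsto (fun k => u k + u' k) (v + v') := by
  rw [weakTendsto_iff] at h h' ⊢
  intro F
  simpa using (h F).add (h' F)

theorem WeakTendsto.sum {ι : Type*} (s : Finset ι) {u : ℕ → ι → X} {v : ι → X}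
    (h : ∀ i ∈ s, WeakTendsto (fun k => u k i) (v i)) :
    WeakTendsto (fun k => ∑ i ∈ s, u k i) (∑ i ∈ s, v i) := by
  simp only [weakTendsto_iff] at h ⊢
  intro F
  simp only [map_sum]
  exact tendsto_finsetSum s fun i hi => h i hi F

theorem WeakTendsto.prodMk {u : ℕ → X} {v : X} {u' : ℕ → Z} {v' : Z} (h : WeakTendsto u v)
    (h' : WeakTendsto u' v') : WeakTendsto (fun k => (u k, u' k)) (v, v') := by
  have h1 := (h.map (ContinuousLinearMap.inl ℝ X Z)).add (h'.map (ContinuousLinearMap.inr ℝ X Z))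
  simpa using h1

/-- Hahn–Banach: every functional on S is the restriction of one on X. -/
theorem WeakTendsto.codRestrict {S : Submodule ℝ X} {u : ℕ → S} {v : S}
    (h : WeakTendsto (fun k => (u k : X)) v) : WeakTendsto u v := by
  rw [weakTendsto_iff] at h ⊢
  intro F
  obtain ⟨G, hG, -⟩ := exists_extension_norm_eq S F
  simpa [hG] using h G

/-- Uniform boundedness principle, applied in the bidual. -/
theorem WeakTendsto.exists_norm_le {u : ℕ → X} {v : X} (h : WeakTendsto u v) :
    ∃ M : ℝ, ∀ k, ‖u k‖ ≤ M := by
  rw [weakTendsto_iff] at h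
  obtain ⟨M, hM⟩ := banach_steinhaus (g := fun k => NormedSpace.inclusionInDoubleDual ℝ X (u k))
    (fun F => by
      obtain ⟨B, hB⟩ := (Metric.isBounded_range_of_tendsto _ (h F)).exists_norm_le
      exact ⟨B, fun k => by simpa using hB _ (mem_range_self k)⟩)
  refine ⟨M, fun k => ?_⟩
  have h1 : ‖NormedSpace.inclusionInDoubleDual ℝ X (u k)‖ = ‖u k‖ :=
    (NormedSpace.inclusionInDoubleDualLi ℝ).norm_map (u k)
  rw [← h1]
  exact hM k

variable {α : Type*} [MeasurableSpace α] [MeasurableSpace.CountablyGenerated α] {μ : Measure α}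
  [IsFiniteMeasure μ] {p : ℝ≥0∞} [Fact (1 ≤ p)]

/-- View the sequence as functionals on the separable space `L^q`. The sequential Banach–Alaoglu
theorem gives a weak-* limit, which the Riesz representation turns back into an element of `L^p`;
the same theorem for `L^p` shows that the convergence is weak. -/
theorem exists_weakTendsto_subseq (hp₁ : 1 < p) (hp : p ≠ ⊤) {u : ℕ → Lp ℝ p μ} {M : ℝ}
    (hu : ∀ k, ‖u k‖ ≤ M) :
    ∃ (φ : ℕ → ℕ) (v : Lp ℝ p μ), StrictMono φ ∧ WeakTendsto (fun k => u (φ k)) v := by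
  set q := p.conjExponent with hqdef
  have hpq : p.HolderConjugate q := ENNReal.HolderConjugate.conjExponent hp₁.le
  have hqp : q.HolderConjugate p := hpq.symm
  have hq1 : 1 < q := by
    have := ENNReal.HolderConjugate.lt_top_iff_one_lt p q
    exact this.1 hp.lt_top
  have hqt : q ≠ ⊤ := by
    have := ENNReal.HolderConjugate.lt_top_iff_one_lt q p
    exact (this.2 hp₁).ne
  have : Fact (1 ≤ q) := ⟨hq1.le⟩
  have : Fact (q ≠ ⊤) := ⟨hqt⟩
  set ℓ : ℕ → (Lp ℝ q μ →L[ℝ] ℝ) := fun k => lpDuality μ q p (u k) with hℓ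
  have hbd : ∀ k, ℓ k ∈ Metric.closedBall (0 : Lp ℝ q μ →L[ℝ] ℝ) (‖lpDuality μ q p‖ * M) := by
    intro k
    rw [mem_closedBall_zero_iff]
    exact ((lpDuality μ q p).le_opNorm _).trans
      (mul_le_mul_of_nonneg_left (hu k) (norm_nonneg _))
  obtain ⟨L, -, φ, hφ, hL⟩ := WeakDual.isSeqCompact_closedBall ℝ (Lp ℝ q μ) 0
    (‖lpDuality μ q p‖ * M) (x := fun k => StrongDual.toWeakDual (ℓ k)) (fun k => hbd k)
  obtain ⟨v, hv⟩ := exists_lp_representation (p := q) (q := p) hq1 hqt hp (WeakDual.toStrongDual L)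
  refine ⟨φ, v, hφ, ?_⟩
  rw [weakTendsto_iff]
  intro F
  obtain ⟨g, rfl⟩ := exists_lp_representation (p := p) (q := q) hp₁ hp hqt F
  have h1 := (WeakDual.eval_continuous g).tendsto L |>.comp hL
  have h2 : ∀ f : Lp ℝ p μ, lpDuality μ p q g f = lpDuality μ q p f g := by
    intro f
    simp only [lpDuality_apply, mul_comm]
  have h3 : L g = lpDuality μ q p v g := by rw [← hv]; rfl
  simp only [h2]
  rw [← h3]
  exact h1

theorem exists_weakTendsto_subseq_finset {ι : Type*} (hp₁ : 1 < p) (hp : p ≠ ⊤)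
    {u : ℕ → ι → Lp ℝ p μ} {M : ℝ} (hu : ∀ k i, ‖u k i‖ ≤ M) (s : Finset ι) :
    ∃ (φ : ℕ → ℕ) (v : ι → Lp ℝ p μ), StrictMono φ ∧
      ∀ i ∈ s, WeakTendsto (fun k => u (φ k) i) (v i) := by
  classical
  induction s using Finset.induction_on with
  | empty => exact ⟨id, 0, strictMono_id, by simp⟩
  | insert j s hj ih =>
    obtain ⟨φ, v, hφ, hv⟩ := ih
    obtain ⟨ψ, v', hψ, hv'⟩ := exists_weakTendsto_subseq hp₁ hp (u := fun k => u (φ k) j)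
      (fun k => hu _ _)
    refine ⟨φ ∘ ψ, Function.update v j v', hφ.comp hψ, fun i hi => ?_⟩
    rcases Finset.mem_insert.1 hi with rfl | hi
    · simpa using hv'
    · rw [Function.update_of_ne (by rintro rfl; exact hj ‹i ∈ s›)]
      exact (hv i hi).comp_strictMono hψ

/-- The `i`-th component of an `L^p` vector field. -/
noncomputable def lpCoord {d : ℕ} (p : ℝ≥0∞) [Fact (1 ≤ p)] (μ : Measure α) (i : Fin d) :
    Lp (E d) p μ →L[ℝ] Lp ℝ p μ :=
  (EuclideanSpace.proj (𝕜 := ℝ) i).compLpL p μ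

/-- The `L^p` vector field with `i`-th component `f` and vanishing other components. -/
noncomputable def lpSingle {d : ℕ} (p : ℝ≥0∞) [Fact (1 ≤ p)] (μ : Measure α) (i : Fin d) :
    Lp ℝ p μ →L[ℝ] Lp (E d) p μ :=
  ((ContinuousLinearMap.id ℝ ℝ).smulRight (EuclideanSpace.single i (1 : ℝ))).compLpL p μ

omit [MeasurableSpace.CountablyGenerated α] [IsFiniteMeasure μ] in
theorem lpCoord_ae {d : ℕ} (i : Fin d) (u : Lp (E d) p μ) :
    lpCoord p μ i u =ᵐ[μ] fun x => u x i :=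
  ContinuousLinearMap.coeFn_compLpL _ _

omit [MeasurableSpace.CountablyGenerated α] [IsFiniteMeasure μ] in
theorem lpSingle_ae {d : ℕ} (i : Fin d) (u : Lp ℝ p μ) :
    lpSingle p μ i u =ᵐ[μ] fun x => u x • EuclideanSpace.single i (1 : ℝ) :=
  ContinuousLinearMap.coeFn_compLpL _ _

omit [MeasurableSpace.CountablyGenerated α] [IsFiniteMeasure μ] in
theorem sum_lpSingle_lpCoord {d : ℕ} (u : Lp (E d) p μ) :
    ∑ i, lpSingle p μ i (lpCoord p μ i u) = u := by
  refine Lp.ext ?_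
  have h1 : ∀ᵐ x ∂μ, ∀ i, lpSingle p μ i (lpCoord p μ i u) x =
      u x i • EuclideanSpace.single i (1 : ℝ) := by
    rw [ae_all_iff]
    intro i
    filter_upwards [lpSingle_ae i (lpCoord p μ i u), lpCoord_ae i u] with x h1 h2
    rw [h1, h2]
  filter_upwards [h1, Lp.coeFn_finsetSum Finset.univ fun i => lpSingle p μ i (lpCoord p μ i u)]
    with x h1 h2
  rw [h2, Finset.sum_apply]
  simp only [h1]
  ext j
  simp [Finset.sum_apply, Pi.single_apply]

omit [MeasurableSpace.CountablyGenerated α] [IsFiniteMeasure μ] in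
-- Reassembles a field from its components, so that the scalar Riesz theorem suffices for vector
-- fields.
theorem weakTendsto_of_coord {d : ℕ} {U : ℕ → Lp (E d) p μ} {V : Fin d → Lp ℝ p μ}
    (h : ∀ i, WeakTendsto (fun k => lpCoord p μ i (U k)) (V i)) :
    WeakTendsto U (∑ i, lpSingle p μ i (V i)) := by
  have := WeakTendsto.sum Finset.univ fun i _ => (h i).map (lpSingle p μ i)
  simpa only [sum_lpSingle_lpCoord] using this

theorem exists_weakTendsto_subseq_prod {d : ℕ} (hp₁ : 1 < p) (hp : p ≠ ⊤) {u : ℕ → Lp ℝ p μ}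
    {U : ℕ → Lp (E d) p μ} {M : ℝ} (hu : ∀ k, ‖u k‖ ≤ M) (hU : ∀ k, ‖U k‖ ≤ M) :
    ∃ (φ : ℕ → ℕ) (v : Lp ℝ p μ) (V : Lp (E d) p μ), StrictMono φ ∧
      WeakTendsto (fun k => u (φ k)) v ∧ WeakTendsto (fun k => U (φ k)) V := by
  obtain ⟨φ, v, hφ, hv⟩ := exists_weakTendsto_subseq hp₁ hp hu
  obtain ⟨ψ, V, hψ, hV⟩ := exists_weakTendsto_subseq_finset hp₁ hp
    (u := fun k i => lpCoord p μ i (U (φ k)))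
    (M := (∑ i, ‖lpCoord (d := d) p μ i‖) * M) (fun k i => by
      refine ((lpCoord p μ i).le_opNorm _).trans ?_
      refine mul_le_mul ?_ (hU _) (norm_nonneg _) (Finset.sum_nonneg fun _ _ => norm_nonneg _)
      exact Finset.single_le_sum (f := fun i => ‖lpCoord (d := d) p μ i‖)
        (fun _ _ => norm_nonneg _) (Finset.mem_univ i)) Finset.univ
  exact ⟨φ ∘ ψ, v, _, hφ.comp hψ, hv.comp_strictMono hψ,
    weakTendsto_of_coord fun i => hV i (Finset.mem_univ i)⟩

end WeakCompactness

/-! ### `L^p` on a product as a Bochner space of `L^p` sections -/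

section Curry

/-- Open sets are countable unions of balls, and the preimage of a ball is described by one distance
function. -/
theorem measurable_of_measurable_dist {α X : Type*} [MeasurableSpace α] [PseudoMetricSpace X]
    [SecondCountableTopology X] [MeasurableSpace X] [BorelSpace X] {f : α → X}
    (h : ∀ c, Measurable fun x => dist (f x) c) : Measurable f := by
  refine measurable_of_isOpen fun U hU => ?_
  choose! r hr0 hr using Metric.isOpen_iff.1 hU
  obtain ⟨T, hT, hTU⟩ := TopologicalSpace.isOpen_iUnion_countable
    (fun c : U => Metric.ball (c : X) (r c)) fun _ => Metric.isOpen_ball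
  have hU' : U = ⋃ c : U, Metric.ball (c : X) (r c) := by
    refine Set.Subset.antisymm (fun x hx => ?_) (Set.iUnion_subset fun c => hr c c.2)
    exact Set.mem_iUnion.2 ⟨⟨x, hx⟩, Metric.mem_ball_self (hr0 x hx)⟩
  rw [hU', ← hTU, Set.preimage_iUnion₂]
  exact MeasurableSet.biUnion hT fun c _ => measurableSet_lt (h c) measurable_const

/-- Weak convergence passes to the range of T by Hahn–Banach, and the inverse on the range is
continuous. -/
theorem WeakTendsto.of_linearIsometry {X Z : Type*} [NormedAddCommGroup X] [NormedSpace ℝ X]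
    [NormedAddCommGroup Z] [NormedSpace ℝ Z] (T : X →ₗᵢ[ℝ] Z) {u : ℕ → X} {v : X}
    (h : WeakTendsto (fun k => T (u k)) (T v)) : WeakTendsto u v := by
  have h1 : WeakTendsto (fun k => T.equivRange (u k)) (T.equivRange v) :=
    WeakTendsto.codRestrict (S := LinearMap.range T.toLinearMap) h
  have h2 := h1.map (T.equivRange.symm.toContinuousLinearEquiv.toContinuousLinearMap)
  simpa using h2

variable {α β : Type*} [MeasurableSpace α] [MeasurableSpace β] {μ : Measure α} {ν : Measure β}
  [SFinite μ] [SFinite ν] {F : Type*} [NormedAddCommGroup F] [NormedSpace ℝ F]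
  {p : ℝ≥0∞} [Fact (1 ≤ p)]

open Classical in
/-- The section `f(x, ·)` in `L^p`, with junk value `0`. -/
noncomputable def sectionLp (p : ℝ≥0∞) (ν : Measure β) (f : α × β → F) (x : α) : Lp F p ν :=
  if h : MemLp (fun y => f (x, y)) p ν then h.toLp else 0

omit [SFinite μ] [SFinite ν] [NormedSpace ℝ F] in
theorem lintegral_rpow_lt_top {f : α → F} (hp : p ≠ ⊤) (hf : MemLp f p μ) :
    ∫⁻ x, ‖f x‖ₑ ^ p.toReal ∂μ < ⊤ :=
  lintegral_rpow_enorm_lt_top_of_eLpNorm_lt_top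
    (zero_lt_one.trans_le (Fact.out : 1 ≤ p)).ne' hp hf.2

omit [SFinite μ] [NormedSpace ℝ F] in
theorem ae_memLp_section (hp : p ≠ ⊤) {f : α × β → F} (hf : MemLp f p (μ.prod ν)) :
    ∀ᵐ x ∂μ, MemLp (fun y => f (x, y)) p ν := by
  have h0 : p ≠ 0 := (zero_lt_one.trans_le (Fact.out : 1 ≤ p)).ne'
  have h1 := lintegral_rpow_lt_top hp hf
  rw [lintegral_prod _ (hf.1.enorm.pow_const _)] at h1
  filter_upwards [ae_lt_top' (hf.1.enorm.pow_const _).lintegral_prod_right' h1.ne,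
    hf.1.prodMk_left] with x hx hx'
  refine ⟨hx', ?_⟩
  exact (eLpNorm_lt_top_iff_lintegral_rpow_enorm_lt_top h0 hp).2 hx

omit [SFinite μ] [NormedSpace ℝ F] in
theorem sectionLp_ae (hp : p ≠ ⊤) {f : α × β → F} (hf : MemLp f p (μ.prod ν)) :
    ∀ᵐ x ∂μ, sectionLp p ν f x =ᵐ[ν] fun y => f (x, y) := by
  filter_upwards [ae_memLp_section hp hf] with x hx
  rw [sectionLp, dif_pos hx]
  exact hx.coeFn_toLp

omit [SFinite μ] [NormedAddCommGroup F] [NormedSpace ℝ F] in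
theorem ae_ae_of_eq {f g : α × β → F} (h : f =ᵐ[μ.prod ν] g) :
    ∀ᵐ x ∂μ, (fun y => f (x, y)) =ᵐ[ν] fun y => g (x, y) :=
  Measure.ae_ae_of_ae_prod h

omit [SFinite μ] [NormedSpace ℝ F] in
theorem eLpNorm_sectionLp (hp : p ≠ ⊤) {f : α × β → F} (hf : MemLp f p (μ.prod ν)) :
    eLpNorm (sectionLp p ν f) p μ = eLpNorm f p (μ.prod ν) := by
  have h0 : p ≠ 0 := (zero_lt_one.trans_le (Fact.out : 1 ≤ p)).ne'
  have hp0 : p.toReal ≠ 0 := ENNReal.toReal_ne_zero.2 ⟨h0, hp⟩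
  rw [eLpNorm_eq_lintegral_rpow_enorm_toReal h0 hp, eLpNorm_eq_lintegral_rpow_enorm_toReal h0 hp,
    lintegral_prod _ (hf.1.enorm.pow_const _)]
  congr 1
  refine lintegral_congr_ae ?_
  filter_upwards [ae_memLp_section hp hf] with x hx
  rw [sectionLp, dif_pos hx, Lp.enorm_toLp, eLpNorm_eq_lintegral_rpow_enorm_toReal h0 hp,
    ← ENNReal.rpow_mul, one_div, inv_mul_cancel₀ hp0, ENNReal.rpow_one]

variable [MeasurableSpace.CountablyGenerated β] [SecondCountableTopology F]

omit [NormedSpace ℝ F] in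
-- The distance from the section to a fixed c is the root of a parameter integral, hence measurable
-- in x by Tonelli; separability of `L^p`, from p < ∞, does the rest.
theorem stronglyMeasurable_sectionLp (hp : p ≠ ⊤) {f : α × β → F}
    (hf : StronglyMeasurable f) : StronglyMeasurable (sectionLp p ν f) := by
  classical
  have h0 : p ≠ 0 := (zero_lt_one.trans_le (Fact.out : 1 ≤ p)).ne'
  have : Fact (p ≠ ⊤) := ⟨hp⟩
  have hsec : ∀ x, StronglyMeasurable fun y => f (x, y) := fun x =>
    hf.comp_measurable measurable_prodMk_left
  borelize ↥(Lp F p ν)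
  refine Measurable.stronglyMeasurable (measurable_of_measurable_dist fun c => ?_)
  have hA : MeasurableSet {x | MemLp (fun y => f (x, y)) p ν} := by
    have : {x | MemLp (fun y => f (x, y)) p ν} =
        {x | ∫⁻ y, ‖f (x, y)‖ₑ ^ p.toReal ∂ν < ⊤} := by
      ext x
      simp only [mem_ofPred_eq]
      rw [← eLpNorm_lt_top_iff_lintegral_rpow_enorm_lt_top h0 hp]
      exact ⟨fun h => h.2, fun h => ⟨(hsec x).aestronglyMeasurable, h⟩⟩
    rw [this]
    exact measurableSet_lt (hf.enorm.pow_const _).lintegral_prod_right' measurable_const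
  have hc : StronglyMeasurable (c : β → F) := Lp.stronglyMeasurable c
  have heq : (fun x => dist (sectionLp p ν f x) c) =
      {x | MemLp (fun y => f (x, y)) p ν}.piecewise
        (fun x => ((∫⁻ y, ‖f (x, y) - c y‖ₑ ^ p.toReal ∂ν) ^ (1 / p.toReal)).toReal)
        (fun _ => dist 0 c) := by
    funext x
    by_cases hx : MemLp (fun y => f (x, y)) p ν
    · rw [Set.piecewise_eq_of_mem _ _ _ (show x ∈ {x | MemLp (fun y => f (x, y)) p ν} from hx), sectionLp, dif_pos hx, Lp.dist_def,
        ← eLpNorm_eq_lintegral_rpow_enorm_toReal h0 hp]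
      congr 1
      refine eLpNorm_congr_ae ?_
      filter_upwards [hx.coeFn_toLp] with y hy
      simp [hy]
    · rw [Set.piecewise_eq_of_notMem _ _ _ (show x ∉ {x | MemLp (fun y => f (x, y)) p ν} from hx), sectionLp, dif_neg hx]
  rw [heq]
  refine Measurable.piecewise hA ?_ measurable_const
  refine Measurable.ennreal_toReal (Measurable.pow_const ?_ _)
  exact ((hf.sub (hc.comp_measurable measurable_snd)).enorm.pow_const _).lintegral_prod_right'

omit [SFinite μ] [NormedSpace ℝ F] in
theorem memLp_sectionLp (hp : p ≠ ⊤) (f : Lp F p (μ.prod ν)) :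
    MemLp (sectionLp p ν f) p μ :=
  ⟨(stronglyMeasurable_sectionLp hp (Lp.stronglyMeasurable f)).aestronglyMeasurable, by
    rw [eLpNorm_sectionLp hp (Lp.memLp f)]; exact (Lp.memLp f).2⟩

/-- The isometry `L^p(μ ⊗ ν) → L^p(μ; L^p(ν))`. -/
noncomputable def lpCurry (hp : p ≠ ⊤) : Lp F p (μ.prod ν) →ₗᵢ[ℝ] Lp (Lp F p ν) p μ where
  toFun f := MemLp.toLp (sectionLp p ν f) (memLp_sectionLp hp f)
  map_add' f g := by
    refine Lp.ext ?_
    filter_upwards [(memLp_sectionLp hp (f + g)).coeFn_toLp, (memLp_sectionLp hp f).coeFn_toLp,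
      (memLp_sectionLp hp g).coeFn_toLp, Lp.coeFn_add (memLp_sectionLp hp f).toLp
      (memLp_sectionLp hp g).toLp, ae_ae_of_eq (Lp.coeFn_add f g), sectionLp_ae hp (Lp.memLp f),
      sectionLp_ae hp (Lp.memLp g), sectionLp_ae hp (Lp.memLp (f + g))]
      with x h1 h2 h3 h4 h5 h6 h7 h8
    rw [h1, h4, Pi.add_apply, h2, h3]
    refine Lp.ext ?_
    filter_upwards [h5, h6, h7, h8, Lp.coeFn_add (sectionLp p ν f x) (sectionLp p ν g x)]
      with y e1 e2 e3 e4 e5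
    rw [e4, e5, e1, Pi.add_apply, Pi.add_apply, e2, e3]
  map_smul' c f := by
    refine Lp.ext ?_
    filter_upwards [(memLp_sectionLp hp (c • f)).coeFn_toLp, (memLp_sectionLp hp f).coeFn_toLp,
      Lp.coeFn_smul c (memLp_sectionLp hp f).toLp, ae_ae_of_eq (Lp.coeFn_smul c f),
      sectionLp_ae hp (Lp.memLp f), sectionLp_ae hp (Lp.memLp (c • f))]
      with x h1 h2 h4 h5 h6 h8
    rw [h1, RingHom.id_apply, h4, Pi.smul_apply, h2]
    refine Lp.ext ?_
    filter_upwards [h5, h6, h8, Lp.coeFn_smul c (sectionLp p ν f x)]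
      with y e1 e2 e4 e5
    rw [e4, e5, e1, Pi.smul_apply, Pi.smul_apply, e2]
  norm_map' f := by
    change ‖(memLp_sectionLp hp f).toLp‖ = ‖f‖
    rw [Lp.norm_toLp, eLpNorm_sectionLp hp (Lp.memLp f), Lp.norm_def]

omit [SFinite μ] in
theorem lpCurry_ae (hp : p ≠ ⊤) (f : Lp F p (μ.prod ν)) :
    ∀ᵐ x ∂μ, lpCurry hp f x =ᵐ[ν] fun y => f (x, y) := by
  filter_upwards [(memLp_sectionLp hp f).coeFn_toLp, sectionLp_ae hp (Lp.memLp f)] with x h1 h2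
  change (MemLp.toLp (sectionLp p ν f) (memLp_sectionLp hp f) : Lp (Lp F p ν) p μ) x =ᵐ[ν] _
  rw [h1]
  exact h2

end Curry

/-! ### Bochner spaces with values in a subspace or in a product -/

section Generic

variable {α : Type*} [MeasurableSpace α] {μ : Measure α} {p : ℝ≥0∞} [Fact (1 ≤ p)]
  {A B : Type*} [NormedAddCommGroup A] [NormedSpace ℝ A] [NormedAddCommGroup B] [NormedSpace ℝ B]

/-- The inclusion `L^p(μ; S) → L^p(μ; A)` for a subspace `S` of `A`. -/
noncomputable def lpSubtype (S : Submodule ℝ A) (p : ℝ≥0∞) [Fact (1 ≤ p)] (μ : Measure α) :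
    Lp S p μ →ₗᵢ[ℝ] Lp A p μ where
  toLinearMap := (S.subtypeL.compLpL p μ).toLinearMap
  norm_map' f := by
    change ‖S.subtypeL.compLpL p μ f‖ = ‖f‖
    rw [Lp.norm_def, Lp.norm_def]
    congr 1
    refine eLpNorm_congr_norm_ae ?_
    filter_upwards [ContinuousLinearMap.coeFn_compLpL (p := p) (μ := μ) S.subtypeL f] with x hx
    rw [hx]
    rfl

theorem lpSubtype_ae (S : Submodule ℝ A) (V : Lp S p μ) :
    lpSubtype S p μ V =ᵐ[μ] fun x => (V x : A) :=
  ContinuousLinearMap.coeFn_compLpL _ _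

/-- Redefine P as 0 on the exceptional null set; strong measurability descends along the embedding
of S. -/
theorem exists_lpSubtype_eq (S : Submodule ℝ A) (P : Lp A p μ) (h : ∀ᵐ x ∂μ, P x ∈ S) :
    ∃ V : Lp S p μ, lpSubtype S p μ V = P := by
  classical
  set V₀ : α → S := fun x => if hx : P x ∈ S then ⟨P x, hx⟩ else 0 with hV₀
  have hV₀P : (fun x => (V₀ x : A)) =ᵐ[μ] P := by
    filter_upwards [h] with x hx
    simp [hV₀, hx]
  have hL : MemLp V₀ p μ := by
    refine ⟨?_, ?_⟩
    · have h1 : AEStronglyMeasurable (fun x => (V₀ x : A)) μ :=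
        (Lp.aestronglyMeasurable P).congr hV₀P.symm
      exact (Topology.IsEmbedding.subtypeVal.aestronglyMeasurable_comp_iff).1 h1
    · refine lt_of_le_of_lt (le_of_eq ?_) (Lp.memLp P).2
      refine eLpNorm_congr_norm_ae ?_
      filter_upwards [hV₀P] with x hx
      rw [← hx]
      rfl
  refine ⟨hL.toLp, Lp.ext ?_⟩
  filter_upwards [lpSubtype_ae S (hL.toLp), hL.coeFn_toLp, hV₀P] with x h1 h2 h3
  rw [h1, h2, h3]

/-- Pairs of `L^p` functions as `L^p` functions with values in pairs. -/
noncomputable def lpPair (A B : Type*) [NormedAddCommGroup A] [NormedSpace ℝ A]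
    [NormedAddCommGroup B] [NormedSpace ℝ B] (p : ℝ≥0∞) [Fact (1 ≤ p)] (μ : Measure α) :
    Lp A p μ × Lp B p μ →L[ℝ] Lp (A × B) p μ :=
  ((ContinuousLinearMap.inl ℝ A B).compLpL p μ).coprod
    ((ContinuousLinearMap.inr ℝ A B).compLpL p μ)

theorem lpPair_ae (f : Lp A p μ) (g : Lp B p μ) :
    lpPair A B p μ (f, g) =ᵐ[μ] fun x => (f x, g x) := by
  have h0 : lpPair A B p μ (f, g) = (ContinuousLinearMap.inl ℝ A B).compLpL p μ f +
      (ContinuousLinearMap.inr ℝ A B).compLpL p μ g := rfl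
  rw [h0]
  filter_upwards [Lp.coeFn_add ((ContinuousLinearMap.inl ℝ A B).compLpL p μ f)
      ((ContinuousLinearMap.inr ℝ A B).compLpL p μ g),
    ContinuousLinearMap.coeFn_compLpL (p := p) (μ := μ) (ContinuousLinearMap.inl ℝ A B) f,
    ContinuousLinearMap.coeFn_compLpL (p := p) (μ := μ) (ContinuousLinearMap.inr ℝ A B) g]
    with x h1 h2 h3
  rw [h1, Pi.add_apply, h2, h3]
  simp

end Generic

/-! ### The Bochner space of Sobolev functions -/

section Bochner

variable {d : ℕ} {Ω U : Set (E d)} {p : ℝ≥0∞} [Fact (1 ≤ p)]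

theorem HasWeakGradient.congr {u u' : E d → ℝ} {G G' : E d → E d} (h : HasWeakGradient U u G)
    (hu : u =ᵐ[volume.restrict U] u') (hG : G =ᵐ[volume.restrict U] G') :
    HasWeakGradient U u' G' := by
  intro φ hφ i
  have h1 : ∫ x in U, u' x * pderiv i φ x = ∫ x in U, u x * pderiv i φ x :=
    integral_congr_ae (by filter_upwards [hu] with x hx; rw [hx])
  have h2 : ∫ x in U, G' x i * φ x = ∫ x in U, G x i * φ x :=
    integral_congr_ae (by filter_upwards [hG] with x hx; rw [hx])
  rw [h1, h2, h φ hφ i]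

/-- The inclusion `L^p(Ω; W^{1,p}(U)) → L^p(Ω; L^p(U) × L^p(U)^d)`. -/
noncomputable def bochnerIncl (Ω U : Set (E d)) (p : ℝ≥0∞) [Fact (1 ≤ p)] :
    Lp (W1p U p) p (volume.restrict Ω) →ₗᵢ[ℝ]
      Lp (Lp ℝ p (volume.restrict U) × Lp (E d) p (volume.restrict U)) p (volume.restrict Ω) :=
  lpSubtype (sobolevSubmodule U p) p (volume.restrict Ω)

theorem bochnerIncl_ae (V : Lp (W1p U p) p (volume.restrict Ω)) :
    bochnerIncl Ω U p V =ᵐ[volume.restrict Ω] fun x =>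
      (V x : Lp ℝ p (volume.restrict U) × Lp (E d) p (volume.restrict U)) :=
  lpSubtype_ae _ _

/-- The pair of curried functions. -/
noncomputable def bochnerPair (hp : p ≠ ⊤) (Ω U : Set (E d)) :
    Lp ℝ p ((volume.restrict Ω).prod (volume.restrict U)) ×
      Lp (E d) p ((volume.restrict Ω).prod (volume.restrict U)) →L[ℝ]
      Lp (Lp ℝ p (volume.restrict U) × Lp (E d) p (volume.restrict U)) p (volume.restrict Ω) :=
  (lpPair _ _ p (volume.restrict Ω)).comp
    ((lpCurry hp).toContinuousLinearMap.prodMap (lpCurry hp).toContinuousLinearMap)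

theorem bochnerPair_ae (hp : p ≠ ⊤)
    (f : Lp ℝ p ((volume.restrict Ω).prod (volume.restrict U)))
    (G : Lp (E d) p ((volume.restrict Ω).prod (volume.restrict U))) :
    bochnerPair hp Ω U (f, G) =ᵐ[volume.restrict Ω] fun x => (lpCurry hp f x, lpCurry hp G x) :=
  lpPair_ae (lpCurry hp f) (lpCurry hp G)

/-- Elements of the Bochner space are built from a pair of `L^p` functions on the product whose
fibres are Sobolev functions with their gradients. -/
theorem exists_bochner (hp : p ≠ ⊤)
    (f : Lp ℝ p ((volume.restrict Ω).prod (volume.restrict U)))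
    (G : Lp (E d) p ((volume.restrict Ω).prod (volume.restrict U)))
    (h : ∀ᵐ x ∂(volume.restrict Ω), HasWeakGradient U (fun y => f (x, y)) fun y => G (x, y)) :
    ∃ V : Lp (W1p U p) p (volume.restrict Ω), bochnerIncl Ω U p V = bochnerPair hp Ω U (f, G) := by
  refine exists_lpSubtype_eq _ _ ?_
  filter_upwards [bochnerPair_ae hp f G, lpCurry_ae hp f, lpCurry_ae hp G, h] with x h1 h2 h3 h4
  rw [h1]
  exact h4.congr h2.symm h3.symm

theorem bochner_ae (hp : p ≠ ⊤)
    {f : Lp ℝ p ((volume.restrict Ω).prod (volume.restrict U))}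
    {G : Lp (E d) p ((volume.restrict Ω).prod (volume.restrict U))}
    {V : Lp (W1p U p) p (volume.restrict Ω)}
    (hV : bochnerIncl Ω U p V = bochnerPair hp Ω U (f, G)) :
    ∀ᵐ x ∂(volume.restrict Ω), (V x).fn =ᵐ[volume.restrict U] (fun y => f (x, y)) ∧
      (V x).grad =ᵐ[volume.restrict U] fun y => G (x, y) := by
  filter_upwards [bochnerPair_ae hp f G, lpCurry_ae hp f, lpCurry_ae hp G, bochnerIncl_ae V]
    with x h1 h2 h3 h4
  have h5 := h4.symm.trans ((congrArg (fun P : Lp _ p (volume.restrict Ω) => P x) hV).trans h1)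
  have h6 := congrArg Prod.fst h5
  have h7 := congrArg Prod.snd h5
  refine ⟨?_, ?_⟩
  · unfold W1p.fn
    rw [h6]
    exact h2
  · unfold W1p.grad
    rw [h7]
    exact h3

/-- The isometric inclusion turns the claim into one about pairs, where weak convergence is
preserved by the continuous linear map `bochnerPair`. -/
theorem weakTendsto_bochner (hp : p ≠ ⊤)
    {f : ℕ → Lp ℝ p ((volume.restrict Ω).prod (volume.restrict U))}
    {G : ℕ → Lp (E d) p ((volume.restrict Ω).prod (volume.restrict U))}
    {f₀ : Lp ℝ p ((volume.restrict Ω).prod (volume.restrict U))}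
    {G₀ : Lp (E d) p ((volume.restrict Ω).prod (volume.restrict U))}
    (hf : WeakTendsto f f₀) (hG : WeakTendsto G G₀)
    {V : ℕ → Lp (W1p U p) p (volume.restrict Ω)} {V₀ : Lp (W1p U p) p (volume.restrict Ω)}
    (hV : ∀ k, bochnerIncl Ω U p (V k) = bochnerPair hp Ω U (f k, G k))
    (hV₀ : bochnerIncl Ω U p V₀ = bochnerPair hp Ω U (f₀, G₀)) : WeakTendsto V V₀ := by
  refine WeakTendsto.of_linearIsometry (bochnerIncl Ω U p) ?_
  simp only [hV, hV₀]
  exact (hf.prodMk hG).map _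

end Bochner

/-! ### Matrix action, integer parts and the unit cell -/

section Linear

variable {d : ℕ}

/-- `z ↦ A z` as a continuous linear map. -/
noncomputable def actL (A : Mat d) : E d →L[ℝ] E d := Matrix.toEuclideanCLM (𝕜 := ℝ) A

@[simp] theorem actL_apply (A : Mat d) (z : E d) : actL A z = act A z := by
  ext i
  simp [actL, act, Matrix.ofLp_toEuclideanCLM]

theorem act_add (A : Mat d) (y z : E d) : act A (y + z) = act A y + act A z := by
  simp only [← actL_apply, map_add]

theorem act_sub (A : Mat d) (y z : E d) : act A (y - z) = act A y - act A z := by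
  simp only [← actL_apply, map_sub]

theorem act_smul (A : Mat d) (c : ℝ) (z : E d) : act A (c • z) = c • act A z := by
  simp only [← actL_apply, map_smul]

theorem act_mul (A B : Mat d) (z : E d) : act (A * B) z = act A (act B z) := by
  simp [act, Matrix.mulVec_mulVec]

theorem act_one (z : E d) : act 1 z = z := by simp [act]

theorem act_apply (A : Mat d) (z : E d) (i : Fin d) : act A z i = ∑ j, A i j * z j := by
  simp [act, Matrix.mulVec, dotProduct]

theorem act_inv_act {A : Mat d} (hA : IsUnit A.det) (z : E d) : act A⁻¹ (act A z) = z := by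
  rw [← act_mul, Matrix.nonsing_inv_mul _ hA, act_one]

theorem act_act_inv {A : Mat d} (hA : IsUnit A.det) (z : E d) : act A (act A⁻¹ z) = z := by
  rw [← act_mul, Matrix.mul_nonsing_inv _ hA, act_one]

theorem continuous_act (A : Mat d) : Continuous (act A) := by
  have := (actL A).continuous
  simpa [funext (actL_apply A)] using this

theorem det_actL (A : Mat d) : LinearMap.det (actL A : E d →ₗ[ℝ] E d) = A.det := by
  rw [actL, Matrix.coe_toEuclideanCLM_eq_toEuclideanLin]
  exact LinearMap.det_toLpLin 2 A

/-- A vector of integers as a point of `ℝ^d`. -/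
noncomputable def intVec (ξ : Fin d → ℤ) : E d := WithLp.toLp 2 fun i => (ξ i : ℝ)

@[simp] theorem intVec_apply (ξ : Fin d → ℤ) (i : Fin d) : intVec ξ i = ξ i := rfl

theorem intPart_eq_intVec (z : E d) : intPart z = intVec fun i => ⌊z i⌋ := rfl

@[simp] theorem intPart_apply (z : E d) (i : Fin d) : intPart z i = ⌊z i⌋ := rfl

theorem intPart_add_intVec (z : E d) (ξ : Fin d → ℤ) :
    intPart (z + intVec ξ) = intPart z + intVec ξ := by
  ext i
  simp

theorem intPart_eq_zero {y : E d} (hy : y ∈ unitCell d) : intPart y = 0 := by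
  ext i
  have := hy i
  simp [Int.floor_eq_zero_iff, this.1.le, this.2]

theorem isOpen_unitCell : IsOpen (unitCell d) := by
  have : unitCell d = ⋂ i, (fun y : E d => y i) ⁻¹' Ioo 0 1 := by
    ext y; simp [unitCell]
  rw [this]
  exact isOpen_iInter_of_finite fun i => isOpen_Ioo.preimage (EuclideanSpace.proj i).continuous

theorem closure_unitCell_subset : closure (unitCell d) ⊆ {y | ∀ i, y i ∈ Icc (0 : ℝ) 1} := by
  refine closure_minimal (fun y hy i => Ioo_subset_Icc_self (hy i)) ?_
  have : {y : E d | ∀ i, y i ∈ Icc (0 : ℝ) 1} = ⋂ i, (fun y : E d => y i) ⁻¹' Icc 0 1 := by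
    ext y; simp
  rw [this]
  exact isClosed_iInter fun i => isClosed_Icc.preimage (EuclideanSpace.proj i).continuous

theorem volume_unitCell : volume (unitCell d) = 1 := by
  have : unitCell d = (WithLp.ofLp : E d → (Fin d → ℝ)) ⁻¹' (Set.pi univ fun _ => Ioo (0 : ℝ) 1) := by
    ext y; simp [unitCell]
  rw [this, (PiLp.volume_preserving_ofLp (Fin d)).measure_preimage
    (MeasurableSet.univ_pi fun _ => measurableSet_Ioo).nullMeasurableSet, Real.volume_pi_Ioo]
  simp

instance : IsProbabilityMeasure (volume.restrict (unitCell d)) :=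
  ⟨by rw [Measure.restrict_apply_univ, volume_unitCell]⟩

/-- The points with some integer coordinate. -/
def gridSet (d : ℕ) : Set (E d) := {y | ∃ (i : Fin d) (m : ℤ), y i = m}

theorem volume_gridSet : volume (gridSet d) = 0 := by
  have : gridSet d = ⋃ (i : Fin d) (m : ℤ), (WithLp.ofLp : E d → (Fin d → ℝ)) ⁻¹' {y | y i = m} := by
    ext y; simp [gridSet]
  rw [this]
  refine measure_iUnion_null fun i => measure_iUnion_null fun m => ?_
  have hm : MeasurableSet {y : Fin d → ℝ | y i = (m : ℝ)} :=
    measurableSet_eq_fun (measurable_pi_apply i) measurable_const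
  rw [(PiLp.volume_preserving_ofLp (Fin d)).measure_preimage hm.nullMeasurableSet,
    volume_pi]
  exact Measure.pi_hyperplane (α := fun _ : Fin d => ℝ) (fun _ => volume) i (m : ℝ)

theorem sub_intPart_mem_unitCell {z : E d} (hz : z ∉ gridSet d) : z - intPart z ∈ unitCell d := by
  intro i
  have h : Int.fract (z i) ≠ 0 := fun h => hz ⟨i, ⌊z i⌋, by
    have := Int.self_sub_floor (z i)
    linarith⟩
  change z i - (⌊z i⌋ : ℝ) ∈ _
  rw [Int.self_sub_floor]
  exact ⟨lt_of_le_of_ne (Int.fract_nonneg _) h.symm, Int.fract_lt_one _⟩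

end Linear

/-! ### Cells of the lattice ε A ℤ^d -/

section Cells

variable {d : ℕ} {ε : ℝ} {A : Mat d}

/-- The rescaled point `A⁻¹ z / ε`. -/
noncomputable def rescale (ε : ℝ) (A : Mat d) (z : E d) : E d := ε⁻¹ • act A⁻¹ z

theorem continuous_rescale (ε : ℝ) (A : Mat d) : Continuous (rescale ε A) := by
  have := continuous_act A⁻¹
  unfold rescale
  fun_prop

/-- The affine map `y ↦ ε A (y + ξ)`. -/
noncomputable def cellMap (ε : ℝ) (A : Mat d) (ξ : Fin d → ℤ) (y : E d) : E d :=
  ε • act A (y + intVec ξ)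

theorem continuous_cellMap (ε : ℝ) (A : Mat d) (ξ : Fin d → ℤ) : Continuous (cellMap ε A ξ) := by
  have := continuous_act A
  unfold cellMap
  fun_prop

theorem scaledCell_eq (S : Set (E d)) (ξ : Fin d → ℤ) :
    scaledCell ε A S ξ = cellMap ε A ξ '' S := rfl

theorem rescale_cellMap (hε : ε ≠ 0) (hA : IsUnit A.det) (ξ : Fin d → ℤ) (y : E d) :
    rescale ε A (cellMap ε A ξ y) = y + intVec ξ := by
  rw [rescale, cellMap, act_smul, act_inv_act hA, smul_smul, inv_mul_cancel₀ hε, one_smul]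

theorem cellMap_rescale (hε : ε ≠ 0) (hA : IsUnit A.det) (ξ : Fin d → ℤ) (z : E d) :
    cellMap ε A ξ (rescale ε A z - intVec ξ) = z := by
  rw [cellMap, sub_add_cancel, rescale, act_smul, act_act_inv hA, smul_smul, mul_inv_cancel₀ hε,
    one_smul]

theorem mem_scaledCell_iff (hε : ε ≠ 0) (hA : IsUnit A.det) {S : Set (E d)} {ξ : Fin d → ℤ}
    {z : E d} : z ∈ scaledCell ε A S ξ ↔ rescale ε A z - intVec ξ ∈ S := by
  rw [scaledCell_eq]
  constructor
  · rintro ⟨y, hy, rfl⟩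
    rw [rescale_cellMap hε hA, add_sub_cancel_right]
    exact hy
  · intro h
    exact ⟨_, h, cellMap_rescale hε hA ξ z⟩

theorem isOpen_scaledCell (hε : ε ≠ 0) (hA : IsUnit A.det) {S : Set (E d)} (hS : IsOpen S)
    (ξ : Fin d → ℤ) : IsOpen (scaledCell ε A S ξ) := by
  have : scaledCell ε A S ξ = (fun z => rescale ε A z - intVec ξ) ⁻¹' S := by
    ext z; exact mem_scaledCell_iff hε hA
  rw [this]
  exact hS.preimage ((continuous_rescale ε A).sub continuous_const)

theorem volume_cellMap_image (S : Set (E d)) (ξ : Fin d → ℤ) :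
    volume (cellMap ε A ξ '' S) = ENNReal.ofReal |LinearMap.det
      ((ε • actL A : E d →L[ℝ] E d) : E d →ₗ[ℝ] E d)| * volume S := by
  have : cellMap ε A ξ '' S = (ε • actL A : E d →L[ℝ] E d) '' ((fun y => y + intVec ξ) '' S) := by
    rw [Set.image_image]
    refine Set.image_congr fun y _ => ?_
    simp [cellMap]
  rw [this, Measure.addHaar_image_continuousLinearMap, Set.image_add_right, measure_preimage_add_right]

theorem intPart_rescale (hε : ε ≠ 0) (hA : IsUnit A.det) {ξ : Fin d → ℤ} {z : E d}
    (hz : z ∈ scaledCell ε A (unitCell d) ξ) : intPart (rescale ε A z) = intVec ξ := by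
  have h := (mem_scaledCell_iff hε hA).1 hz
  have := intPart_add_intVec (rescale ε A z - intVec ξ) ξ
  rwa [sub_add_cancel, intPart_eq_zero h, zero_add] at this

theorem intVec_injective : Function.Injective (intVec : (Fin d → ℤ) → E d) := by
  intro ξ η h
  funext i
  have := congrArg (fun z : E d => z i) h
  simpa using this

theorem mem_unitCell_of_closure {y : E d} (hy : y ∈ closure (unitCell d)) (h : y ∉ gridSet d) :
    y ∈ unitCell d := by
  intro i
  have h1 := closure_unitCell_subset hy i
  refine ⟨lt_of_le_of_ne h1.1 fun h0 => h ⟨i, 0, by simp [← h0]⟩,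
    lt_of_le_of_ne h1.2 fun h0 => h ⟨i, 1, by simp [h0]⟩⟩

theorem sub_intVec_mem_gridSet {z : E d} {ξ : Fin d → ℤ} :
    z - intVec ξ ∈ gridSet d ↔ z ∈ gridSet d := by
  constructor
  · rintro ⟨i, m, h⟩
    refine ⟨i, m + ξ i, ?_⟩
    simp only [PiLp.sub_apply, intVec_apply] at h
    push_cast
    linarith
  · rintro ⟨i, m, h⟩
    refine ⟨i, m - ξ i, ?_⟩
    simp [h]

/-- Discards the faces of the cells: the preimage of a null set under an invertible linear map is
null. -/
theorem ae_rescale_notMem_gridSet (hε : ε ≠ 0) (hA : IsUnit A.det) :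
    ∀ᵐ z : E d, rescale ε A z ∉ gridSet d := by
  have hd : (A⁻¹).det ≠ 0 := by
    have := (Matrix.isUnit_nonsing_inv_det_iff).2 hA
    exact this.ne_zero
  have h1 : LinearMap.det ((ε⁻¹ • actL A⁻¹ : E d →L[ℝ] E d) : E d →ₗ[ℝ] E d) ≠ 0 := by
    rw [ContinuousLinearMap.toLinearMap_smul, LinearMap.det_smul, det_actL]
    exact mul_ne_zero (pow_ne_zero _ (inv_ne_zero hε)) hd
  have h2 := Measure.addHaar_preimage_linearMap volume h1 (gridSet d)
  rw [volume_gridSet, mul_zero] at h2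
  rw [ae_iff]
  convert h2 using 2
  ext z
  simp [rescale]

end Cells

/-! ### Admissible cells and the unfolding operator -/

namespace CubePartition

variable {d : ℕ} {Ω : Set (E d)} {r ε : ℝ} (P : CubePartition Ω r ε) (D : E d → Mat d)

/-- The admissible cells. -/
abbrev Index : Type := Σ n : Fin P.N, P.hatXi D n

/-- The open cell with a given index. -/
def cell (c : P.Index D) : Set (E d) := scaledCell ε (D (P.node c.1)) (unitCell d) c.2

/-- The parametrisation of a cell by the unit cell. -/
noncomputable def cellParam (c : P.Index D) : E d → E d := cellMap ε (D (P.node c.1)) c.2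

/-- The union of all the admissible cells. -/
def cells : Set (E d) := ⋃ c, P.cell D c

variable {P D}

theorem cell_subset (c : P.Index D) : P.cell D c ⊆ P.sub c.1 ∩ Ω := c.2.2

theorem cells_subset : P.cells D ⊆ Ω := iUnion_subset fun c => (cell_subset c).trans inter_subset_right

section

variable (hε : 0 < ε) (hD : ∀ x, IsUnit (D x).det)
include hε hD

theorem isOpen_cell (c : P.Index D) : IsOpen (P.cell D c) :=
  isOpen_scaledCell hε.ne' (hD _) isOpen_unitCell _

theorem isOpen_cells : IsOpen (P.cells D) := isOpen_iUnion fun c => isOpen_cell hε hD c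

/-- Inside one cube the index of a cell is read off from the integer part; cells of different cubes
lie in disjoint sets. -/
theorem cell_disjoint : Pairwise fun c c' : P.Index D => Disjoint (P.cell D c) (P.cell D c') := by
  rintro ⟨n, ξ, hξ⟩ ⟨m, η, hη⟩ hne
  rw [Set.disjoint_left]
  intro z hz hz'
  by_cases hnm : n = m
  · subst hnm
    have h1 := intPart_rescale hε.ne' (hD _) hz
    have h2 := intPart_rescale hε.ne' (hD _) hz'
    have : ξ = η := intVec_injective (h1.symm.trans h2)
    subst this
    exact hne rfl
  · exact Set.disjoint_left.1 (P.disjoint hnm) (cell_subset _ hz).1 (cell_subset _ hz').1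

theorem cell_subset_hatSub (c : P.Index D) : P.cell D c ⊆ P.hatSub D c.1 := by
  refine interior_maximal ?_ (isOpen_cell hε hD c)
  exact fun z hz => mem_iUnion₂.2 ⟨c.2.1, c.2.2, image_mono subset_closure hz⟩

/-- Away from the faces the closed and the open cells have the same points, so neither the closure
nor the interior in the definition of `hatSub` matters. -/
theorem mem_hatSub_iff {n : Fin P.N} {x : E d} (hx : rescale ε (D (P.node n)) x ∉ gridSet d) :
    x ∈ P.hatSub D n ↔ ∃ ξ : P.hatXi D n, x ∈ P.cell D ⟨n, ξ⟩ := by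
  constructor
  · intro h
    obtain ⟨ξ, hξ, hx'⟩ := mem_iUnion₂.1 (interior_subset h)
    refine ⟨⟨ξ, hξ⟩, ?_⟩
    rw [mem_scaledCell_iff hε.ne' (hD _)] at hx'
    change x ∈ scaledCell ε (D (P.node n)) (unitCell d) ξ
    rw [mem_scaledCell_iff hε.ne' (hD _)]
    exact mem_unitCell_of_closure hx' fun h => hx (sub_intVec_mem_gridSet.1 h)
  · rintro ⟨ξ, hξ⟩
    exact cell_subset_hatSub hε hD ⟨n, ξ⟩ hξ

theorem ae_rescale_notMem : ∀ᵐ x : E d, ∀ n, rescale ε (D (P.node n)) x ∉ gridSet d := by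
  rw [ae_all_iff]
  exact fun n => ae_rescale_notMem_gridSet hε.ne' (hD _)

/-- A single summand survives, and in it the integer part is the index of the cell. -/
theorem unfolding_of_mem {F : Type*} [AddCommMonoid F] {x : E d}
    (hx : ∀ n, rescale ε (D (P.node n)) x ∉ gridSet d) {c : P.Index D} (hc : x ∈ P.cell D c)
    (ψ : E d → F) (y : E d) : P.unfolding D ψ x y = ψ (P.cellParam D c y) := by
  unfold unfolding
  rw [Finset.sum_eq_single c.1]
  · rw [indicator_of_mem (cell_subset_hatSub hε hD c hc)]
    congr 1
    have h1 : intPart (ε⁻¹ • act (D (P.node c.1))⁻¹ x) = intVec c.2 :=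
      intPart_rescale hε.ne' (hD _) hc
    rw [h1, cellParam, cellMap, act_add, smul_add, add_comm]
  · intro m _ hm
    refine indicator_of_notMem (fun h => ?_) _
    obtain ⟨ξ, hξ⟩ := (mem_hatSub_iff hε hD (hx m)).1 h
    have hne : (⟨m, ξ⟩ : P.Index D) ≠ c := by
      rintro rfl
      exact hm rfl
    exact Set.disjoint_left.1 (cell_disjoint hε hD hne) hξ hc
  · simp

theorem unfolding_of_notMem {F : Type*} [AddCommMonoid F] {x : E d}
    (hx : ∀ n, rescale ε (D (P.node n)) x ∉ gridSet d) (hc : x ∉ P.cells D)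
    (ψ : E d → F) (y : E d) : P.unfolding D ψ x y = 0 := by
  unfold unfolding
  refine Finset.sum_eq_zero fun m _ => indicator_of_notMem (fun h => ?_) _
  obtain ⟨ξ, hξ⟩ := (mem_hatSub_iff hε hD (hx m)).1 h
  exact hc (mem_iUnion.2 ⟨_, hξ⟩)

end

variable (P D)

/-- The point of the cell of `x` with local coordinate `y`. -/
noncomputable def foldPt (z : E d × E d) : E d := P.unfolding D id z.1 z.2

variable {P D}

theorem measurable_intPart : Measurable (intPart : E d → E d) := by
  have h : Measurable fun z : E d => fun i => ((⌊z i⌋ : ℤ) : ℝ) :=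
    measurable_pi_lambda _ fun i =>
      (measurable_from_top (f := fun m : ℤ => (m : ℝ))).comp
        (Int.measurable_floor.comp (EuclideanSpace.proj (𝕜 := ℝ) i).continuous.measurable)
  exact (WithLp.measurable_toLp 2 (Fin d → ℝ)).comp h

theorem measurableSet_hatSub (n : Fin P.N) : MeasurableSet (P.hatSub D n) :=
  isOpen_interior.measurableSet

theorem stronglyMeasurable_unfolding {F : Type*} [NormedAddCommGroup F] {ψ : E d → F}
    (hψ : StronglyMeasurable ψ) :
    StronglyMeasurable fun z : E d × E d => P.unfolding D ψ z.1 z.2 := by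
  unfold unfolding
  refine Finset.stronglyMeasurable_fun_sum _ fun n _ => ?_
  have h1 : StronglyMeasurable fun z : E d × E d =>
      ψ (ε • act (D (P.node n)) (intPart (ε⁻¹ • act (D (P.node n))⁻¹ z.1))
        + ε • act (D (P.node n)) z.2) := by
    refine hψ.comp_measurable ?_
    have ha := (continuous_act (D (P.node n))).measurable
    have hb := (continuous_act (D (P.node n))⁻¹).measurable
    have hi := measurable_intPart (d := d)
    fun_prop
  have h2 := h1.indicator ((measurableSet_hatSub (P := P) (D := D) n).preimage
    (measurable_fst (α := E d) (β := E d)))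
  convert h2 using 1
  funext z
  by_cases hz : z.1 ∈ P.hatSub D n
  · rw [indicator_of_mem hz, indicator_of_mem (show z ∈ Prod.fst ⁻¹' P.hatSub D n from hz)]
  · rw [indicator_of_notMem hz, indicator_of_notMem (show z ∉ Prod.fst ⁻¹' P.hatSub D n from hz)]

variable (hε : 0 < ε) (hD : ∀ x, IsUnit (D x).det)
include hε hD

/-- On a cell the map does not depend on x, and in y it is affine onto the cell with Jacobian
|cell|, because |Y| = 1. Integrating over x in the cell supplies exactly this factor. -/
theorem measurePreserving_foldPt :
    MeasurePreserving (P.foldPt D) ((volume.restrict (P.cells D)).prod (volume.restrict (unitCell d)))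
      (volume.restrict (P.cells D)) := by
  have hm : Measurable (P.foldPt D) :=
    (stronglyMeasurable_unfolding (P := P) (D := D) stronglyMeasurable_id).measurable
  refine ⟨hm, ?_⟩
  ext S hS
  rw [Measure.map_apply hm hS, Measure.prod_apply (hm hS)]
  have hcm : ∀ c, MeasurableSet (P.cell D c) := fun c => (isOpen_cell hε hD c).measurableSet
  have hdis : Pairwise (Function.onFun Disjoint (P.cell D)) := cell_disjoint hε hD
  have hL : ∀ f : E d → ℝ≥0∞, ∫⁻ x in P.cells D, f x = ∑' c, ∫⁻ x in P.cell D c, f x :=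
    fun f => lintegral_iUnion hcm hdis f
  rw [hL, Measure.restrict_apply hS, cells, inter_iUnion, measure_iUnion
    (fun i j hij => (hdis hij).mono inter_subset_right inter_subset_right)
    (fun c => hS.inter (hcm c))]
  refine tsum_congr fun c => ?_
  have h1 : ∫⁻ x in P.cell D c, volume.restrict (unitCell d) (Prod.mk x ⁻¹' (P.foldPt D ⁻¹' S)) =
      ∫⁻ x in P.cell D c, volume (unitCell d ∩ P.cellParam D c ⁻¹' S) := by
    refine lintegral_congr_ae ?_
    filter_upwards [ae_restrict_mem (hcm c), ae_restrict_of_ae (ae_rescale_notMem (P := P) hε hD)]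
      with x hx hx'
    rw [Measure.restrict_apply ((hm hS).preimage measurable_prodMk_left), inter_comm]
    congr 2
    ext y
    simp only [mem_preimage, foldPt, unfolding_of_mem hε hD hx' hx, id]
  rw [h1, setLIntegral_const]
  have h2 : S ∩ P.cell D c = P.cellParam D c '' (unitCell d ∩ P.cellParam D c ⁻¹' S) := by
    rw [image_inter_preimage, inter_comm]
    rfl
  have h3 : P.cell D c = P.cellParam D c '' unitCell d := rfl
  rw [h2, h3, cellParam, volume_cellMap_image, volume_cellMap_image, volume_unitCell, mul_one,
    mul_comm]

theorem unfolding_ae {F : Type*} [AddCommMonoid F] (ψ : E d → F) : ∀ᵐ x : E d, ∀ y,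
    P.unfolding D ψ x y = (P.cells D).indicator (fun x => ψ (P.foldPt D (x, y))) x := by
  filter_upwards [ae_rescale_notMem (P := P) hε hD] with x hx y
  by_cases hc : x ∈ P.cells D
  · obtain ⟨c, hc'⟩ := mem_iUnion.1 hc
    rw [indicator_of_mem hc, unfolding_of_mem hε hD hx hc', foldPt, unfolding_of_mem hε hD hx hc', id]
  · rw [indicator_of_notMem hc, unfolding_of_notMem hε hD hx hc]

/-- Integration of an unfolded function. -/
theorem integral_cells_prod {F : Type*} [NormedAddCommGroup F] [NormedSpace ℝ F] {h : E d → F}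
    (hh : StronglyMeasurable h) :
    ∫ z, h (P.foldPt D z) ∂((volume.restrict (P.cells D)).prod (volume.restrict (unitCell d))) =
      ∫ z in P.cells D, h z := by
  have := measurePreserving_foldPt (P := P) hε hD
  have h1 := integral_map (μ := (volume.restrict (P.cells D)).prod (volume.restrict (unitCell d)))
    this.measurable.aemeasurable (f := h) hh.aestronglyMeasurable
  rw [this.map_eq] at h1
  exact h1.symm

theorem unfolding_ae_prod {F : Type*} [AddCommMonoid F] (ψ : E d → F) (Y : Set (E d)) :
    ∀ᵐ z : E d × E d ∂((volume.restrict Ω).prod (volume.restrict Y)),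
      P.unfolding D ψ z.1 z.2 =
        (P.cells D ×ˢ (univ : Set (E d))).indicator (fun z => ψ (P.foldPt D z)) z := by
  have h1 := (Measure.quasiMeasurePreserving_fst (μ := volume.restrict Ω)
    (ν := volume.restrict Y)).ae (ae_restrict_of_ae (unfolding_ae (P := P) hε hD ψ))
  filter_upwards [h1] with z hz
  rw [hz z.2]
  by_cases hc : z.1 ∈ P.cells D
  · rw [indicator_of_mem hc, indicator_of_mem (by exact ⟨hc, mem_univ _⟩)]
  · rw [indicator_of_notMem hc, indicator_of_notMem (fun h => hc h.1)]

omit hε hD in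
theorem restrict_prod_cells (hc : MeasurableSet (P.cells D)) :
    ((volume.restrict Ω).prod (volume.restrict (unitCell d))).restrict
      (P.cells D ×ˢ (univ : Set (E d))) =
      (volume.restrict (P.cells D)).prod (volume.restrict (unitCell d)) := by
  rw [← Measure.prod_restrict, Measure.restrict_univ, Measure.restrict_restrict hc,
    inter_eq_self_of_subset_left cells_subset]

theorem eLpNorm_unfolding {F : Type*} [NormedAddCommGroup F] {ψ : E d → F}
    (hψ : StronglyMeasurable ψ) (p : ℝ≥0∞) :
    eLpNorm (fun z : E d × E d => P.unfolding D ψ z.1 z.2) p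
      ((volume.restrict Ω).prod (volume.restrict (unitCell d))) =
      eLpNorm ψ p (volume.restrict (P.cells D)) := by
  have hcm : MeasurableSet (P.cells D) := (isOpen_cells hε hD).measurableSet
  rw [eLpNorm_congr_ae (unfolding_ae_prod hε hD ψ _),
    eLpNorm_indicator_eq_eLpNorm_restrict (hcm.prod MeasurableSet.univ),
    restrict_prod_cells hcm]
  exact eLpNorm_comp_measurePreserving hψ.aestronglyMeasurable (measurePreserving_foldPt hε hD)

theorem eLpNorm_unfolding_le {F : Type*} [NormedAddCommGroup F] {ψ : E d → F}
    (hψ : StronglyMeasurable ψ) (p : ℝ≥0∞) :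
    eLpNorm (fun z : E d × E d => P.unfolding D ψ z.1 z.2) p
      ((volume.restrict Ω).prod (volume.restrict (unitCell d))) ≤
      eLpNorm ψ p (volume.restrict Ω) := by
  rw [eLpNorm_unfolding hε hD hψ]
  exact eLpNorm_mono_measure _ (Measure.restrict_mono cells_subset le_rfl)

theorem memLp_unfolding {F : Type*} [NormedAddCommGroup F] {ψ : E d → F}
    (hψ : StronglyMeasurable ψ) {p : ℝ≥0∞} (h : MemLp ψ p (volume.restrict Ω)) :
    MemLp (fun z : E d × E d => P.unfolding D ψ z.1 z.2) p
      ((volume.restrict Ω).prod (volume.restrict (unitCell d))) :=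
  ⟨(stronglyMeasurable_unfolding hψ).aestronglyMeasurable,
    (eLpNorm_unfolding_le hε hD hψ p).trans_lt h.2⟩

end CubePartition

/-! ### Integration by parts in arbitrary directions -/

section Directional

variable {d : ℕ} {Ω : Set (E d)} {p : ℝ≥0∞} [Fact (1 ≤ p)]

theorem inner_eq_sum (v g : E d) : inner ℝ v g = ∑ j, v j * g j := by
  rw [PiLp.inner_apply]
  exact Finset.sum_congr rfl fun j _ => by simp [mul_comm]

theorem fderiv_eq_sum_pderiv (φ : E d → ℝ) (x v : E d) :
    fderiv ℝ φ x v = ∑ j, v j * pderiv j φ x := by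
  have hv : v = ∑ j, v j • EuclideanSpace.single j (1 : ℝ) := by
    ext i
    simp [Finset.sum_apply, Pi.single_apply]
  conv_lhs => rw [hv, map_sum]
  simp [pderiv]

theorem act_transpose_apply (A : Mat d) (g : E d) (i : Fin d) :
    act A.transpose g i = inner ℝ (act A (EuclideanSpace.single i 1)) g := by
  rw [inner_eq_sum, act_apply]
  refine Finset.sum_congr rfl fun j _ => ?_
  rw [act_apply]
  simp

theorem W1p.hasWeakGradient (w : W1p Ω p) : HasWeakGradient Ω w.fn w.grad := w.2

theorem W1p.stronglyMeasurable_fn (w : W1p Ω p) : StronglyMeasurable w.fn :=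
  Lp.stronglyMeasurable _

theorem W1p.stronglyMeasurable_grad (w : W1p Ω p) : StronglyMeasurable w.grad :=
  Lp.stronglyMeasurable _

theorem W1p.memLp_fn (w : W1p Ω p) : MemLp w.fn p (volume.restrict Ω) := Lp.memLp _

theorem W1p.memLp_grad (w : W1p Ω p) : MemLp w.grad p (volume.restrict Ω) := Lp.memLp _

theorem IsTestFunction.mono {U V : Set (E d)} {φ : E d → ℝ} (h : IsTestFunction U φ) (hUV : U ⊆ V) :
    IsTestFunction V φ := ⟨h.1, h.2.1, h.2.2.trans hUV⟩

theorem IsTestFunction.fderiv_apply {U : Set (E d)} {φ : E d → ℝ} (h : IsTestFunction U φ)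
    (v : E d) : IsTestFunction U fun x => fderiv ℝ φ x v := by
  refine ⟨?_, h.2.1.fderiv_apply (𝕜 := ℝ) v, ?_⟩
  · exact (h.1.fderiv_right (m := ((⊤ : ℕ∞) : WithTop ℕ∞)) (by simp)).clm_apply contDiff_const
  · refine subset_trans ?_ h.2.2
    exact tsupport_fderiv_apply_subset ℝ v

theorem integral_mul_fderiv (w : W1p Ω p) {φ : E d → ℝ} (hφ : IsTestFunction Ω φ) (v : E d) :
    ∫ z in Ω, w.fn z * fderiv ℝ φ z v = - ∫ z in Ω, inner ℝ v (w.grad z) * φ z := by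
  have h1 : ∀ j, Integrable (fun z => w.fn z * pderiv j φ z) (volume.restrict Ω) := fun j =>
    integrable_mul_test _ (continuous_pderiv hφ j) (hasCompactSupport_pderiv hφ j)
  have h2 : ∀ j, Integrable (fun z => w.grad z j * φ z) (volume.restrict Ω) := fun j =>
    integrable_coord_mul_test _ j hφ.1.continuous hφ.2.1
  calc ∫ z in Ω, w.fn z * fderiv ℝ φ z v
      = ∫ z in Ω, ∑ j, v j * (w.fn z * pderiv j φ z) := by
        refine integral_congr_ae (Eventually.of_forall fun z => ?_)
        simp only [fderiv_eq_sum_pderiv, Finset.mul_sum]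
        exact Finset.sum_congr rfl fun j _ => by ring
    _ = ∑ j, v j * ∫ z in Ω, w.fn z * pderiv j φ z := by
        rw [integral_finsetSum _ fun j _ => (h1 j).const_mul _]
        exact Finset.sum_congr rfl fun j _ => integral_const_mul _ _
    _ = - ∑ j, v j * ∫ z in Ω, w.grad z j * φ z := by
        rw [← Finset.sum_neg_distrib]
        refine Finset.sum_congr rfl fun j _ => ?_
        rw [w.hasWeakGradient φ hφ j]
        ring
    _ = - ∫ z in Ω, ∑ j, v j * (w.grad z j * φ z) := by
        rw [integral_finsetSum _ fun j _ => (h2 j).const_mul _]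
        congr 1
        exact Finset.sum_congr rfl fun j _ => (integral_const_mul _ _).symm
    _ = _ := by
        congr 1
        refine integral_congr_ae (Eventually.of_forall fun z => ?_)
        simp only [inner_eq_sum, Finset.sum_mul]
        exact Finset.sum_congr rfl fun j _ => by ring

/-- Both sides are -∫ w D²φ(v, v'), and D²φ is symmetric. This is the origin of the curl condition
on the limit of the gradients. -/
theorem integral_inner_grad_mul_fderiv_comm (w : W1p Ω p) {φ : E d → ℝ} (hφ : IsTestFunction Ω φ)
    (v v' : E d) :
    ∫ z in Ω, inner ℝ v (w.grad z) * fderiv ℝ φ z v' =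
      ∫ z in Ω, inner ℝ v' (w.grad z) * fderiv ℝ φ z v := by
  have key : ∀ u u' : E d, ∫ z in Ω, inner ℝ u (w.grad z) * fderiv ℝ φ z u' =
      - ∫ z in Ω, w.fn z * fderiv ℝ (fderiv ℝ φ) z u u' := by
    intro u u'
    have h1 := integral_mul_fderiv w (hφ.fderiv_apply u') u
    have hd : Differentiable ℝ (fderiv ℝ φ) :=
      (hφ.1.fderiv_right (m := 1) (by norm_cast)).differentiable (by simp)
    have h2 : ∀ z, fderiv ℝ (fun x => fderiv ℝ φ x u') z u = fderiv ℝ (fderiv ℝ φ) z u u' := by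
      intro z
      rw [fderiv_clm_apply (hd z) (differentiableAt_const _)]
      simp
    simp only [h2] at h1
    rw [h1, neg_neg]
  rw [key, key]
  congr 1
  refine integral_congr_ae (Eventually.of_forall fun z => ?_)
  have hs : IsSymmSndFDerivAt ℝ φ z :=
    (hφ.1.contDiffAt).isSymmSndFDerivAt
    (by rw [minSmoothness_of_isRCLikeNormedField]; exact WithTop.coe_le_coe.2 (le_top : (2 : ℕ∞) ≤ ⊤))
  simp only
  rw [hs.eq]

end Directional

/-! ### Sobolev functions pulled back to the unit cell -/

section CellGradient

variable {d : ℕ} {Ω : Set (E d)} {p : ℝ≥0∞} [Fact (1 ≤ p)] {ε : ℝ} {A : Mat d}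

theorem contDiff_rescale (ε : ℝ) (A : Mat d) (n : WithTop ℕ∞) : ContDiff ℝ n (rescale ε A) := by
  have : rescale ε A = fun z => ε⁻¹ • actL A⁻¹ z := by
    funext z; simp [rescale]
  rw [this]
  exact (actL A⁻¹).contDiff.const_smul _

theorem hasFDerivAt_rescale (ε : ℝ) (A : Mat d) (z : E d) :
    HasFDerivAt (rescale ε A) (ε⁻¹ • actL A⁻¹) z := by
  have : rescale ε A = fun z => ε⁻¹ • actL A⁻¹ z := by
    funext z; simp [rescale]
  rw [this]
  exact (actL A⁻¹).hasFDerivAt.const_smul ε⁻¹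

theorem hasFDerivAt_cellMap (ε : ℝ) (A : Mat d) (ξ : Fin d → ℤ) (y : E d) :
    HasFDerivAt (cellMap ε A ξ) (ε • actL A) y := by
  have : cellMap ε A ξ = fun y => ε • actL A (y + intVec ξ) := by
    funext z; simp [cellMap]
  rw [this]
  exact ((actL A).hasFDerivAt.comp y ((hasFDerivAt_id y).add_const (intVec ξ))).const_smul ε

theorem fderiv_comp_rescale (hε : ε ≠ 0) (hA : IsUnit A.det) {φ : E d → ℝ}
    (hφ : Differentiable ℝ φ) (b z : E d) (v : E d) :
    fderiv ℝ (fun z => φ (rescale ε A z - b)) z (ε • act A v) =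
      fderiv ℝ φ (rescale ε A z - b) v := by
  have h := (hφ (rescale ε A z - b)).hasFDerivAt.comp z ((hasFDerivAt_rescale ε A z).sub_const b)
  rw [show (fun z => φ (rescale ε A z - b)) = φ ∘ fun z => rescale ε A z - b from rfl, h.fderiv]
  simp [act_inv_act hA, mul_inv_cancel_left₀ hε]

theorem isTestFunction_comp_rescale (hε : ε ≠ 0) (hA : IsUnit A.det) {U : Set (E d)} {φ : E d → ℝ}
    (hφ : IsTestFunction U φ) (ξ : Fin d → ℤ) :
    IsTestFunction (scaledCell ε A U ξ) fun z => φ (rescale ε A z - intVec ξ) := by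
  set e : E d ≃ₜ E d :=
    { toFun := fun z => rescale ε A z - intVec ξ
      invFun := cellMap ε A ξ
      left_inv := fun z => cellMap_rescale hε hA ξ z
      right_inv := fun y => by
        change rescale ε A (cellMap ε A ξ y) - intVec ξ = y
        rw [rescale_cellMap hε hA, add_sub_cancel_right]
      continuous_toFun := (continuous_rescale ε A).sub continuous_const
      continuous_invFun := continuous_cellMap ε A ξ } with he
  refine ⟨hφ.1.comp ((contDiff_rescale ε A _).sub contDiff_const), ?_, ?_⟩
  · exact hφ.2.1.comp_homeomorph e
  · intro z hz
    have h1 : tsupport (φ ∘ e) = e ⁻¹' tsupport φ := tsupport_comp_eq_preimage φ e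
    have hz' : z ∈ tsupport (φ ∘ e) := hz
    rw [h1] at hz'
    exact (mem_scaledCell_iff hε hA).2 (hφ.2.2 hz')

/-- Chain rule by duality: a test function on Y is transplanted to the cell and extended by zero to
Ω, where the direction ε A e_i gives the integration by parts. The Jacobian appears on both sides
and cancels. -/
theorem hasWeakGradient_comp_cellMap (hε : ε ≠ 0) (hA : IsUnit A.det) (w : W1p Ω p)
    (hΩ : MeasurableSet Ω) (ξ : Fin d → ℤ) (hξ : scaledCell ε A (unitCell d) ξ ⊆ Ω) :
    HasWeakGradient (unitCell d) (fun y => w.fn (cellMap ε A ξ y))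
      (fun y => ε • act A.transpose (w.grad (cellMap ε A ξ y))) := by
  intro φ hφ i
  set κ : ℝ := |(ε • actL A : E d →L[ℝ] E d).det| with hκ
  have hκ0 : κ ≠ 0 := by
    rw [hκ, abs_ne_zero, ContinuousLinearMap.det, ContinuousLinearMap.toLinearMap_smul,
      LinearMap.det_smul, det_actL]
    exact mul_ne_zero (pow_ne_zero _ hε) hA.ne_zero
  have hinj : InjOn (cellMap ε A ξ) (unitCell d) := by
    intro y _ y' _ h
    have := congrArg (rescale ε A) h
    rwa [rescale_cellMap hε hA, rescale_cellMap hε hA, add_left_inj] at this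
  have hcv : ∀ f : E d → ℝ, ∫ z in scaledCell ε A (unitCell d) ξ, f z =
      κ * ∫ y in unitCell d, f (cellMap ε A ξ y) := by
    intro f
    rw [scaledCell_eq, integral_image_eq_integral_abs_det_fderiv_smul volume
      isOpen_unitCell.measurableSet (fun y _ => (hasFDerivAt_cellMap ε A ξ y).hasFDerivWithinAt) hinj]
    simp only [smul_eq_mul]
    rw [← hκ, integral_const_mul]
  set ψ : E d → ℝ := fun z => φ (rescale ε A z - intVec ξ) with hψ
  have hψt : IsTestFunction (scaledCell ε A (unitCell d) ξ) ψ :=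
    isTestFunction_comp_rescale hε hA hφ ξ
  have hcell : MeasurableSet (scaledCell ε A (unitCell d) ξ) :=
    (isOpen_scaledCell hε hA isOpen_unitCell ξ).measurableSet
  have h1 := integral_mul_fderiv w (hψt.mono hξ) (ε • act A (EuclideanSpace.single i 1))
  have hψ0 : ∀ z ∉ scaledCell ε A (unitCell d) ξ, ψ z = 0 := fun z hz =>
    image_eq_zero_of_notMem_tsupport fun h => hz (hψt.2.2 h)
  have hdψ0 : ∀ v, ∀ z ∉ scaledCell ε A (unitCell d) ξ, fderiv ℝ ψ z v = 0 := by
    intro v z hz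
    have := image_eq_zero_of_notMem_tsupport (f := fun x => fderiv ℝ ψ x v)
      fun h => hz ((hψt.fderiv_apply v).2.2 h)
    exact this
  have hext : ∀ f : E d → ℝ, (∀ z ∉ scaledCell ε A (unitCell d) ξ, f z = 0) →
      ∫ z in Ω, f z = κ * ∫ y in unitCell d, f (cellMap ε A ξ y) := by
    intro f hf
    rw [← hcv]
    exact setIntegral_eq_of_subset_of_forall_sdiff_eq_zero hΩ hξ fun z hz => hf z hz.2
  rw [hext _ fun z hz => by rw [hdψ0 _ z hz, mul_zero],
    hext _ fun z hz => by rw [hψ0 z hz, mul_zero], ← mul_neg] at h1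
  have h2 := mul_left_cancel₀ hκ0 h1
  have hdiff : Differentiable ℝ φ := hφ.1.differentiable (by simp)
  have hres : ∀ y, rescale ε A (cellMap ε A ξ y) - intVec ξ = y := fun y => by
    rw [rescale_cellMap hε hA, add_sub_cancel_right]
  simp only [hψ, fderiv_comp_rescale hε hA hdiff, hres] at h2
  refine h2.trans ?_
  congr 1
  refine integral_congr_ae (Eventually.of_forall fun y => ?_)
  simp only [PiLp.smul_apply, act_transpose_apply, inner_smul_left, smul_eq_mul]
  simp

end CellGradient

/-! ### Cutoff functions in the unit cell -/

section Cutoff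

variable {d : ℕ}

/-- Smooth cutoff functions in the unit cell. -/
structure IsCutoff (θ : E d → ℝ) : Prop where
  smooth : ContDiff ℝ ((⊤ : ℕ∞) : WithTop ℕ∞) θ
  tsupport_subset : tsupport θ ⊆ unitCell d
  nonneg : ∀ y, 0 ≤ θ y
  le_one : ∀ y, θ y ≤ 1

theorem dist_le_of_coord {z w : E d} {s : ℝ} (hs : 0 ≤ s) (h : ∀ i, |z i - w i| ≤ s) :
    dist z w ≤ d * s := by
  rw [EuclideanSpace.dist_eq]
  refine Real.sqrt_le_iff.2 ⟨by positivity, ?_⟩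
  calc ∑ i, dist (z i) (w i) ^ 2 ≤ ∑ _i : Fin d, s ^ 2 := by
        refine Finset.sum_le_sum fun i _ => ?_
        rw [Real.dist_eq]
        exact pow_le_pow_left₀ (abs_nonneg _) (h i) 2
    _ = d * s ^ 2 := by simp
    _ ≤ (d * s) ^ 2 := by
        rcases Nat.eq_zero_or_pos d with rfl | hd
        · simp
        · have : (1 : ℝ) ≤ d := by exact_mod_cast hd
          nlinarith [sq_nonneg s, mul_nonneg (sub_nonneg.2 this) (sq_nonneg s)]

theorem dist_le_of_mem_unitCell {y y' : E d} (hy : y ∈ unitCell d) (hy' : y' ∈ unitCell d) :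
    dist y y' ≤ d := by
  have := dist_le_of_coord (z := y) (w := y') zero_le_one fun i => by
    have h1 := hy i
    have h2 := hy' i
    rw [abs_le]
    constructor <;> linarith [h1.1, h1.2, h2.1, h2.2]
  simpa using this

theorem isBounded_unitCell : Bornology.IsBounded (unitCell d) :=
  Metric.isBounded_iff.2 ⟨d, fun _ hy _ hy' => dist_le_of_mem_unitCell hy hy'⟩

theorem IsCutoff.hasCompactSupport {θ : E d → ℝ} (h : IsCutoff θ) : HasCompactSupport θ :=
  Metric.isCompact_of_isClosed_isBounded (isClosed_tsupport _)
    (isBounded_unitCell.subset h.tsupport_subset)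

theorem IsCutoff.eq_zero {θ : E d → ℝ} (h : IsCutoff θ) {y : E d} (hy : y ∉ unitCell d) : θ y = 0 :=
  image_eq_zero_of_notMem_tsupport fun h' => hy (h.tsupport_subset h')

open scoped Manifold in
-- Inner regularity leaves a compact K in Y with small complement, and a smooth Urysohn function
-- equals 1 on K.
theorem exists_isCutoff {δ : ℝ≥0∞} (hδ : δ ≠ 0) :
    ∃ θ : E d → ℝ, IsCutoff θ ∧ ∫⁻ y in unitCell d, ENNReal.ofReal (1 - θ y) ≤ δ := by
  obtain ⟨K, hKY, hK, hKδ⟩ : ∃ K ⊆ unitCell d, IsCompact K ∧ volume (unitCell d \ K) < δ := by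
    obtain ⟨K, hKY, hK, h⟩ := isOpen_unitCell.measurableSet.exists_isCompact_sdiff_lt
      (μ := volume) (by rw [volume_unitCell (d := d)]; simp) hδ
    exact ⟨K, hKY, hK, h⟩
  obtain ⟨f, h0, h1, hf⟩ := exists_contMDiffMap_zero_one_nhds_of_isClosed 𝓘(ℝ, E d)
    (n := (⊤ : ℕ∞)) (s := (unitCell d)ᶜ) (t := K) isOpen_unitCell.isClosed_compl
    hK.isClosed (Set.disjoint_left.2 fun y hy hy' => hy (hKY hy'))
  have hone : ∀ y ∈ K, f y = 1 := fun y hy => h1.self_of_nhdsSet y hy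
  refine ⟨f, ⟨f.contMDiff.contDiff, ?_, fun y => (hf y).1, fun y => (hf y).2⟩, ?_⟩
  · intro y hy
    by_contra hyY
    have := (eventually_nhdsSet_iff_forall.1 h0) y hyY
    exact (notMem_tsupport_iff_eventuallyEq.2 this) hy
  · calc ∫⁻ y in unitCell d, ENNReal.ofReal (1 - f y)
        ≤ ∫⁻ y in unitCell d, (unitCell d \ K).indicator 1 y := by
          refine lintegral_mono_ae ?_
          filter_upwards [ae_restrict_mem isOpen_unitCell.measurableSet] with y hy
          by_cases hyK : y ∈ K
          · simp [hone y hyK]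
          · rw [indicator_of_mem (show y ∈ unitCell d \ K from ⟨hy, hyK⟩)]
            exact ENNReal.ofReal_le_one.2 (by linarith [(hf y).1])
      _ ≤ volume (unitCell d \ K) := by
          rw [lintegral_indicator_one (isOpen_unitCell.measurableSet.diff hK.measurableSet)]
          exact Measure.restrict_apply_le _ _
      _ ≤ δ := hKδ.le

end Cutoff

/-! ### Cutoffs transplanted to the cubes -/

namespace CubePartition

variable {d : ℕ} {Ω : Set (E d)} {r ε : ℝ} (P : CubePartition Ω r ε)

/-- The coordinate in `Y` of a point of the cube `Ω_n`. -/
noncomputable def localCoord (n : Fin P.N) (z : E d) : E d := (ε ^ r)⁻¹ • (z - P.corner n)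

/-- The cutoff function `θ` transplanted to the cube `Ω_n`. -/
noncomputable def cut (θ : E d → ℝ) (n : Fin P.N) (z : E d) : ℝ := θ (P.localCoord n z)

variable {P}

theorem continuous_localCoord (n : Fin P.N) : Continuous (P.localCoord n) := by
  unfold localCoord
  fun_prop

theorem sum_eq_of_mem_sub {F : Type*} [AddCommMonoid F] {n : Fin P.N} {z : E d} (hz : z ∈ P.sub n)
    {g : Fin P.N → F} (hg : ∀ m, z ∉ P.sub m → g m = 0) : ∑ m, g m = g n := by
  refine Finset.sum_eq_single n (fun m _ hm => hg m fun h => ?_) (by simp)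
  exact Set.disjoint_left.1 (P.disjoint hm) h hz

theorem isOpen_sub (n : Fin P.N) : IsOpen (P.sub n) := by
  have : P.sub n = ⋂ i, (fun y : E d => y i) ⁻¹' Ioo (P.corner n i) (P.corner n i + ε ^ r) := by
    ext y; simp [sub, cube]
  rw [this]
  exact isOpen_iInter_of_finite fun i => isOpen_Ioo.preimage (EuclideanSpace.proj i).continuous

variable (hε : 0 < ε)
include hε

theorem mem_sub_iff {n : Fin P.N} {z : E d} : z ∈ P.sub n ↔ P.localCoord n z ∈ unitCell d := by
  have hs : 0 < ε ^ r := Real.rpow_pos_of_pos hε r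
  simp only [sub, cube, unitCell, localCoord, mem_ofPred_eq]
  refine forall_congr' fun i => ?_
  simp only [PiLp.smul_apply, PiLp.sub_apply, smul_eq_mul, mem_Ioo]
  rw [inv_mul_eq_div, lt_div_iff₀ hs, div_lt_iff₀ hs]
  constructor <;> rintro ⟨h1, h2⟩ <;> constructor <;> linarith

theorem cut_eq_zero {θ : E d → ℝ} (hθ : IsCutoff θ) {n : Fin P.N} {z : E d} (hz : z ∉ P.sub n) :
    P.cut θ n z = 0 :=
  hθ.eq_zero fun h => hz ((mem_sub_iff hε).2 h)

theorem dist_le_of_mem_sub {n : Fin P.N} {z z' : E d} (hz : z ∈ P.sub n) (hz' : z' ∈ P.sub n) :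
    dist z z' ≤ d * ε ^ r := by
  refine dist_le_of_coord (Real.rpow_nonneg hε.le r) fun i => ?_
  have h1 := hz i
  have h2 := hz' i
  rw [abs_le]
  constructor <;> linarith [h1.1, h1.2, h2.1, h2.2]

theorem sub_eq_image (n : Fin P.N) :
    P.sub n = (fun y => ε ^ r • y + P.corner n) '' unitCell d := by
  have hs : ε ^ r ≠ 0 := (Real.rpow_pos_of_pos hε r).ne'
  ext z
  rw [mem_sub_iff hε]
  constructor
  · intro h
    refine ⟨_, h, ?_⟩
    simp [localCoord, smul_smul, mul_inv_cancel₀ hs]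
  · rintro ⟨y, hy, rfl⟩
    simpa [localCoord, smul_smul, inv_mul_cancel₀ hs] using hy

theorem lintegral_sub (n : Fin P.N) (g : E d → ℝ≥0∞) :
    ∫⁻ z in P.sub n, g (P.localCoord n z) = volume (P.sub n) * ∫⁻ y in unitCell d, g y := by
  have hs : ε ^ r ≠ 0 := (Real.rpow_pos_of_pos hε r).ne'
  have hder : ∀ y ∈ unitCell d, HasFDerivWithinAt (fun y => ε ^ r • y + P.corner n)
      (ε ^ r • ContinuousLinearMap.id ℝ (E d)) (unitCell d) y := fun y _ =>
    (((hasFDerivAt_id y).const_smul (ε ^ r)).add_const _).hasFDerivWithinAt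
  have hinj : InjOn (fun y => ε ^ r • y + P.corner n) (unitCell d) := by
    intro y _ y' _ h
    simpa [hs] using h
  have key : ∀ f : E d → ℝ≥0∞, ∫⁻ z in P.sub n, f z = ENNReal.ofReal
      |(ε ^ r • ContinuousLinearMap.id ℝ (E d)).det| *
        ∫⁻ y in unitCell d, f (ε ^ r • y + P.corner n) := by
    intro f
    rw [sub_eq_image hε, lintegral_image_eq_lintegral_abs_det_fderiv_mul volume
      isOpen_unitCell.measurableSet hder hinj, lintegral_const_mul' _ _ ENNReal.ofReal_ne_top]
  -- The constant integrand identifies the Jacobian with the volume of the cube.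
  have h1 := key fun _ => 1
  simp only [setLIntegral_const, one_mul, volume_unitCell, mul_one] at h1
  rw [key, h1]
  congr 1
  simp [localCoord, smul_smul, inv_mul_cancel₀ hs]

theorem measure_closure_sub_diff (n : Fin P.N) : volume (closure (P.sub n) \ P.sub n) = 0 := by
  have hs : 0 < ε ^ r := Real.rpow_pos_of_pos hε r
  have hconv : Convex ℝ (P.sub n) := by
    intro z hz w hw a b ha hb hab i
    have := (convex_Ioo (P.corner n i) (P.corner n i + ε ^ r)) (hz i) (hw i) ha hb hab
    simpa using this
  have h := hconv.addHaar_frontier volume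
  rwa [frontier, (isOpen_sub n).interior_eq] at h

/-- The closed cubes cover Ω, and the boundary of a cube is null since a cube is convex. -/
theorem ae_mem_iUnion_sub (hΩ : MeasurableSet Ω) :
    ∀ᵐ z ∂(volume.restrict Ω), z ∈ ⋃ n, P.sub n := by
  have h1 : ∀ᵐ z : E d, ∀ n, z ∉ closure (P.sub n) \ P.sub n := by
    rw [ae_all_iff]
    exact fun n => measure_eq_zero_iff_ae_notMem.1 (measure_closure_sub_diff hε n)
  filter_upwards [ae_restrict_mem hΩ, ae_restrict_of_ae h1] with z hz hz'
  obtain ⟨n, hn⟩ := mem_iUnion.1 (P.covers hz)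
  refine mem_iUnion.2 ⟨n, ?_⟩
  by_contra h
  exact hz' n ⟨hn, h⟩

/-- Every cube meets Ω and has diameter at most d ε^r ≤ d. This bounds the total volume of the cubes
independently of ε. -/
theorem iUnion_sub_subset (hε₁ : ε ≤ 1) (hr : 0 < r) {R : ℝ} (hR : Ω ⊆ Metric.closedBall 0 R) :
    ⋃ n, P.sub n ⊆ Metric.closedBall 0 (R + d) := by
  refine iUnion_subset fun n z hz => ?_
  have h1 := dist_le_of_mem_sub hε hz (P.node_mem n).1
  have h2 := hR (P.node_mem n).2
  have h3 : ε ^ r ≤ 1 := Real.rpow_le_one hε.le hε₁ hr.le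
  rw [Metric.mem_closedBall] at h2 ⊢
  have h4 : (d : ℝ) * ε ^ r ≤ d := by
    have : (0 : ℝ) ≤ d := Nat.cast_nonneg d
    nlinarith
  linarith [dist_triangle z (P.node n) 0]

variable (P) in
/-- The sum of the transplanted cutoff functions. -/
noncomputable def cutSum (θ : E d → ℝ) (z : E d) : ℝ := ∑ n, P.cut θ n z

theorem cutSum_of_mem {θ : E d → ℝ} (hθ : IsCutoff θ) {n : Fin P.N} {z : E d} (hz : z ∈ P.sub n) :
    P.cutSum θ z = P.cut θ n z :=
  sum_eq_of_mem_sub hz fun _ hm => cut_eq_zero hε hθ hm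

omit hε in
theorem continuous_cut {θ : E d → ℝ} (hθ : IsCutoff θ) (n : Fin P.N) : Continuous (P.cut θ n) :=
  hθ.smooth.continuous.comp (continuous_localCoord n)

omit hε in
theorem continuous_cutSum {θ : E d → ℝ} (hθ : IsCutoff θ) : Continuous (P.cutSum θ) :=
  continuous_finsetSum _ fun n _ => continuous_cut hθ n

omit hε in
theorem cutSum_nonneg {θ : E d → ℝ} (hθ : IsCutoff θ) (z : E d) : 0 ≤ P.cutSum θ z :=
  Finset.sum_nonneg fun _ _ => hθ.nonneg _

/-- By scaling, the cutoff loses the same fraction of each cube; the cubes are disjoint, so the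
losses add up to that fraction of the total volume. -/
theorem lintegral_one_sub_cutSum_le (hΩ : MeasurableSet Ω) {θ : E d → ℝ} (hθ : IsCutoff θ) :
    ∫⁻ z in Ω, ENNReal.ofReal (1 - P.cutSum θ z) ≤
      volume (⋃ n, P.sub n) * ∫⁻ y in unitCell d, ENNReal.ofReal (1 - θ y) := by
  have hm : ∀ n, MeasurableSet (P.sub n) := fun n => (isOpen_sub n).measurableSet
  have hdis : Pairwise (Function.onFun Disjoint P.sub) := P.disjoint
  have hle : volume.restrict Ω ≤ volume.restrict (⋃ n, P.sub n) := by
    refine Measure.restrict_mono_ae ?_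
    have := (ae_restrict_iff' hΩ).1 (ae_mem_iUnion_sub (P := P) hε hΩ)
    exact this
  calc ∫⁻ z in Ω, ENNReal.ofReal (1 - P.cutSum θ z)
      ≤ ∫⁻ z in ⋃ n, P.sub n, ENNReal.ofReal (1 - P.cutSum θ z) := lintegral_mono' hle le_rfl
    _ = ∑' n, ∫⁻ z in P.sub n, ENNReal.ofReal (1 - P.cutSum θ z) := lintegral_iUnion hm hdis _
    _ = ∑' n, volume (P.sub n) * ∫⁻ y in unitCell d, ENNReal.ofReal (1 - θ y) := by
        refine tsum_congr fun n => ?_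
        rw [← lintegral_sub hε n]
        refine setLIntegral_congr_fun (hm n) fun z hz => ?_
        simp only [cutSum_of_mem hε hθ hz, cut]
    _ = _ := by rw [ENNReal.tsum_mul_right, measure_iUnion hdis hm]

end CubePartition

/-! ### Hölder estimate on a thin layer -/

section Layer

variable {d : ℕ} {Ω : Set (E d)}

/-- Hölder's inequality, followed by g^q ≤ g, which holds because g ≤ 1 ≤ q. -/
theorem lintegral_enorm_mul_le {F : Type*} [NormedAddCommGroup F] {μ : Measure (E d)} {p q : ℝ}
    (hpq : p.HolderConjugate q) {f : E d → F} (hf : AEStronglyMeasurable f μ) {g : E d → ℝ≥0∞}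
    (hg : AEMeasurable g μ) (hg₁ : ∀ z, g z ≤ 1) :
    ∫⁻ z, ‖f z‖ₑ * g z ∂μ ≤ eLpNorm f (ENNReal.ofReal p) μ * (∫⁻ z, g z ∂μ) ^ (1 / q) := by
  have h := ENNReal.lintegral_mul_le_Lp_mul_Lq μ hpq hf.enorm hg
  refine h.trans ?_
  rw [eLpNorm_eq_lintegral_rpow_enorm_toReal (by simpa using hpq.pos) ENNReal.ofReal_ne_top,
    ENNReal.toReal_ofReal hpq.nonneg]
  gcongr with z
  · exact one_div_nonneg.2 hpq.symm.nonneg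
  · calc g z ^ q ≤ g z ^ (1 : ℝ) := ENNReal.rpow_le_rpow_of_exponent_ge (hg₁ z) hpq.symm.lt.le
      _ = g z := ENNReal.rpow_one _

end Layer

/-! ### Cells meeting the support of a cutoff are admissible -/

namespace CubePartition

variable {d : ℕ} {Ω : Set (E d)} {r ε : ℝ} {P : CubePartition Ω r ε} {D : E d → Mat d}

theorem localCoord_sub (n : Fin P.N) (z w : E d) :
    P.localCoord n z - P.localCoord n w = (ε ^ r)⁻¹ • (z - w) := by
  rw [localCoord, localCoord, ← smul_sub, sub_sub_sub_cancel_right]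

/-- A cell that meets the support of the transplanted cutoff is admissible when `ε` is small. -/
theorem mem_cells_of_cut_ne_zero (hε : 0 < ε) (hD : ∀ x, IsUnit (D x).det) {C : ℝ}
    (hC₀ : 0 ≤ C) (hC : ∀ x ∈ Ω, ∀ v, ‖act (D x) v‖ ≤ C * ‖v‖) {S K : Set (E d)} {ρ ρ' : ℝ}
    (hS : Metric.cthickening ρ S ⊆ unitCell d) (hK : Metric.cthickening ρ' K ⊆ Ω)
    (h₁ : ε * (C * d) ≤ ρ') (h₂ : (ε ^ r)⁻¹ * (ε * (C * d)) ≤ ρ) {n : Fin P.N} {z : E d}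
    (hz : rescale ε (D (P.node n)) z ∉ gridSet d) (hzS : P.localCoord n z ∈ S) (hzK : z ∈ K) :
    z ∈ P.cells D := by
  set A := D (P.node n) with hA
  set ξ : Fin d → ℤ := fun i => ⌊rescale ε A z i⌋ with hξ
  have hy : rescale ε A z - intVec ξ ∈ unitCell d := sub_intPart_mem_unitCell hz
  have hzc : z ∈ scaledCell ε A (unitCell d) ξ := (mem_scaledCell_iff hε.ne' (hD _)).2 hy
  have hadm : ξ ∈ P.hatXi D n := by
    rintro p ⟨y, hyY, rfl⟩
    set p := cellMap ε A ξ y with hp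
    -- A cell has diameter at most ε C d. This fits the margin ρ' of K in Ω and, after division by
    -- ε^r, the margin ρ of S in Y.
    have hpz : dist p z ≤ ε * (C * d) := by
      have h3 : z = cellMap ε A ξ (rescale ε A z - intVec ξ) := (cellMap_rescale hε.ne' (hD _) ξ z).symm
      rw [dist_eq_norm]
      nth_rewrite 1 [h3]
      rw [hp, cellMap, cellMap, ← smul_sub, ← act_sub, norm_smul, Real.norm_of_nonneg hε.le]
      refine mul_le_mul_of_nonneg_left ?_ hε.le
      refine (hC _ (P.node_mem n).2 _).trans ?_
      rw [add_sub_add_right_eq_sub]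
      have h4 : ‖y - (rescale ε A z - intVec ξ)‖ ≤ d := by
        rw [← dist_eq_norm]; exact dist_le_of_mem_unitCell hyY hy
      exact mul_le_mul_of_nonneg_left h4 hC₀
    refine ⟨?_, ?_⟩
    · rw [mem_sub_iff hε]
      apply hS
      refine Metric.mem_cthickening_of_dist_le _ _ _ _ hzS ?_
      rw [dist_eq_norm, localCoord_sub, norm_smul, norm_inv,
        Real.norm_of_nonneg (Real.rpow_nonneg hε.le r), ← dist_eq_norm]
      exact (mul_le_mul_of_nonneg_left hpz (inv_nonneg.2 (Real.rpow_nonneg hε.le r))).trans h₂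
    · exact hK (Metric.mem_cthickening_of_dist_le _ _ _ _ hzK (hpz.trans h₁))
  exact mem_iUnion.2 ⟨⟨n, ξ, hadm⟩, hzc⟩

/-! ### Unfolded against oscillating pairings -/

section Compare

variable {F : Type*} [NormedAddCommGroup F] [InnerProductSpace ℝ F]

variable (P D) in
/-- The unfolded functional. -/
noncomputable def unfoldedPairing (a Φ : E d → ℝ) (m : E d → F) (f : E d → F) : ℝ :=
  ∫ z, a z.1 * Φ z.2 * inner ℝ (m z.1) (P.unfolding D f z.1 z.2)
    ∂((volume.restrict Ω).prod (volume.restrict (unitCell d)))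

variable (P D) in
/-- The oscillating functional, localised to the cubes by a cutoff. -/
noncomputable def cutPairing (θ a Φ : E d → ℝ) (m : E d → F) (f : E d → F) : ℝ :=
  ∫ z in Ω, ∑ n, P.cut θ n z * a z * Φ (rescale ε (D (P.node n)) z) * inner ℝ (m (P.node n)) (f z)

variable (P D) in
/-- The oscillating function `Φ(D(x_n)⁻¹ z / ε)`, `z ∈ Ω_n`. -/
noncomputable def oscillating (Φ : E d → ℝ) (z : E d) : ℝ :=
  ∑ n, (P.sub n).indicator (fun z => Φ (rescale ε (D (P.node n)) z)) z

theorem oscillating_of_mem {Φ : E d → ℝ} {n : Fin P.N} {z : E d} (hz : z ∈ P.sub n) :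
    P.oscillating D Φ z = Φ (rescale ε (D (P.node n)) z) := by
  rw [oscillating, sum_eq_of_mem_sub hz fun m hm => indicator_of_notMem hm _, indicator_of_mem hz]

theorem stronglyMeasurable_oscillating {Φ : E d → ℝ} (hΦ : Continuous Φ) :
    StronglyMeasurable (P.oscillating D Φ) := by
  refine Finset.stronglyMeasurable_fun_sum _ fun n _ => ?_
  exact (hΦ.comp (continuous_rescale _ _)).stronglyMeasurable.indicator (isOpen_sub n).measurableSet

omit [InnerProductSpace ℝ F] in
theorem integral_norm_unfolding_le (hε : 0 < ε) (hD : ∀ x, IsUnit (D x).det) {f : E d → F}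
    (hf : StronglyMeasurable f) (hfi : Integrable f (volume.restrict Ω)) :
    Integrable (fun z : E d × E d => P.unfolding D f z.1 z.2)
      ((volume.restrict Ω).prod (volume.restrict (unitCell d))) ∧
    ∫ z, ‖P.unfolding D f z.1 z.2‖ ∂((volume.restrict Ω).prod (volume.restrict (unitCell d))) ≤
      ∫ z in Ω, ‖f z‖ := by
  have h1 := memLp_unfolding (P := P) hε hD hf (memLp_one_iff_integrable.2 hfi)
  refine ⟨memLp_one_iff_integrable.1 h1, ?_⟩
  have h2 := eLpNorm_unfolding_le (P := P) hε hD hf 1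
  rw [integral_norm_eq_lintegral_enorm h1.1, integral_norm_eq_lintegral_enorm hfi.1,
    ← eLpNorm_one_eq_lintegral_enorm, ← eLpNorm_one_eq_lintegral_enorm]
  exact ENNReal.toReal_mono (memLp_one_iff_integrable.2 hfi).eLpNorm_ne_top h2

omit [InnerProductSpace ℝ F] in
theorem integrable_of_norm_le {α : Type*} [MeasurableSpace α] {μ : Measure α} {g : α → F}
    (hg : Integrable g μ) {h : α → ℝ} (hh : AEStronglyMeasurable h μ) {c : ℝ}
    (hb : ∀ᵐ x ∂μ, |h x| ≤ c * ‖g x‖) : Integrable h μ :=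
  (hg.norm.const_mul c).mono' hh hb

theorem abs_integral_sub_le {α : Type*} [MeasurableSpace α] {μ : Measure α} {h h' b : α → ℝ}
    (hh : Integrable h μ) (hh' : Integrable h' μ) (hb : Integrable b μ)
    (hle : ∀ᵐ x ∂μ, |h x - h' x| ≤ b x) : |∫ x, h x ∂μ - ∫ x, h' x ∂μ| ≤ ∫ x, b x ∂μ := by
  rw [← integral_sub hh hh']
  exact norm_integral_le_of_norm_le (f := fun x => h x - h' x) hb hle

theorem abs_mul_mul_inner_le {a b Ca Cb Cm : ℝ} {m f : F} (ha : |a| ≤ Ca) (hb : |b| ≤ Cb)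
    (hm : ‖m‖ ≤ Cm) : |a * b * inner ℝ m f| ≤ Ca * Cb * Cm * ‖f‖ := by
  have h0 := (abs_nonneg a).trans ha
  have h1 := (abs_nonneg b).trans hb
  rw [abs_mul, abs_mul]
  calc |a| * |b| * |inner ℝ m f| ≤ Ca * Cb * (‖m‖ * ‖f‖) := by
        gcongr
        exact abs_real_inner_le_norm m f
    _ ≤ Ca * Cb * (Cm * ‖f‖) := by gcongr
    _ = _ := by ring

variable (hε : 0 < ε) (hD : ∀ x, IsUnit (D x).det) (hΩ : MeasurableSet Ω)
  {f : E d → F} (hf : StronglyMeasurable f) (hfi : Integrable f (volume.restrict Ω))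
  {a Φ : E d → ℝ} {m : E d → F} (ha : Continuous a) (hΦ : Continuous Φ) (hm : Continuous m)
  {Ca CΦ Cm ω : ℝ} (hCa : ∀ x, |a x| ≤ Ca) (hCΦ : ∀ y, |Φ y| ≤ CΦ) (hCm : ∀ x ∈ Ω, ‖m x‖ ≤ Cm)
  (haω : ∀ n, ∀ x ∈ P.sub n ∩ Ω, ∀ z ∈ P.sub n ∩ Ω, |a x - a z| ≤ ω)
  (hmω : ∀ n, ∀ x ∈ P.sub n ∩ Ω, ∀ z ∈ P.sub n ∩ Ω, ‖m x - m z‖ ≤ ω)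

include hε hD hΩ hf hfi ha hΦ hm hCa hCΦ hCm haω hmω

/-- The integral over the cells is pulled back by the measure preserving map `foldPt`. There the
oscillating function is Φ(y) by periodicity, so the two integrands differ only through a and m,
taken at two points of one cube. -/
theorem abs_unfoldedPairing_sub_le (hper : ∀ y ξ, Φ (y + intVec ξ) = Φ y) :
    |P.unfoldedPairing D a Φ m f -
      ∫ z in Ω, (P.cells D).indicator (fun z => a z * P.oscillating D Φ z * inner ℝ (m z) (f z)) z| ≤
      CΦ * (Ca + Cm) * ω * ∫ z in Ω, ‖f z‖ := by
  set μ := (volume.restrict Ω).prod (volume.restrict (unitCell d)) with hμ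
  set h : E d → ℝ := fun z => a z * P.oscillating D Φ z * inner ℝ (m z) (f z) with hh
  have hcm : MeasurableSet (P.cells D) := (isOpen_cells hε hD).measurableSet
  have hhm : StronglyMeasurable h :=
    (ha.stronglyMeasurable.mul (stronglyMeasurable_oscillating hΦ)).mul
      (hm.stronglyMeasurable.inner hf)
  obtain ⟨hTi, hTle⟩ := integral_norm_unfolding_le (P := P) hε hD hf hfi
  have hTm := stronglyMeasurable_unfolding (P := P) (D := D) hf
  have hCa0 : 0 ≤ Ca := (abs_nonneg _).trans (hCa 0)
  have hCΦ0 : 0 ≤ CΦ := (abs_nonneg _).trans (hCΦ 0)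
  -- Pull back to the product, where the integrand can be compared pointwise with the unfolded one.
  have h2 : ∫ z in Ω, (P.cells D).indicator h z =
      ∫ z, (P.cells D ×ˢ (univ : Set (E d))).indicator (fun z => h (P.foldPt D z)) z ∂μ := by
    rw [integral_indicator hcm, integral_indicator (hcm.prod MeasurableSet.univ),
      restrict_prod_cells hcm, integral_cells_prod hε hD hhm,
      Measure.restrict_restrict hcm, inter_eq_self_of_subset_left cells_subset]
  have hfm : Measurable (P.foldPt D) := (measurePreserving_foldPt hε hD).measurable
  have hae : ∀ᵐ z : E d × E d ∂μ, z.1 ∈ Ω ∧ z.2 ∈ unitCell d ∧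
      ∀ n, rescale ε (D (P.node n)) z.1 ∉ gridSet d := by
    have e1 := (Measure.quasiMeasurePreserving_fst (μ := volume.restrict Ω)
      (ν := volume.restrict (unitCell d))).ae
      ((ae_restrict_mem hΩ).and (ae_restrict_of_ae (ae_rescale_notMem (P := P) hε hD)))
    have e2 := (Measure.quasiMeasurePreserving_snd (μ := volume.restrict Ω)
      (ν := volume.restrict (unitCell d))).ae (ae_restrict_mem isOpen_unitCell.measurableSet)
    filter_upwards [e1, e2] with z hz hz'
    exact ⟨hz.1, hz', hz.2⟩
  have key : ∀ᵐ z : E d × E d ∂μ,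
      |a z.1 * Φ z.2 * inner ℝ (m z.1) (P.unfolding D f z.1 z.2) -
        (P.cells D ×ˢ (univ : Set (E d))).indicator (fun z => h (P.foldPt D z)) z| ≤
        CΦ * (Ca + Cm) * ω * ‖P.unfolding D f z.1 z.2‖ ∧
      |(P.cells D ×ˢ (univ : Set (E d))).indicator (fun z => h (P.foldPt D z)) z| ≤
        Ca * CΦ * Cm * ‖P.unfolding D f z.1 z.2‖ := by
    filter_upwards [hae] with z ⟨hz, hy, hgrid⟩
    by_cases hc : z.1 ∈ P.cells D
    · obtain ⟨c, hxc⟩ := mem_iUnion.1 hc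
      have hT := unfolding_of_mem hε hD hgrid hxc f z.2
      set q := P.cellParam D c z.2 with hq
      have hfold : P.foldPt D z = q := unfolding_of_mem hε hD hgrid hxc id z.2
      have hqc : q ∈ P.cell D c := mem_image_of_mem _ hy
      have hqs := cell_subset c hqc
      have hxs := cell_subset c hxc
      have hosc : P.oscillating D Φ q = Φ z.2 := by
        rw [oscillating_of_mem hqs.1, hq, cellParam, rescale_cellMap hε.ne' (hD _), hper]
      rw [indicator_of_mem (show z ∈ P.cells D ×ˢ (univ : Set (E d)) from ⟨hc, mem_univ _⟩)]
      simp only [hfold, hT, hh, hosc]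
      refine ⟨?_, abs_mul_mul_inner_le (hCa _) (hCΦ _) (hCm _ hqs.2)⟩
      have e1 : a z.1 * Φ z.2 * inner ℝ (m z.1) (f q) - a q * Φ z.2 * inner ℝ (m q) (f q) =
          (a z.1 - a q) * Φ z.2 * inner ℝ (m z.1) (f q) +
            a q * Φ z.2 * inner ℝ (m z.1 - m q) (f q) := by
        rw [inner_sub_left]; ring
      rw [e1]
      refine (abs_add_le _ _).trans ?_
      refine (add_le_add (abs_mul_mul_inner_le (haω c.1 _ hxs _ hqs) (hCΦ _) (hCm _ hxs.2))
        (abs_mul_mul_inner_le (hCa _) (hCΦ _) (hmω c.1 _ hxs _ hqs))).trans (le_of_eq ?_)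
      ring
    · have hT := unfolding_of_notMem hε hD hgrid hc f z.2
      rw [indicator_of_notMem (fun hz' : z ∈ P.cells D ×ˢ (univ : Set (E d)) => hc hz'.1), hT]
      simp
  have hi2 : Integrable ((P.cells D ×ˢ (univ : Set (E d))).indicator
      (fun z => h (P.foldPt D z))) μ :=
    integrable_of_norm_le hTi (((hhm.comp_measurable hfm).indicator
      (hcm.prod MeasurableSet.univ)).aestronglyMeasurable) (key.mono fun z hz => hz.2)
  have hi1 : Integrable (fun z : E d × E d =>
      a z.1 * Φ z.2 * inner ℝ (m z.1) (P.unfolding D f z.1 z.2)) μ := by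
    refine integrable_of_norm_le hTi (c := Ca * CΦ * Cm) ?_ ?_
    · exact (((ha.stronglyMeasurable.comp_measurable measurable_fst).mul
        (hΦ.stronglyMeasurable.comp_measurable measurable_snd)).mul
        ((hm.stronglyMeasurable.comp_measurable measurable_fst).inner hTm)).aestronglyMeasurable
    · filter_upwards [hae] with z ⟨hz, _, _⟩
      exact abs_mul_mul_inner_le (hCa _) (hCΦ _) (hCm _ hz)
  rw [h2, unfoldedPairing]
  refine (abs_integral_sub_le hi1 hi2 (hTi.norm.const_mul (CΦ * (Ca + Cm) * ω))
    (key.mono fun z hz => hz.1)).trans ?_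
  rw [integral_const_mul]
  -- The signs of ω and Cm are known only once a cube exists; without cubes Ω is empty and both
  -- sides vanish.
  rcases isEmpty_or_nonempty (Fin P.N) with hN | ⟨⟨n⟩⟩
  · have : ∀ z : E d × E d, P.unfolding D f z.1 z.2 = 0 := fun z => by simp [unfolding]
    have hΩe : Ω = ∅ := by
      have := P.covers
      rwa [iUnion_of_empty, subset_empty_iff] at this
    simp [this, hΩe]
  · have hω0 : 0 ≤ ω := (abs_nonneg _).trans (haω n _ (P.node_mem n) _ (P.node_mem n))
    have hCm0 : 0 ≤ Cm := (norm_nonneg _).trans (hCm _ (P.node_mem n).2)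
    exact mul_le_mul_of_nonneg_left hTle (by positivity)

/-- Two errors occur on the cells: freezing m at the node costs ω, and the factor 1 - θ is the layer
term. Off the cells the localised integrand vanishes by `hcov`. -/
theorem abs_cutPairing_sub_le {θ : E d → ℝ} (hθ : IsCutoff θ)
    (hcov : ∀ᵐ z ∂(volume.restrict Ω), z ∉ P.cells D → ∀ n, P.cut θ n z * a z = 0) :
    |P.cutPairing D θ a Φ m f -
      ∫ z in Ω, (P.cells D).indicator (fun z => a z * P.oscillating D Φ z * inner ℝ (m z) (f z)) z| ≤
      CΦ * Ca * ω * (∫ z in Ω, ‖f z‖) +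
        CΦ * Ca * Cm * ∫ z in Ω, ‖f z‖ * (1 - P.cutSum θ z) := by
  have hcm : MeasurableSet (P.cells D) := (isOpen_cells hε hD).measurableSet
  have hCa0 : 0 ≤ Ca := (abs_nonneg _).trans (hCa 0)
  have hCΦ0 : 0 ≤ CΦ := (abs_nonneg _).trans (hCΦ 0)
  have hcut : ∀ n z, |P.cut θ n z| ≤ 1 := fun n z => by
    exact (abs_of_nonneg (hθ.nonneg _)).trans_le (hθ.le_one _)
  have key : ∀ᵐ z ∂(volume.restrict Ω),
      |∑ n, P.cut θ n z * a z * Φ (rescale ε (D (P.node n)) z) * inner ℝ (m (P.node n)) (f z) -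
        (P.cells D).indicator (fun z => a z * P.oscillating D Φ z * inner ℝ (m z) (f z)) z| ≤
        CΦ * Ca * ω * ‖f z‖ + CΦ * Ca * Cm * (‖f z‖ * (1 - P.cutSum θ z)) ∧
      |(P.cells D).indicator (fun z => a z * P.oscillating D Φ z * inner ℝ (m z) (f z)) z| ≤
        Ca * CΦ * Cm * ‖f z‖ ∧
      |∑ n, P.cut θ n z * a z * Φ (rescale ε (D (P.node n)) z) * inner ℝ (m (P.node n)) (f z)| ≤
        Ca * CΦ * Cm * ‖f z‖ ∧ |P.cutSum θ z| ≤ 1 := by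
    filter_upwards [hcov, ae_restrict_mem hΩ, ae_mem_iUnion_sub (P := P) hε hΩ] with z hz hzΩ hzs
    obtain ⟨n, hn⟩ := mem_iUnion.1 hzs
    have hω0 : 0 ≤ ω := (abs_nonneg _).trans (haω n _ (P.node_mem n) _ (P.node_mem n))
    have hCm0 : 0 ≤ Cm := (norm_nonneg _).trans (hCm _ (P.node_mem n).2)
    have hsum := cutSum_of_mem hε hθ hn
    have hs : ∑ n, P.cut θ n z * a z * Φ (rescale ε (D (P.node n)) z) *
        inner ℝ (m (P.node n)) (f z) = P.cut θ n z * a z * Φ (rescale ε (D (P.node n)) z) *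
        inner ℝ (m (P.node n)) (f z) :=
      sum_eq_of_mem_sub hn fun k hk => by rw [cut_eq_zero hε hθ hk]; simp
    rw [hs, hsum]
    set t := P.cut θ n z with ht
    have ht0 : 0 ≤ t := hθ.nonneg _
    have ht1 : t ≤ 1 := hθ.le_one _
    have hta : |t * a z| ≤ Ca := by
      rw [abs_mul]
      calc |t| * |a z| ≤ 1 * Ca := mul_le_mul (hcut n z) (hCa z) (abs_nonneg _) zero_le_one
        _ = Ca := one_mul _
    have hosc : P.oscillating D Φ z = Φ (rescale ε (D (P.node n)) z) := oscillating_of_mem hn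
    refine ⟨?_, ?_, abs_mul_mul_inner_le hta (hCΦ _) (hCm _ (P.node_mem n).2), hcut n z⟩
    · by_cases hc : z ∈ P.cells D
      · rw [indicator_of_mem hc, hosc]
        set b := Φ (rescale ε (D (P.node n)) z)
        have e1 : t * a z * b * inner ℝ (m (P.node n)) (f z) - a z * b * inner ℝ (m z) (f z) =
            t * a z * b * inner ℝ (m (P.node n) - m z) (f z) +
              (-(1 - t) * a z) * b * inner ℝ (m z) (f z) := by
          rw [inner_sub_left]; ring
        have e2 : |-(1 - t) * a z| ≤ (1 - t) * Ca := by
          rw [abs_mul, abs_neg, abs_of_nonneg (sub_nonneg.2 ht1)]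
          exact mul_le_mul_of_nonneg_left (hCa z) (sub_nonneg.2 ht1)
        rw [e1]
        refine (abs_add_le _ _).trans ?_
        refine (add_le_add (abs_mul_mul_inner_le hta (hCΦ _)
          (hmω n _ (P.node_mem n) _ ⟨hn, hzΩ⟩))
          (abs_mul_mul_inner_le e2 (hCΦ _) (hCm _ hzΩ))).trans (le_of_eq ?_)
        ring
      · rw [indicator_of_notMem hc, ht, hz hc n]
        have := sub_nonneg.2 ht1
        simp only [zero_mul, sub_zero, abs_zero]
        positivity
    · by_cases hc : z ∈ P.cells D
      · rw [indicator_of_mem hc, hosc]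
        exact abs_mul_mul_inner_le (hCa _) (hCΦ _) (hCm _ hzΩ)
      · rw [indicator_of_notMem hc, abs_zero]
        positivity
  have hi2 := integrable_of_norm_le hfi (h := (P.cells D).indicator
      (fun z => a z * P.oscillating D Φ z * inner ℝ (m z) (f z)))
    ((((ha.stronglyMeasurable.mul (stronglyMeasurable_oscillating hΦ)).mul
      (hm.stronglyMeasurable.inner hf)).indicator hcm).aestronglyMeasurable)
    (key.mono fun z hz => hz.2.1)
  have hi1 := integrable_of_norm_le hfi (h := fun z =>
      ∑ n, P.cut θ n z * a z * Φ (rescale ε (D (P.node n)) z) * inner ℝ (m (P.node n)) (f z))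
    (by
      refine (Finset.stronglyMeasurable_fun_sum _ fun n _ => ?_).aestronglyMeasurable
      have h1 := (continuous_cut hθ n).mul ha
      have h2 := hΦ.comp (continuous_rescale ε (D (P.node n)))
      exact (h1.mul h2).stronglyMeasurable.mul (stronglyMeasurable_const.inner hf))
    (key.mono fun z hz => hz.2.2.1)
  have hi3 : Integrable (fun z => ‖f z‖ * (1 - P.cutSum θ z)) (volume.restrict Ω) := by
    refine integrable_of_norm_le hfi (c := 2) (hfi.1.norm.mul
      ((continuous_const.sub (continuous_cutSum hθ)).aestronglyMeasurable)) ?_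
    filter_upwards [key] with z hz
    rw [abs_mul, abs_norm, mul_comm]
    refine mul_le_mul_of_nonneg_right ?_ (norm_nonneg _)
    have := abs_le.1 hz.2.2.2
    rw [abs_le]
    constructor <;> linarith
  rw [cutPairing]
  refine (abs_integral_sub_le hi1 hi2 ((hfi.norm.const_mul (CΦ * Ca * ω)).add
    (hi3.const_mul (CΦ * Ca * Cm))) (key.mono fun z hz => hz.1)).trans (le_of_eq ?_)
  simp only [Pi.add_apply]
  rw [integral_add (hfi.norm.const_mul _) (hi3.const_mul _), integral_const_mul, integral_const_mul]

end Compare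

end CubePartition

/-! ### Bounds and continuity of Lipschitz matrix fields -/

section Field

variable {d : ℕ} {A : E d → Mat d}

theorem IsLipschitzField.transpose (hA : IsLipschitzField A) :
    IsLipschitzField fun x => (A x).transpose := by
  obtain ⟨C, hC⟩ := hA
  exact ⟨C, fun x x' i j => hC x x' j i⟩

theorem IsLipschitzField.continuous_apply (hA : IsLipschitzField A) (i j : Fin d) :
    Continuous fun x => A x i j := by
  obtain ⟨C, hC⟩ := hA
  refine (LipschitzWith.of_dist_le_mul (K := C.toNNReal) fun x x' => ?_).continuous
  rw [Real.dist_eq]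
  exact (hC x x' i j).trans (mul_le_mul_of_nonneg_right (Real.le_coe_toNNReal C) dist_nonneg)

theorem abs_apply_le_norm (v : E d) (i : Fin d) : |v i| ≤ ‖v‖ := PiLp.norm_apply_le v i

theorem norm_act_le {B : Mat d} {c : ℝ} (hc : 0 ≤ c) (hB : ∀ i j, |B i j| ≤ c) (v : E d) :
    ‖act B v‖ ≤ d * (d * c) * ‖v‖ := by
  have h := dist_le_of_coord (z := act B v) (w := 0) (s := d * c * ‖v‖) (by positivity) fun i => by
    rw [act_apply, PiLp.zero_apply, sub_zero]
    calc |∑ j, B i j * v j| ≤ ∑ j, |B i j * v j| := Finset.abs_sum_le_sum_abs _ _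
      _ ≤ ∑ _j : Fin d, c * ‖v‖ := Finset.sum_le_sum fun j _ => by
          rw [abs_mul]
          exact mul_le_mul (hB i j) (abs_apply_le_norm v j) (abs_nonneg _) hc
      _ = d * c * ‖v‖ := by simp [mul_assoc]
  rw [dist_zero_right] at h
  linarith

theorem IsLipschitzField.uniformContinuous_act (hA : IsLipschitzField A) (v : E d) :
    UniformContinuous fun x => act (A x) v := by
  obtain ⟨C, hC⟩ := hA
  refine (LipschitzWith.of_dist_le_mul (K := (d * (d * (|C| * ‖v‖))).toNNReal)
    fun x x' => ?_).uniformContinuous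
  rw [Real.coe_toNNReal _ (by positivity)]
  have h0 : ∀ i j, |(A x - A x') i j| ≤ |C| * dist x x' := fun i j =>
    (hC x x' i j).trans (mul_le_mul_of_nonneg_right (le_abs_self C) dist_nonneg)
  have h1 : act (A x) v - act (A x') v = act (A x - A x') v := by
    simp [act, Matrix.sub_mulVec]
  rw [dist_eq_norm, h1]
  refine (norm_act_le (by positivity) h0 v).trans (le_of_eq ?_)
  ring

theorem IsLipschitzField.exists_bound (hA : IsLipschitzField A) {Ω : Set (E d)}
    (hΩ : Bornology.IsBounded Ω) : ∃ C : ℝ, 0 ≤ C ∧ ∀ x ∈ Ω, ∀ v, ‖act (A x) v‖ ≤ C * ‖v‖ := by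
  obtain ⟨C, hC⟩ := hA
  obtain ⟨R, hR⟩ := hΩ.subset_closedBall 0
  set c := (∑ i, ∑ j, |A 0 i j|) + |C| * |R| with hc
  have hc0 : 0 ≤ c := by positivity
  refine ⟨d * (d * c), by positivity, fun x hx v => norm_act_le hc0 (fun i j => ?_) v⟩
  have h1 := hC x 0 i j
  have h2 : dist x 0 ≤ |R| := (Metric.mem_closedBall.1 (hR hx)).trans (le_abs_self R)
  have h3 : |A 0 i j| ≤ ∑ i, ∑ j, |A 0 i j| :=
    (Finset.single_le_sum (f := fun j => |A 0 i j|) (fun _ _ => abs_nonneg _)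
      (Finset.mem_univ j)).trans
      (Finset.single_le_sum (f := fun i => ∑ j, |A 0 i j|)
        (fun _ _ => Finset.sum_nonneg fun _ _ => abs_nonneg _) (Finset.mem_univ i))
  have h4 : C * dist x 0 ≤ |C| * |R| :=
    mul_le_mul (le_abs_self C) h2 dist_nonneg (abs_nonneg _)
  have h5 := abs_sub_abs_le_abs_sub (A x i j) (A 0 i j)
  linarith

end Field

/-! ### Uniform integral bounds and the choice of the layer -/

section Bounds

variable {d : ℕ} {Ω : Set (E d)} {F : Type*} [NormedAddCommGroup F]

theorem integral_norm_le_of_eLpNorm_le [IsFiniteMeasure (volume.restrict Ω)] {p : ℝ≥0∞}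
    (hp : 1 ≤ p) {M : ℝ≥0∞} (hM : M ≠ ⊤) :
    ∃ B : ℝ, 0 ≤ B ∧ ∀ f : E d → F, AEStronglyMeasurable f (volume.restrict Ω) →
      eLpNorm f p (volume.restrict Ω) ≤ M →
      Integrable f (volume.restrict Ω) ∧ ∫ z in Ω, ‖f z‖ ≤ B := by
  set c := (volume.restrict Ω) univ ^ (1 / (1 : ℝ≥0∞).toReal - 1 / p.toReal) with hc
  have hct : c ≠ ⊤ := by
    refine ENNReal.rpow_ne_top_of_nonneg ?_ (measure_ne_top _ _)
    rcases eq_or_ne p ⊤ with rfl | hpt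
    · simp
    · have h1 : 1 ≤ p.toReal := by
        have := ENNReal.toReal_mono hpt hp
        simpa using this
      simp only [ENNReal.toReal_one, ne_eq, one_ne_zero, not_false_eq_true, div_self, sub_nonneg]
      exact (div_le_one (by linarith)).2 h1
  refine ⟨(M * c).toReal, ENNReal.toReal_nonneg, fun f hf hfM => ?_⟩
  have h1 := eLpNorm_le_eLpNorm_mul_rpow_measure_univ hp hf
  have h2 : eLpNorm f 1 (volume.restrict Ω) ≤ M * c := h1.trans (mul_le_mul_left hfM c)
  have h3 : M * c ≠ ⊤ := ENNReal.mul_ne_top hM hct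
  refine ⟨memLp_one_iff_integrable.1 ⟨hf, h2.trans_lt h3.lt_top⟩, ?_⟩
  rw [integral_norm_eq_lintegral_enorm hf, ← eLpNorm_one_eq_lintegral_enorm]
  exact ENNReal.toReal_mono h3 h2

/-- Continuity in δ at 0, where the left side vanishes because q > 0. -/
theorem exists_pos_mul_rpow_le {M V : ℝ≥0∞} (hM : M ≠ ⊤) (hV : V ≠ ⊤) {q : ℝ} (hq : 0 < q)
    {κ : ℝ≥0∞} (hκ : κ ≠ 0) : ∃ δ : ℝ≥0∞, δ ≠ 0 ∧ M * (V * δ) ^ q ≤ κ := by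
  have h : Continuous fun δ : ℝ≥0∞ => M * (V * δ) ^ q :=
    (ENNReal.continuous_const_mul hM).comp
      ((ENNReal.continuous_rpow_const).comp (ENNReal.continuous_const_mul hV))
  have h0 := h.tendsto 0
  simp only [mul_zero, ENNReal.zero_rpow_of_pos hq] at h0
  have h1 : ∀ᶠ δ in 𝓝[>] (0 : ℝ≥0∞), M * (V * δ) ^ q ≤ κ :=
    ((h0.mono_left nhdsWithin_le_nhds).eventually (gt_mem_nhds (pos_iff_ne_zero.2 hκ))).mono
      fun _ h => h.le
  obtain ⟨δ, hδ, hδ'⟩ := (h1.and self_mem_nhdsWithin).exists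
  exact ⟨δ, (show (0 : ℝ≥0∞) < δ from hδ').ne', hδ⟩

end Bounds

/-! ### Vanishing of the comparison errors as ε → 0 -/

namespace CubePartition

variable {d : ℕ} {Ω : Set (E d)} (hΩ : IsOpen Ω) (hΩb : Bornology.IsBounded Ω) {D : E d → Mat d}
  (hD : IsTransformation Ω D) {r : ℝ} (hr₀ : 0 < r) (hr₁ : r < 1) {ε : ℕ → ℝ} (hε : ∀ k, 0 < ε k)
  (hε₀ : Tendsto ε atTop (𝓝 0)) {P : ∀ k, CubePartition Ω r (ε k)}

include hr₀ hε₀ in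
theorem tendsto_rpow_zero : Tendsto (fun k => ε k ^ r) atTop (𝓝 0) := by
  have := hε₀.rpow_const (p := r) (Or.inr hr₀.le)
  rwa [Real.zero_rpow hr₀.ne'] at this

include hr₁ hε hε₀ in
-- The quotient of cell size and cube size is ε^{1-r}, and r < 1.
theorem tendsto_div_rpow_zero (C : ℝ) :
    Tendsto (fun k => (ε k ^ r)⁻¹ * (ε k * C)) atTop (𝓝 0) := by
  have h1 : ∀ k, (ε k ^ r)⁻¹ * (ε k * C) = ε k ^ (1 - r) * C := fun k => by
    rw [Real.rpow_sub (hε k), Real.rpow_one]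
    field_simp
  simp only [h1]
  have := (tendsto_rpow_zero (r := 1 - r) (by linarith) hε₀).mul_const C
  rwa [zero_mul] at this

include hr₀ hε hε₀ in
theorem eventually_norm_sub_le {F : Type*} [NormedAddCommGroup F] {m : E d → F}
    (hm : UniformContinuous m) {ω : ℝ} (hω : 0 < ω) :
    ∀ᶠ k in atTop, ∀ n, ∀ x ∈ (P k).sub n, ∀ z ∈ (P k).sub n, ‖m x - m z‖ ≤ ω := by
  obtain ⟨ρ, hρ, h⟩ := Metric.uniformContinuous_iff.1 hm ω hω
  have h1 : Tendsto (fun k => (d : ℝ) * ε k ^ r) atTop (𝓝 0) := by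
    simpa using (tendsto_rpow_zero hr₀ hε₀).const_mul (d : ℝ)
  filter_upwards [h1.eventually (gt_mem_nhds hρ)] with k hk n x hx z hz
  rw [← dist_eq_norm]
  exact (h ((dist_le_of_mem_sub (hε k) hx hz).trans_lt hk)).le

include hΩb hD hr₁ hε hε₀ in
-- The compact supports of θ and of a leave positive margins in Y and in Ω; cells of size O(ε)
-- eventually fit into both, the first one being scaled by ε^r.
theorem eventually_mem_cells {θ a : E d → ℝ} (hθ : IsCutoff θ) (ha : IsTestFunction Ω a)
    (hΩ : IsOpen Ω) :
    ∀ᶠ k in atTop, ∀ᵐ z ∂(volume.restrict Ω), z ∉ (P k).cells D → ∀ n, (P k).cut θ n z * a z = 0 := by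
  obtain ⟨C, hC₀, hC⟩ := hD.lipschitz.exists_bound hΩb
  obtain ⟨ρ, hρ, hS⟩ := hθ.hasCompactSupport.isCompact.exists_cthickening_subset_open
    isOpen_unitCell hθ.tsupport_subset
  obtain ⟨ρ', hρ', hK⟩ := ha.2.1.isCompact.exists_cthickening_subset_open hΩ ha.2.2
  have h1 : Tendsto (fun k => ε k * (C * d)) atTop (𝓝 0) := by
    simpa using hε₀.mul_const (C * d)
  filter_upwards [h1.eventually (gt_mem_nhds hρ'),
    (tendsto_div_rpow_zero hr₁ hε hε₀ (C * d)).eventually (gt_mem_nhds hρ)] with k h₁ h₂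
  filter_upwards [ae_restrict_of_ae (ae_rescale_notMem (P := P k) (hε k) hD.invertible)]
    with z hz hzc n
  by_contra h
  refine hzc (mem_cells_of_cut_ne_zero (hε k) hD.invertible hC₀ hC hS hK h₁.le h₂.le (hz n) ?_ ?_)
  · exact subset_tsupport _ (Function.mem_support.2 (left_ne_zero_of_mul h))
  · exact subset_tsupport _ (Function.mem_support.2 (right_ne_zero_of_mul h))

variable {F : Type*} [NormedAddCommGroup F] [InnerProductSpace ℝ F] {p : ℝ≥0∞} (hp₁ : 1 < p)
  (hp : p ≠ ⊤) {f : ℕ → E d → F} (hf : ∀ k, StronglyMeasurable (f k)) {M : ℝ≥0∞} (hM : M ≠ ⊤)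
  (hfM : ∀ k, eLpNorm (f k) p (volume.restrict Ω) ≤ M)

omit [InnerProductSpace ℝ F] in
include hΩ hΩb hr₀ hε hε₀ hp₁ hp hf hM hfM in
-- Hölder with the conjugate exponent of p. The threshold δ is found before θ and k, from the norm
-- bound and from the volume of a ball containing all cubes.
theorem exists_layer_le {κ : ℝ} (hκ : 0 < κ) : ∃ δ : ℝ≥0∞, δ ≠ 0 ∧ ∀ θ : E d → ℝ, IsCutoff θ →
    ∫⁻ y in unitCell d, ENNReal.ofReal (1 - θ y) ≤ δ →
    ∀ᶠ k in atTop, ∫ z in Ω, ‖f k z‖ * (1 - (P k).cutSum θ z) ≤ κ := by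
  obtain ⟨R, hR⟩ := hΩb.subset_closedBall 0
  set V := volume (Metric.closedBall (0 : E d) (R + d)) with hV
  have hVt : V ≠ ⊤ := measure_closedBall_lt_top.ne
  have hpr : 1 < p.toReal := by
    have := (ENNReal.toReal_lt_toReal ENNReal.one_ne_top hp).2 hp₁
    simpa using this
  have hpq := Real.HolderConjugate.conjExponent hpr
  set q := p.toReal.conjExponent with hq
  obtain ⟨δ, hδ, hδ'⟩ := exists_pos_mul_rpow_le hM hVt (one_div_pos.2 hpq.symm.pos)
    (κ := ENNReal.ofReal κ) (by simpa using hκ)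
  refine ⟨δ, hδ, fun θ hθ hθδ => ?_⟩
  filter_upwards [hε₀.eventually (ge_mem_nhds zero_lt_one)] with k hk
  have hms : ∀ᵐ z ∂(volume.restrict Ω), 0 ≤ 1 - (P k).cutSum θ z := by
    filter_upwards [ae_mem_iUnion_sub (P := P k) (hε k) hΩ.measurableSet] with z hz
    obtain ⟨n, hn⟩ := mem_iUnion.1 hz
    rw [cutSum_of_mem (hε k) hθ hn]
    exact sub_nonneg.2 (hθ.le_one _)
  have hgm : Continuous fun z => 1 - (P k).cutSum θ z := continuous_const.sub (continuous_cutSum hθ)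
  have h1 := lintegral_enorm_mul_le (μ := volume.restrict Ω) hpq
    (hf k).aestronglyMeasurable (g := fun z => ENNReal.ofReal (1 - (P k).cutSum θ z))
    hgm.measurable.ennreal_ofReal.aemeasurable
    (fun z => ENNReal.ofReal_le_one.2 (by linarith [cutSum_nonneg (P := P k) hθ z]))
  rw [ENNReal.ofReal_toReal hp] at h1
  have h2 : ∫⁻ z in Ω, ENNReal.ofReal (1 - (P k).cutSum θ z) ≤ V * δ :=
    (lintegral_one_sub_cutSum_le (hε k) hΩ.measurableSet hθ).trans
      (mul_le_mul' (measure_mono (iUnion_sub_subset (hε k) hk hr₀ hR)) hθδ)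
  have h3 : ∫⁻ z in Ω, ‖f k z‖ₑ * ENNReal.ofReal (1 - (P k).cutSum θ z) ≤ ENNReal.ofReal κ := by
    refine h1.trans (le_trans ?_ hδ')
    exact mul_le_mul' (hfM k) (ENNReal.rpow_le_rpow h2 (one_div_nonneg.2 hpq.symm.nonneg))
  rw [integral_eq_lintegral_of_nonneg_ae (hms.mono fun z hz => mul_nonneg (norm_nonneg _) hz)
    ((hf k).norm.mul hgm.stronglyMeasurable).aestronglyMeasurable]
  refine ENNReal.toReal_le_of_le_ofReal hκ.le (le_trans (le_of_eq ?_) h3)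
  refine lintegral_congr fun z => ?_
  rw [ENNReal.ofReal_mul (norm_nonneg _), ofReal_norm]

include hΩ hΩb hD hr₀ hr₁ hε hε₀ hp₁ hp hf hM hfM in
/-- Comparison of the unfolded functional with the localised oscillating one. -/
theorem exists_transfer {a : E d → ℝ} (ha : IsTestFunction Ω a) {Φ : E d → ℝ} (hΦ : Continuous Φ)
    (hper : ∀ y ξ, Φ (y + intVec ξ) = Φ y) {CΦ : ℝ} (hCΦ : ∀ y, |Φ y| ≤ CΦ) {m : E d → F}
    (hm : UniformContinuous m) {Cm : ℝ} (hCm : ∀ x ∈ Ω, ‖m x‖ ≤ Cm) {κ : ℝ} (hκ : 0 < κ) :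
    ∃ δ : ℝ≥0∞, δ ≠ 0 ∧ ∀ θ : E d → ℝ, IsCutoff θ →
      ∫⁻ y in unitCell d, ENNReal.ofReal (1 - θ y) ≤ δ →
      ∀ᶠ k in atTop, |(P k).unfoldedPairing D a Φ m (f k) -
        (P k).cutPairing D θ a Φ m (f k)| ≤ κ := by
  have : IsFiniteMeasure (volume.restrict Ω) :=
    ⟨by rw [Measure.restrict_apply_univ]; exact hΩb.measure_lt_top⟩
  obtain ⟨B, hB₀, hB⟩ := integral_norm_le_of_eLpNorm_le (F := F) (Ω := Ω) hp₁.le hM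
  obtain ⟨Ca, hCa⟩ := ha.2.1.exists_bound_of_continuous ha.1.continuous
  have hau : UniformContinuous a := ha.2.1.uniformContinuous_of_continuous ha.1.continuous
  rcases Ω.eq_empty_or_nonempty with hΩe | ⟨x₀, hx₀⟩
  · refine ⟨1, one_ne_zero, fun θ _ _ => Eventually.of_forall fun k => ?_⟩
    have : volume.restrict Ω = 0 := by rw [hΩe, Measure.restrict_empty]
    simp [unfoldedPairing, cutPairing, this, hκ.le]
  have hCa0 : 0 ≤ Ca := (norm_nonneg _).trans (hCa 0)
  have hCΦ0 : 0 ≤ CΦ := (abs_nonneg _).trans (hCΦ 0)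
  have hCm0 : 0 ≤ Cm := (norm_nonneg _).trans (hCm _ hx₀)
  -- L collects the coefficients of the three error terms; the summand 1 keeps it positive, and all
  -- tolerances are taken equal to κ / L.
  set L := CΦ * (Ca + Cm) * B + CΦ * Ca * B + CΦ * Ca * Cm + 1 with hL
  have hL0 : 0 < L := by positivity
  obtain ⟨δ, hδ, h⟩ := exists_layer_le (P := P) hΩ hΩb hr₀ hε hε₀ hp₁ hp hf hM hfM
    (div_pos hκ hL0)
  refine ⟨δ, hδ, fun θ hθ hθδ => ?_⟩
  filter_upwards [h θ hθ hθδ, eventually_mem_cells (P := P) hΩb hD hr₁ hε hε₀ hθ ha hΩ,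
    eventually_norm_sub_le (P := P) hr₀ hε hε₀ hau (div_pos hκ hL0),
    eventually_norm_sub_le (P := P) hr₀ hε hε₀ hm (div_pos hκ hL0)] with k h1 h2 h3 h4
  obtain ⟨hfi, hfB⟩ := hB (f k) (hf k).aestronglyMeasurable (hfM k)
  have h3' : ∀ n, ∀ x ∈ (P k).sub n ∩ Ω, ∀ z ∈ (P k).sub n ∩ Ω, |a x - a z| ≤ κ / L :=
    fun n x hx z hz => h3 n x hx.1 z hz.1
  have h4' : ∀ n, ∀ x ∈ (P k).sub n ∩ Ω, ∀ z ∈ (P k).sub n ∩ Ω, ‖m x - m z‖ ≤ κ / L :=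
    fun n x hx z hz => h4 n x hx.1 z hz.1
  have e1 := abs_unfoldedPairing_sub_le (hε k) hD.invertible hΩ.measurableSet (hf k) hfi
    ha.1.continuous hΦ hm.continuous hCa hCΦ hCm h3' h4' hper
  have e2 := abs_cutPairing_sub_le (hε k) hD.invertible hΩ.measurableSet (hf k) hfi
    ha.1.continuous hΦ hm.continuous hCa hCΦ hCm h3' h4' hθ h2
  rw [abs_sub_comm] at e2
  refine (abs_sub_le _ _ _).trans ((add_le_add e1 e2).trans ?_)
  have hκL : 0 ≤ κ / L := (div_pos hκ hL0).le
  have e3 : CΦ * (Ca + Cm) * (κ / L) * ∫ z in Ω, ‖f k z‖ ≤ CΦ * (Ca + Cm) * (κ / L) * B :=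
    mul_le_mul_of_nonneg_left hfB (by positivity)
  have e4 : CΦ * Ca * (κ / L) * ∫ z in Ω, ‖f k z‖ ≤ CΦ * Ca * (κ / L) * B :=
    mul_le_mul_of_nonneg_left hfB (by positivity)
  have e5 : CΦ * Ca * Cm * ∫ z in Ω, ‖f k z‖ * (1 - (P k).cutSum θ z) ≤ CΦ * Ca * Cm * (κ / L) :=
    mul_le_mul_of_nonneg_left h1 (by positivity)
  have e6 : κ = L * (κ / L) := (mul_div_cancel₀ κ hL0.ne').symm
  calc _ ≤ (L - 1) * (κ / L) := by rw [hL]; linarith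
    _ ≤ κ := by linarith

end CubePartition

/-! ### Oscillating test functions and their integration by parts -/

section

variable {d : ℕ} {Ω : Set (E d)} {p : ℝ≥0∞} [Fact (1 ≤ p)]

theorem W1p.integrable_fn_mul (w : W1p Ω p) {g : E d → ℝ} (hg : Continuous g)
    (hs : HasCompactSupport g) : Integrable (fun z => w.fn z * g z) (volume.restrict Ω) :=
  integrable_mul_test _ hg hs

theorem W1p.integrable_inner_grad_mul (w : W1p Ω p) (u : E d) {g : E d → ℝ} (hg : Continuous g)
    (hs : HasCompactSupport g) :
    Integrable (fun z => inner ℝ u (w.grad z) * g z) (volume.restrict Ω) := by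
  have h := (w.memLp_grad.locallyIntegrable
    Fact.out).integrable_smul_left_of_hasCompactSupport hg hs
  refine (h.const_inner u).congr (Eventually.of_forall fun z => ?_)
  simp [inner_smul_right, mul_comm]

end

namespace CubePartition

variable {d : ℕ} {Ω : Set (E d)} {r ε : ℝ} (P : CubePartition Ω r ε) (D : E d → Mat d)

/-- A test function localised to the cube `Ω_n`. -/
noncomputable def localTest (θ a : E d → ℝ) (n : Fin P.N) (z : E d) : ℝ := P.cut θ n z * a z

/-- The oscillating test function localised to the cube `Ω_n`. -/
noncomputable def oscTest (θ a Ψ : E d → ℝ) (n : Fin P.N) (z : E d) : ℝ :=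
  P.localTest θ a n z * Ψ (rescale ε (D (P.node n)) z)

variable {P D} {θ a Ψ : E d → ℝ} (hθ : IsCutoff θ) (ha : IsTestFunction Ω a)

include hθ ha

theorem isTestFunction_localTest (n : Fin P.N) : IsTestFunction Ω (P.localTest θ a n) := by
  refine ⟨?_, ha.2.1.mul_left, (tsupport_mul_subset_right).trans ha.2.2⟩
  refine ContDiff.mul (hθ.smooth.comp ?_) ha.1
  unfold localCoord
  fun_prop

theorem isTestFunction_oscTest (hΨ : ContDiff ℝ ((⊤ : ℕ∞) : WithTop ℕ∞) Ψ) (n : Fin P.N) :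
    IsTestFunction Ω (P.oscTest D θ a Ψ n) := by
  have h := isTestFunction_localTest (P := P) hθ ha n
  exact ⟨h.1.mul (hΨ.comp (contDiff_rescale _ _ _)), h.2.1.mul_right,
    (tsupport_mul_subset_left).trans h.2.2⟩

/-- In the direction ε D(x_n) v the factor ε cancels the ε⁻¹ produced by the oscillating factor, and
survives only where the derivative falls on the slow factor. -/
theorem fderiv_oscTest (hε : ε ≠ 0) (hD : ∀ x, IsUnit (D x).det)
    (hΨ : ContDiff ℝ ((⊤ : ℕ∞) : WithTop ℕ∞) Ψ) (n : Fin P.N) (z v : E d) :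
    fderiv ℝ (P.oscTest D θ a Ψ n) z (ε • act (D (P.node n)) v) =
      ε * (fderiv ℝ (P.localTest θ a n) z (act (D (P.node n)) v) *
        Ψ (rescale ε (D (P.node n)) z)) +
      P.localTest θ a n z * fderiv ℝ Ψ (rescale ε (D (P.node n)) z) v := by
  have h1 : DifferentiableAt ℝ (P.localTest θ a n) z :=
    (isTestFunction_localTest hθ ha n).1.differentiable (by simp) z
  have hΨd : Differentiable ℝ Ψ := hΨ.differentiable (by simp)
  have h2 : DifferentiableAt ℝ (fun z => Ψ (rescale ε (D (P.node n)) z)) z :=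
    (hΨd _).comp z (hasFDerivAt_rescale _ _ z).differentiableAt
  have h3 := fderiv_comp_rescale hε (hD (P.node n)) hΨd 0 z v
  simp only [sub_zero] at h3
  have h4 : fderiv ℝ (P.oscTest D θ a Ψ n) z = _ := fderiv_fun_mul h1 h2
  rw [h4]
  simp only [add_apply, smul_apply, smul_eq_mul, h3]
  rw [map_smul, smul_eq_mul]
  ring

/-- One derivative of the scaled cutoff costs ε^{-r}. The constant depends on θ and a only, not on ε
or the partition. -/
theorem exists_norm_fderiv_localTest_le :
    ∃ c : ℝ, 0 ≤ c ∧ ∀ {ε : ℝ} (P : CubePartition Ω r ε), 0 < ε → ∀ n z,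
      |P.localTest θ a n z| ≤ c ∧ ‖fderiv ℝ (P.localTest θ a n) z‖ ≤ c * (1 + (ε ^ r)⁻¹) := by
  obtain ⟨Ca, hCa⟩ := ha.2.1.exists_bound_of_continuous ha.1.continuous
  obtain ⟨Ca', hCa'⟩ := (ha.2.1.fderiv (𝕜 := ℝ)).exists_bound_of_continuous
    (ha.1.continuous_fderiv (by simp))
  obtain ⟨Cθ, hCθ⟩ := (hθ.hasCompactSupport.fderiv (𝕜 := ℝ)).exists_bound_of_continuous
    (hθ.smooth.continuous_fderiv (by simp))
  have h0 : 0 ≤ Ca := (norm_nonneg _).trans (hCa 0)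
  have h1 : 0 ≤ Ca' := (norm_nonneg _).trans (hCa' 0)
  have h2 : 0 ≤ Cθ := (norm_nonneg _).trans (hCθ 0)
  refine ⟨Ca + Ca' + Ca * Cθ, by positivity, fun {ε} P hε n z => ?_⟩
  have hs : 0 < (ε ^ r)⁻¹ := inv_pos.2 (Real.rpow_pos_of_pos hε r)
  have hcut : |P.cut θ n z| ≤ 1 := (abs_of_nonneg (hθ.nonneg _)).trans_le (hθ.le_one _)
  have hda : HasFDerivAt a (fderiv ℝ a z) z := (ha.1.differentiable (by simp) z).hasFDerivAt
  have hdc : HasFDerivAt (P.cut θ n) ((fderiv ℝ θ (P.localCoord n z)).comp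
      ((ε ^ r)⁻¹ • ContinuousLinearMap.id ℝ (E d))) z := by
    have h3 : HasFDerivAt (P.localCoord n) ((ε ^ r)⁻¹ • ContinuousLinearMap.id ℝ (E d)) z :=
      ((hasFDerivAt_id z).sub_const (P.corner n)).const_smul ((ε ^ r)⁻¹)
    exact (hθ.smooth.differentiable (by simp) (P.localCoord n z)).hasFDerivAt.comp z h3
  constructor
  · rw [localTest, abs_mul]
    calc |P.cut θ n z| * |a z| ≤ 1 * Ca := mul_le_mul hcut (hCa z) (abs_nonneg _) zero_le_one
      _ ≤ _ := by nlinarith [mul_nonneg h0 h2]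
  · have h4 : fderiv ℝ (P.localTest θ a n) z = _ := (hdc.mul hda).fderiv
    have h5 : ‖(fderiv ℝ θ (P.localCoord n z)).comp
        ((ε ^ r)⁻¹ • ContinuousLinearMap.id ℝ (E d))‖ ≤ Cθ * (ε ^ r)⁻¹ := by
      rw [ContinuousLinearMap.comp_smul, ContinuousLinearMap.comp_id, norm_smul,
        Real.norm_of_nonneg hs.le, mul_comm]
      exact mul_le_mul_of_nonneg_right (hCθ _) hs.le
    rw [h4]
    refine (norm_add_le _ _).trans ?_
    rw [norm_smul, norm_smul]
    calc _ ≤ 1 * Ca' + Ca * (Cθ * (ε ^ r)⁻¹) := by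
          gcongr
          · exact hcut
          · exact hCa' z
          · exact hCa z
      _ ≤ _ := by nlinarith [mul_nonneg h0 h2, mul_nonneg h0 hs.le, mul_nonneg h1 hs.le]

omit ha in
theorem localTest_eq_zero (hε : 0 < ε) {n : Fin P.N} {z : E d} (hz : z ∉ P.sub n) :
    P.localTest θ a n z = 0 := by
  rw [localTest, cut_eq_zero hε hθ hz, zero_mul]

omit ha in
theorem fderiv_localTest_eq_zero (hε : 0 < ε) {n : Fin P.N} {z : E d} (hz : z ∉ P.sub n) :
    fderiv ℝ (P.localTest θ a n) z = 0 := by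
  have h1 : P.localCoord n z ∉ tsupport θ := fun h =>
    hz ((mem_sub_iff hε).2 (hθ.tsupport_subset h))
  have h2 : ∀ᶠ z' in 𝓝 z, P.localTest θ a n z' = 0 := by
    have := (continuous_localCoord n).continuousAt.eventually
      ((isClosed_tsupport θ).isOpen_compl.mem_nhds h1)
    filter_upwards [this] with z' hz'
    rw [localTest, cut, image_eq_zero_of_notMem_tsupport hz', zero_mul]
  have h3 : P.localTest θ a n =ᶠ[𝓝 z] fun _ => 0 := h2
  rw [h3.fderiv_eq]
  simp

omit hθ ha in
-- The cubes are disjoint, so almost everywhere at most one summand is nonzero and the number of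
-- cubes does not enter.
theorem abs_integral_sum_le (hε : 0 < ε) (hΩ : MeasurableSet Ω) {G : Fin P.N → E d → ℝ}
    {h : E d → ℝ} {c : ℝ} (hh : Integrable h (volume.restrict Ω))
    (hG : ∀ n, ∀ z ∉ P.sub n, G n z = 0) (hle : ∀ n z, |G n z| ≤ c * h z) :
    |∫ z in Ω, ∑ n, G n z| ≤ c * ∫ z in Ω, h z := by
  rw [← integral_const_mul]
  refine norm_integral_le_of_norm_le (f := fun z => ∑ n, G n z) (hh.const_mul c) ?_
  filter_upwards [ae_mem_iUnion_sub (P := P) hε hΩ] with z hz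
  obtain ⟨n, hn⟩ := mem_iUnion.1 hz
  rw [sum_eq_of_mem_sub hn fun m hm => hG m z hm]
  exact hle n z

variable {p : ℝ≥0∞} [Fact (1 ≤ p)]

/-- Testing w with the oscillating function in the direction ε D(x_n) v trades the term with ∂_vΨ
for the term with ε ∇w and the term where ε times a derivative falls on the cutoff. -/
theorem abs_cutPairing_fn_le (hε : 0 < ε) (hD : ∀ x, IsUnit (D x).det)
    (hΩ : MeasurableSet Ω) (hΨ : ContDiff ℝ ((⊤ : ℕ∞) : WithTop ℕ∞) Ψ) {CΨ C c : ℝ}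
    (hCΨ : ∀ y, |Ψ y| ≤ CΨ) (hC₀ : 0 ≤ C) (hC : ∀ x ∈ Ω, ∀ v, ‖act (D x) v‖ ≤ C * ‖v‖) (hc : 0 ≤ c)
    (hloc : ∀ n z, |P.localTest θ a n z| ≤ c ∧
      ‖fderiv ℝ (P.localTest θ a n) z‖ ≤ c * (1 + (ε ^ r)⁻¹))
    (w : W1p Ω p) (hwi : Integrable w.fn (volume.restrict Ω))
    (hwi' : Integrable w.grad (volume.restrict Ω)) (v : E d) :
    |P.cutPairing D θ a (fun y => fderiv ℝ Ψ y v) (fun _ => (1 : ℝ)) w.fn| ≤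
      ε * (1 + (ε ^ r)⁻¹) * (c * CΨ * (C * ‖v‖)) *
        ((∫ z in Ω, ‖w.fn z‖) + ∫ z in Ω, ‖w.grad z‖) := by
  have hloct := fun n => isTestFunction_localTest (P := P) hθ ha n
  have hosct := fun n => isTestFunction_oscTest (P := P) (D := D) hθ ha hΨ n
  have hres := fun n => continuous_rescale ε (D (P.node n))
  set b := P.localTest θ a with hb
  set A := fun n => D (P.node n) with hA
  have i1 : ∀ n, Integrable (fun z => w.fn z * (b n z * fderiv ℝ Ψ (rescale ε (A n) z) v))
      (volume.restrict Ω) := fun n => w.integrable_fn_mul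
    ((hloct n).1.continuous.mul (((hΨ.continuous_fderiv (by simp)).clm_apply
      continuous_const).comp (hres n))) ((hloct n).2.1.mul_right)
  have i2 : ∀ n, Integrable (fun z => w.fn z *
      (ε * (fderiv ℝ (b n) z (act (A n) v) * Ψ (rescale ε (A n) z)))) (volume.restrict Ω) := fun n =>
    w.integrable_fn_mul (continuous_const.mul (((hloct n).fderiv_apply _).1.continuous.mul
      (hΨ.continuous.comp (hres n)))) ((((hloct n).fderiv_apply _).2.1.mul_right).mul_left)
  have i3 : ∀ n, Integrable (fun z => inner ℝ (ε • act (A n) v) (w.grad z) * P.oscTest D θ a Ψ n z)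
      (volume.restrict Ω) := fun n => w.integrable_inner_grad_mul _ (hosct n).1.continuous (hosct n).2.1
  have i4 : ∀ n, Integrable (fun z =>
      -(w.fn z * (ε * (fderiv ℝ (b n) z (act (A n) v) * Ψ (rescale ε (A n) z))) +
        inner ℝ (ε • act (A n) v) (w.grad z) * P.oscTest D θ a Ψ n z)) (volume.restrict Ω) :=
    fun n => ((i2 n).add (i3 n)).neg
  have hparts : ∀ n, ∫ z in Ω, w.fn z * (b n z * fderiv ℝ Ψ (rescale ε (A n) z) v) =
      ∫ z in Ω, -(w.fn z * (ε * (fderiv ℝ (b n) z (act (A n) v) * Ψ (rescale ε (A n) z))) +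
        inner ℝ (ε • act (A n) v) (w.grad z) * P.oscTest D θ a Ψ n z) := by
    intro n
    have h1 := integral_mul_fderiv w (hosct n) (ε • act (A n) v)
    simp only [hA, fderiv_oscTest hθ ha hε.ne' hD hΨ, mul_add] at h1
    rw [integral_add (i2 n) (i1 n)] at h1
    rw [integral_neg, integral_add (i2 n) (i3 n)]
    linarith
  have hL : P.cutPairing D θ a (fun y => fderiv ℝ Ψ y v) (fun _ => (1 : ℝ)) w.fn =
      ∫ z in Ω, ∑ n, -(w.fn z * (ε * (fderiv ℝ (b n) z (act (A n) v) * Ψ (rescale ε (A n) z))) +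
        inner ℝ (ε • act (A n) v) (w.grad z) * P.oscTest D θ a Ψ n z) := by
    rw [integral_finsetSum _ fun n _ => i4 n, cutPairing,
      ← Finset.sum_congr rfl fun n _ => hparts n, ← integral_finsetSum _ fun n _ => i1 n]
    refine integral_congr_ae (Eventually.of_forall fun z => Finset.sum_congr rfl fun n _ => ?_)
    simp only [hb, localTest, hA]
    simp
    ring
  have hs : 0 < (ε ^ r)⁻¹ := inv_pos.2 (Real.rpow_pos_of_pos hε r)
  have hCΨ0 : 0 ≤ CΨ := (abs_nonneg _).trans (hCΨ 0)
  rw [hL, ← integral_add hwi.norm hwi'.norm]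
  refine abs_integral_sum_le hε hΩ (hwi.norm.add hwi'.norm) ?_ ?_
  · intro n z hz
    simp only [hb, oscTest, localTest_eq_zero hθ hε hz, fderiv_localTest_eq_zero hθ hε hz]
    simp
  · intro n z
    have hAv : ‖act (A n) v‖ ≤ C * ‖v‖ := hC _ (P.node_mem n).2 v
    have e1 : |fderiv ℝ (b n) z (act (A n) v)| ≤ c * (1 + (ε ^ r)⁻¹) * (C * ‖v‖) :=
      ((fderiv ℝ (b n) z).le_opNorm _).trans
        (mul_le_mul (hloc n z).2 hAv (norm_nonneg _) (by positivity))
    have e2 : |inner ℝ (ε • act (A n) v) (w.grad z)| ≤ ε * (C * ‖v‖) * ‖w.grad z‖ := by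
      refine (abs_real_inner_le_norm _ _).trans ?_
      rw [norm_smul, Real.norm_of_nonneg hε.le]
      gcongr
    have e3 : |P.oscTest D θ a Ψ n z| ≤ c * CΨ := by
      rw [oscTest, abs_mul]
      exact mul_le_mul (hloc n z).1 (hCΨ _) (abs_nonneg _) hc
    rw [abs_neg]
    refine (abs_add_le _ _).trans ?_
    rw [abs_mul, abs_mul, abs_mul, abs_mul, abs_of_pos hε, ← Real.norm_eq_abs (w.fn z)]
    calc _ ≤ ‖w.fn z‖ * (ε * (c * (1 + (ε ^ r)⁻¹) * (C * ‖v‖) * CΨ)) +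
          ε * (C * ‖v‖) * ‖w.grad z‖ * (c * CΨ) := by
          gcongr
          exact hCΨ _
      _ ≤ ‖w.fn z‖ * (ε * (c * (1 + (ε ^ r)⁻¹) * (C * ‖v‖) * CΨ)) +
          ε * (C * ‖v‖) * ‖w.grad z‖ * (c * CΨ) * (1 + (ε ^ r)⁻¹) := by
          exact add_le_add le_rfl (le_mul_of_one_le_right (by positivity) (by linarith))
      _ = _ := by ring

/-- Apply the symmetric identity for second derivatives in the directions ε D(x_n) v and ε D(x_n)
v'. Its leading parts are the two pairings, and what remains has the derivative on the slow factor.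
-/
theorem abs_cutPairing_grad_sub_le (hε : 0 < ε) (hD : ∀ x, IsUnit (D x).det)
    (hΩ : MeasurableSet Ω) (hΨ : ContDiff ℝ ((⊤ : ℕ∞) : WithTop ℕ∞) Ψ) {CΨ C c : ℝ}
    (hCΨ : ∀ y, |Ψ y| ≤ CΨ) (hC₀ : 0 ≤ C) (hC : ∀ x ∈ Ω, ∀ v, ‖act (D x) v‖ ≤ C * ‖v‖) (hc : 0 ≤ c)
    (hloc : ∀ n z, |P.localTest θ a n z| ≤ c ∧
      ‖fderiv ℝ (P.localTest θ a n) z‖ ≤ c * (1 + (ε ^ r)⁻¹))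
    (w : W1p Ω p) (hwi' : Integrable w.grad (volume.restrict Ω)) (v v' : E d) :
    |P.cutPairing D θ a (fun y => fderiv ℝ Ψ y v') (fun x => act (D x) v) w.grad -
      P.cutPairing D θ a (fun y => fderiv ℝ Ψ y v) (fun x => act (D x) v') w.grad| ≤
      ε * (1 + (ε ^ r)⁻¹) * (2 * c * CΨ * (C * ‖v‖) * (C * ‖v'‖)) * ∫ z in Ω, ‖w.grad z‖ := by
  have hloct := fun n => isTestFunction_localTest (P := P) hθ ha n
  have hosct := fun n => isTestFunction_oscTest (P := P) (D := D) hθ ha hΨ n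
  have hres := fun n => continuous_rescale ε (D (P.node n))
  set b := P.localTest θ a with hb
  set A := fun n => D (P.node n) with hA
  have i1 : ∀ n u u', Integrable (fun z => inner ℝ (act (A n) u) (w.grad z) *
      (b n z * fderiv ℝ Ψ (rescale ε (A n) z) u')) (volume.restrict Ω) := fun n u u' =>
    w.integrable_inner_grad_mul _ ((hloct n).1.continuous.mul (((hΨ.continuous_fderiv
      (by simp)).clm_apply continuous_const).comp (hres n))) ((hloct n).2.1.mul_right)
  have i2 : ∀ n u u', Integrable (fun z => inner ℝ (act (A n) u) (w.grad z) *
      (ε * (fderiv ℝ (b n) z (act (A n) u') * Ψ (rescale ε (A n) z)))) (volume.restrict Ω) :=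
    fun n u u' => w.integrable_inner_grad_mul _
      (continuous_const.mul (((hloct n).fderiv_apply _).1.continuous.mul
      (hΨ.continuous.comp (hres n)))) ((((hloct n).fderiv_apply _).2.1.mul_right).mul_left)
  have i3 : ∀ n, Integrable (fun z => inner ℝ (act (A n) v') (w.grad z) *
        (ε * (fderiv ℝ (b n) z (act (A n) v) * Ψ (rescale ε (A n) z))) -
        inner ℝ (act (A n) v) (w.grad z) *
        (ε * (fderiv ℝ (b n) z (act (A n) v') * Ψ (rescale ε (A n) z)))) (volume.restrict Ω) :=
    fun n => (i2 n v' v).sub (i2 n v v')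
  have hsplit : ∀ n u u', ∫ z in Ω, inner ℝ (ε • act (A n) u) (w.grad z) *
      fderiv ℝ (P.oscTest D θ a Ψ n) z (ε • act (A n) u') =
      ε * ((∫ z in Ω, inner ℝ (act (A n) u) (w.grad z) *
        (ε * (fderiv ℝ (b n) z (act (A n) u') * Ψ (rescale ε (A n) z)))) +
      ∫ z in Ω, inner ℝ (act (A n) u) (w.grad z) *
        (b n z * fderiv ℝ Ψ (rescale ε (A n) z) u')) := by
    intro n u u'
    rw [← integral_add (i2 n u u') (i1 n u u'), ← integral_const_mul]
    refine integral_congr_ae (Eventually.of_forall fun z => ?_)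
    simp only [hA, fderiv_oscTest hθ ha hε.ne' hD hΨ, inner_smul_left]
    simp
    ring
  have hparts : ∀ n, ∫ z in Ω, (inner ℝ (act (A n) v) (w.grad z) *
        (b n z * fderiv ℝ Ψ (rescale ε (A n) z) v') -
        inner ℝ (act (A n) v') (w.grad z) * (b n z * fderiv ℝ Ψ (rescale ε (A n) z) v)) =
      ∫ z in Ω, (inner ℝ (act (A n) v') (w.grad z) *
        (ε * (fderiv ℝ (b n) z (act (A n) v) * Ψ (rescale ε (A n) z))) -
        inner ℝ (act (A n) v) (w.grad z) *
        (ε * (fderiv ℝ (b n) z (act (A n) v') * Ψ (rescale ε (A n) z)))) := by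
    intro n
    have h1 := integral_inner_grad_mul_fderiv_comm w (hosct n) (ε • act (A n) v) (ε • act (A n) v')
    rw [hsplit, hsplit] at h1
    -- The common factor ε comes from the direction paired with ∇w on each side.
    have h2 := mul_left_cancel₀ hε.ne' h1
    rw [integral_sub (i1 n v v') (i1 n v' v), integral_sub (i2 n v' v) (i2 n v v')]
    linarith
  have hL : ∀ u u', P.cutPairing D θ a (fun y => fderiv ℝ Ψ y u') (fun x => act (D x) u) w.grad =
      ∫ z in Ω, ∑ n, inner ℝ (act (A n) u) (w.grad z) *
        (b n z * fderiv ℝ Ψ (rescale ε (A n) z) u') := by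
    intro u u'
    rw [cutPairing]
    refine integral_congr_ae (Eventually.of_forall fun z => Finset.sum_congr rfl fun n _ => ?_)
    simp only [hb, localTest, hA]
    ring
  rw [hL, hL, integral_finsetSum _ fun n _ => i1 n v v', integral_finsetSum _ fun n _ => i1 n v' v,
    ← Finset.sum_sub_distrib]
  simp only [← integral_sub (i1 _ v v') (i1 _ v' v), hparts]
  rw [← integral_finsetSum _ fun n _ => i3 n]
  have hs : 0 < (ε ^ r)⁻¹ := inv_pos.2 (Real.rpow_pos_of_pos hε r)
  have hCΨ0 : 0 ≤ CΨ := (abs_nonneg _).trans (hCΨ 0)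
  refine abs_integral_sum_le hε hΩ hwi'.norm ?_ ?_
  · intro n z hz
    simp only [hb, fderiv_localTest_eq_zero hθ hε hz]
    simp
  · intro n z
    have hAv : ∀ u, ‖act (A n) u‖ ≤ C * ‖u‖ := fun u => hC _ (P.node_mem n).2 u
    have e1 : ∀ u, |fderiv ℝ (b n) z (act (A n) u)| ≤ c * (1 + (ε ^ r)⁻¹) * (C * ‖u‖) := fun u =>
      ((fderiv ℝ (b n) z).le_opNorm _).trans
        (mul_le_mul (hloc n z).2 (hAv u) (norm_nonneg _) (by positivity))
    have e2 : ∀ u, |inner ℝ (act (A n) u) (w.grad z)| ≤ C * ‖u‖ * ‖w.grad z‖ := fun u =>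
      (abs_real_inner_le_norm _ _).trans (mul_le_mul_of_nonneg_right (hAv u) (norm_nonneg _))
    have e3 : ∀ u u', |inner ℝ (act (A n) u) (w.grad z) *
        (ε * (fderiv ℝ (b n) z (act (A n) u') * Ψ (rescale ε (A n) z)))| ≤
        C * ‖u‖ * ‖w.grad z‖ * (ε * (c * (1 + (ε ^ r)⁻¹) * (C * ‖u'‖) * CΨ)) := by
      intro u u'
      rw [abs_mul, abs_mul, abs_mul, abs_of_pos hε]
      gcongr
      · exact e2 u
      · exact e1 u'
      · exact hCΨ _
    refine (abs_sub _ _).trans ((add_le_add (e3 v' v) (e3 v v')).trans (le_of_eq ?_))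
    ring

end CubePartition

/-! ### Weak convergence tested with bounded functions -/

section Pairing

variable {α : Type*} [MeasurableSpace α] {μ : Measure α} [IsFiniteMeasure μ] {p : ℝ≥0∞}
  [Fact (1 ≤ p)] {F : Type*} [NormedAddCommGroup F] [InnerProductSpace ℝ F]

/-- Pairing with a bounded function is weakly continuous. -/
theorem WeakTendsto.integral_inner {u : ℕ → Lp F p μ} {v : Lp F p μ} (hu : WeakTendsto u v)
    {h : α → F} (hh : AEStronglyMeasurable h μ) {C : ℝ} (hC : ∀ᵐ x ∂μ, ‖h x‖ ≤ C) :
    Tendsto (fun k => ∫ x, inner ℝ (h x) (u k x) ∂μ) atTop (𝓝 (∫ x, inner ℝ (h x) (v x) ∂μ)) := by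
  have hq : (p.conjExponent).HolderConjugate p := by
    have := ENNReal.HolderConjugate.conjExponent (p := p) Fact.out
    infer_instance
  have : Fact (1 ≤ p.conjExponent) := ⟨ENNReal.HolderConjugate.one_le _ p⟩
  have hmem : MemLp h p.conjExponent μ := MemLp.of_bound hh C hC
  set T : Lp F p μ →L[ℝ] ℝ := (innerSL ℝ : F →L[ℝ] F →L[ℝ] ℝ).lpPairing μ p.conjExponent p
    (MemLp.toLp h hmem) with hT
  have hTu : ∀ u : Lp F p μ, T u = ∫ x, inner ℝ (h x) (u x) ∂μ := by
    intro u
    rw [hT, ContinuousLinearMap.lpPairing_eq_integral]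
    refine integral_congr_ae ?_
    filter_upwards [hmem.coeFn_toLp] with x hx
    rw [hx, innerSL_apply_apply]
  simp only [← hTu]
  exact (weakTendsto_iff u v).1 hu T

end Pairing

/-! ### Periodic test functions -/

section Periodic

variable {d : ℕ}

/-- Smooth `ℤ^d`-periodic functions. -/
structure IsPeriodicTest (Ψ : E d → ℝ) : Prop where
  smooth : ContDiff ℝ ((⊤ : ℕ∞) : WithTop ℕ∞) Ψ
  periodic : ∀ y ξ, Ψ (y + intVec ξ) = Ψ y

theorem exists_bound_of_periodic {Ψ : E d → ℝ} (hΨ : Continuous Ψ)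
    (hper : ∀ y ξ, Ψ (y + intVec ξ) = Ψ y) : ∃ C, ∀ y, |Ψ y| ≤ C := by
  obtain ⟨C, hC⟩ := (isCompact_closedBall (0 : E d) d).exists_bound_of_continuousOn
    hΨ.continuousOn
  refine ⟨C, fun y => ?_⟩
  have h1 : Ψ y = Ψ (y - intPart y) := by
    conv_lhs => rw [← sub_add_cancel y (intPart y), intPart_eq_intVec, hper]
    rfl
  rw [h1]
  refine hC _ (Metric.mem_closedBall.2 ?_)
  have := dist_le_of_coord (z := y - intPart y) (w := 0) zero_le_one fun i => by
    have h2 : (y - intPart y) i = Int.fract (y i) := by simp [Int.self_sub_floor]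
    rw [h2, PiLp.zero_apply, sub_zero, abs_of_nonneg (Int.fract_nonneg _)]
    exact (Int.fract_lt_one _).le
  simpa using this

theorem IsPeriodicTest.continuous_fderiv {Ψ : E d → ℝ} (hΨ : IsPeriodicTest Ψ) (v : E d) :
    Continuous fun y => fderiv ℝ Ψ y v :=
  (hΨ.smooth.continuous_fderiv (by simp)).clm_apply continuous_const

theorem IsPeriodicTest.periodic_fderiv {Ψ : E d → ℝ} (hΨ : IsPeriodicTest Ψ) (v y : E d)
    (ξ : Fin d → ℤ) : fderiv ℝ Ψ (y + intVec ξ) v = fderiv ℝ Ψ y v := by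
  have h : (fun y => Ψ (y + intVec ξ)) = Ψ := funext fun y => hΨ.periodic y ξ
  rw [← fderiv_comp_add_right, h]

end Periodic

/-! ### Approximation by functionals depending on a cutoff -/

section Approx

variable {d : ℕ}

/-- `J` is approximated, along the sequence, by functionals depending on a cutoff function. -/
def CutoffApprox (d : ℕ) (J : ℕ → ℝ) (J' : (E d → ℝ) → ℕ → ℝ) : Prop :=
  ∀ κ : ℝ, 0 < κ → ∃ δ : ℝ≥0∞, δ ≠ 0 ∧ ∀ θ : E d → ℝ, IsCutoff θ →
    ∫⁻ y in unitCell d, ENNReal.ofReal (1 - θ y) ≤ δ → ∀ᶠ k in atTop, |J k - J' θ k| ≤ κ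

theorem CutoffApprox.sub {J K : ℕ → ℝ} {J' K' : (E d → ℝ) → ℕ → ℝ} (hJ : CutoffApprox d J J')
    (hK : CutoffApprox d K K') :
    CutoffApprox d (fun k => J k - K k) (fun θ k => J' θ k - K' θ k) := by
  intro κ hκ
  obtain ⟨δ, hδ, h⟩ := hJ (κ / 2) (half_pos hκ)
  obtain ⟨δ', hδ', h'⟩ := hK (κ / 2) (half_pos hκ)
  refine ⟨min δ δ', (lt_min (pos_iff_ne_zero.2 hδ) (pos_iff_ne_zero.2 hδ')).ne', fun θ hθ hle => ?_⟩
  filter_upwards [h θ hθ (hle.trans (min_le_left _ _)), h' θ hθ (hle.trans (min_le_right _ _))]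
    with k h1 h2
  have h3 : J k - K k - (J' θ k - K' θ k) = (J k - J' θ k) - (K k - K' θ k) := by ring
  rw [h3]
  exact (abs_sub _ _).trans (by linarith)

/-- For κ = |L|/2 fix one good cutoff θ and let k → ∞: then |L| ≤ |L|/2. The cutoff stays fixed
during the limit, so J' θ may tend to 0 at a rate depending on θ. -/
theorem CutoffApprox.eq_zero_of_tendsto {J : ℕ → ℝ} {J' : (E d → ℝ) → ℕ → ℝ}
    (hJ : CutoffApprox d J J') (hJ' : ∀ θ, IsCutoff θ → Tendsto (J' θ) atTop (𝓝 0)) {L : ℝ}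
    (hL : Tendsto J atTop (𝓝 L)) : L = 0 := by
  by_contra hne
  have hpos : 0 < |L| := abs_pos.2 hne
  obtain ⟨δ, hδ, h⟩ := hJ (|L| / 2) (half_pos hpos)
  obtain ⟨θ, hθ, hθδ⟩ := exists_isCutoff (d := d) hδ
  have h1 : Tendsto (fun k => |J k - J' θ k|) atTop (𝓝 |L - 0|) := (hL.sub (hJ' θ hθ)).abs
  have h2 := le_of_tendsto h1 (h θ hθ hθδ)
  rw [sub_zero] at h2
  linarith

end Approx

/-! ### Identities satisfied by the limits of the unfolded sequences -/

namespace CubePartition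

variable {d : ℕ} {Ω : Set (E d)} (hΩ : IsOpen Ω) (hΩb : Bornology.IsBounded Ω) {D : E d → Mat d}
  (hD : IsTransformation Ω D) {r : ℝ} (hr₀ : 0 < r) (hr₁ : r < 1) {ε : ℕ → ℝ} (hε : ∀ k, 0 < ε k)
  (hε₀ : Tendsto ε atTop (𝓝 0)) {P : ∀ k, CubePartition Ω r (ε k)} {p : ℝ≥0∞} [Fact (1 ≤ p)]
  (hp₁ : 1 < p) (hp : p ≠ ⊤)

section Limit

variable {F : Type*} [NormedAddCommGroup F] [InnerProductSpace ℝ F]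
  {f : ℕ → E d → F} (hf : ∀ k, StronglyMeasurable (f k)) {M : ℝ≥0∞} (hM : M ≠ ⊤)
  (hfM : ∀ k, eLpNorm (f k) p (volume.restrict Ω) ≤ M)
  {U : ℕ → Lp F p ((volume.restrict Ω).prod (volume.restrict (unitCell d)))}
  {G : Lp F p ((volume.restrict Ω).prod (volume.restrict (unitCell d)))}
  (hU : ∀ k, (U k : E d × E d → F) =ᵐ[(volume.restrict Ω).prod (volume.restrict (unitCell d))]
    fun z => (P k).unfolding D (f k) z.1 z.2)
  (hG : WeakTendsto U G)

include hΩ hΩb hU hG in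
theorem tendsto_unfoldedPairing {a Φ : E d → ℝ} (ha : IsTestFunction Ω a)
    (hΦ : Continuous Φ)
    {CΦ : ℝ} (hCΦ : ∀ y, |Φ y| ≤ CΦ) {m : E d → F} (hm : Continuous m) {Cm : ℝ}
    (hCm : ∀ x ∈ Ω, ‖m x‖ ≤ Cm) :
    Tendsto (fun k => (P k).unfoldedPairing D a Φ m (f k)) atTop
      (𝓝 (∫ z, a z.1 * Φ z.2 * inner ℝ (m z.1) (G z)
        ∂((volume.restrict Ω).prod (volume.restrict (unitCell d))))) := by
  have : IsFiniteMeasure (volume.restrict Ω) :=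
    ⟨by rw [Measure.restrict_apply_univ]; exact hΩb.measure_lt_top⟩
  obtain ⟨Ca, hCa⟩ := ha.2.1.exists_bound_of_continuous ha.1.continuous
  have hac := ha.1.continuous
  have h1 := hG.integral_inner (h := fun z => (a z.1 * Φ z.2) • m z.1) (C := Ca * CΦ * Cm)
    (by
      have : Continuous fun z : E d × E d => (a z.1 * Φ z.2) • m z.1 := by fun_prop
      exact (((hac.stronglyMeasurable.comp_measurable measurable_fst).mul
        (hΦ.stronglyMeasurable.comp_measurable measurable_snd)).smul
        (hm.stronglyMeasurable.comp_measurable measurable_fst)).aestronglyMeasurable)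
    (by
      filter_upwards [(Measure.quasiMeasurePreserving_fst (μ := volume.restrict Ω)
        (ν := volume.restrict (unitCell d))).ae (ae_restrict_mem hΩ.measurableSet)] with z hz
      rw [norm_smul, norm_mul]
      have h2 := hCa z.1
      have h3 := hCΦ z.2
      have h4 := hCm _ hz
      have h5 := (norm_nonneg _).trans h2
      have h6 := (abs_nonneg _).trans h3
      rw [← Real.norm_eq_abs] at h3
      gcongr)
  simp only [inner_smul_left, conj_trivial] at h1
  refine h1.congr fun k => ?_
  refine integral_congr_ae ?_
  filter_upwards [hU k] with z hz
  rw [hz]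

omit [Fact (1 ≤ p)] in
include hΩ hΩb hr₀ hε hε₀ hp₁ hp hf hM hfM in
-- With Φ = 1 and a constant direction e nothing is frozen and nothing oscillates, so the layer is
-- the only error.
theorem cutoffApprox_integral {a : E d → ℝ} (ha : IsTestFunction Ω a) (e : F) :
    CutoffApprox d (fun k => ∫ z in Ω, a z * inner ℝ e (f k z))
      (fun θ k => (P k).cutPairing D θ a (fun _ => 1) (fun _ => e) (f k)) := by
  have : IsFiniteMeasure (volume.restrict Ω) :=
    ⟨by rw [Measure.restrict_apply_univ]; exact hΩb.measure_lt_top⟩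
  obtain ⟨B, hB₀, hB⟩ := integral_norm_le_of_eLpNorm_le (F := F) (Ω := Ω) hp₁.le hM
  obtain ⟨Ca, hCa⟩ := ha.2.1.exists_bound_of_continuous ha.1.continuous
  have hCa0 : 0 ≤ Ca := (norm_nonneg _).trans (hCa 0)
  intro κ hκ
  have hL0 : 0 < Ca * ‖e‖ + 1 := by positivity
  obtain ⟨δ, hδ, h⟩ := exists_layer_le (P := P) hΩ hΩb hr₀ hε hε₀ hp₁ hp hf hM hfM
    (div_pos hκ hL0)
  refine ⟨δ, hδ, fun θ hθ hθδ => ?_⟩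
  filter_upwards [h θ hθ hθδ] with k hk
  obtain ⟨hfi, hfB⟩ := hB (f k) (hf k).aestronglyMeasurable (hfM k)
  have hae : ∀ᵐ z ∂(volume.restrict Ω), |a z * inner ℝ e (f k z) -
      ∑ n, (P k).cut θ n z * a z * 1 * inner ℝ e (f k z)| ≤
      Ca * ‖e‖ * (‖f k z‖ * (1 - (P k).cutSum θ z)) ∧ |(P k).cutSum θ z| ≤ 1 := by
    filter_upwards [ae_mem_iUnion_sub (P := P k) (hε k) hΩ.measurableSet] with z hz
    obtain ⟨n, hn⟩ := mem_iUnion.1 hz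
    have h1 : ∑ n, (P k).cut θ n z * a z * 1 * inner ℝ e (f k z) =
        (P k).cutSum θ z * (a z * inner ℝ e (f k z)) := by
      rw [cutSum, Finset.sum_mul]
      exact Finset.sum_congr rfl fun n _ => by ring
    have h2 : 0 ≤ (P k).cutSum θ z := cutSum_nonneg hθ z
    have h3 : (P k).cutSum θ z ≤ 1 := by
      rw [cutSum_of_mem (hε k) hθ hn]; exact hθ.le_one _
    refine ⟨?_, abs_le.2 ⟨by linarith, h3⟩⟩
    have h4 : a z * inner ℝ e (f k z) - (P k).cutSum θ z * (a z * inner ℝ e (f k z)) =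
        a z * (1 - (P k).cutSum θ z) * inner ℝ e (f k z) := by ring
    rw [h1, h4]
    refine (abs_mul_mul_inner_le (hCa z) (abs_of_nonneg (sub_nonneg.2 h3)).le le_rfl).trans
      (le_of_eq ?_)
    ring
  have i1 : Integrable (fun z => a z * inner ℝ e (f k z)) (volume.restrict Ω) := by
    refine integrable_of_norm_le hfi (c := Ca * ‖e‖) (ha.1.continuous.aestronglyMeasurable.mul
      ((hfi.const_inner e).1)) (Eventually.of_forall fun z => ?_)
    rw [abs_mul, mul_assoc]
    exact mul_le_mul (hCa z) (abs_real_inner_le_norm _ _) (abs_nonneg _) hCa0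
  have hct := continuous_cutSum (P := P k) hθ
  have i2 : Integrable (fun z => ∑ n, (P k).cut θ n z * a z * 1 * inner ℝ e (f k z))
      (volume.restrict Ω) := by
    have h1 : (fun z => ∑ n, (P k).cut θ n z * a z * 1 * inner ℝ e (f k z)) =
        fun z => (P k).cutSum θ z * (a z * inner ℝ e (f k z)) := by
      funext z
      rw [cutSum, Finset.sum_mul]
      exact Finset.sum_congr rfl fun n _ => by ring
    rw [h1]
    refine i1.bdd_mul (c := 1) hct.aestronglyMeasurable (hae.mono fun z hz => hz.2)
  have i3 : Integrable (fun z => ‖f k z‖ * (1 - (P k).cutSum θ z)) (volume.restrict Ω) := by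
    refine hfi.norm.mul_bdd (c := 2) (continuous_const.sub hct).aestronglyMeasurable
      (hae.mono fun z hz => ?_)
    have := abs_le.1 hz.2
    rw [Real.norm_eq_abs, abs_le]
    constructor <;> linarith
  rw [cutPairing]
  refine (abs_integral_sub_le i1 i2 (i3.const_mul (Ca * ‖e‖)) (hae.mono fun z hz => hz.1)).trans ?_
  rw [integral_const_mul]
  calc Ca * ‖e‖ * ∫ z in Ω, ‖f k z‖ * (1 - (P k).cutSum θ z)
      ≤ Ca * ‖e‖ * (κ / (Ca * ‖e‖ + 1)) := mul_le_mul_of_nonneg_left hk (by positivity)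
    _ ≤ (Ca * ‖e‖ + 1) * (κ / (Ca * ‖e‖ + 1)) :=
        mul_le_mul_of_nonneg_right (by linarith) (div_pos hκ hL0).le
    _ = κ := mul_div_cancel₀ κ hL0.ne'

include hΩ hΩb hD hr₀ hr₁ hε hε₀ hp₁ hp hf hM hfM hU hG in
/-- The mean value over the cell of the unfolded limit is the weak limit. -/
theorem integral_unfolded_limit {f₀ : E d → F} {a : E d → ℝ} (ha : IsTestFunction Ω a) (e : F)
    (hf₀ : Tendsto (fun k => ∫ z in Ω, a z * inner ℝ e (f k z)) atTop
      (𝓝 (∫ z in Ω, a z * inner ℝ e (f₀ z)))) :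
    ∫ z, a z.1 * inner ℝ e (G z) ∂((volume.restrict Ω).prod (volume.restrict (unitCell d))) =
      ∫ z in Ω, a z * inner ℝ e (f₀ z) := by
  have h1 := tendsto_unfoldedPairing (P := P) hΩ hΩb hU hG ha (Φ := fun _ => 1) continuous_const
    (CΦ := 1) (by simp) (m := fun _ => e) continuous_const (Cm := ‖e‖) (fun _ _ => le_rfl)
  have h2 : CutoffApprox d _ _ := fun κ hκ => exists_transfer (P := P) hΩ hΩb hD hr₀ hr₁ hε hε₀
    hp₁ hp hf hM hfM ha (Φ := fun _ => 1) continuous_const (fun _ _ => rfl) (CΦ := 1) (by simp)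
    (m := fun _ => e) uniformContinuous_const (Cm := ‖e‖) (fun _ _ => le_rfl) hκ
  have h3 := cutoffApprox_integral (P := P) (D := D) hΩ hΩb hr₀ hε hε₀ hp₁ hp hf hM hfM ha e
  -- Both sequences are approximated by the same cutoff functional, so their difference is
  -- approximated by 0.
  have h4 := (h2.sub h3).eq_zero_of_tendsto (fun θ _ => by simp) (h1.sub hf₀)
  simp only [mul_one] at h4
  linarith

end Limit

section Gradient

include hε hr₁ hε₀ in
theorem tendsto_mul_one_add (c : ℝ) :
    Tendsto (fun k => ε k * (1 + (ε k ^ r)⁻¹) * c) atTop (𝓝 0) := by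
  have h := (hε₀.mul_const c).add (tendsto_div_rpow_zero hr₁ hε hε₀ c)
  rw [zero_mul, add_zero] at h
  refine h.congr fun k => ?_
  ring

variable {w : ℕ → W1p Ω p} {M : ℝ≥0∞} (hM : M ≠ ⊤)
  (hwM : ∀ k, eLpNorm (w k).fn p (volume.restrict Ω) ≤ M)
  (hgM : ∀ k, eLpNorm (w k).grad p (volume.restrict Ω) ≤ M)
  {U : ℕ → Lp ℝ p ((volume.restrict Ω).prod (volume.restrict (unitCell d)))}
  {W : Lp ℝ p ((volume.restrict Ω).prod (volume.restrict (unitCell d)))}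
  (hU : ∀ k, (U k : E d × E d → ℝ) =ᵐ[(volume.restrict Ω).prod (volume.restrict (unitCell d))]
    fun z => (P k).unfolding D (w k).fn z.1 z.2)
  (hW : WeakTendsto U W)
  {U' : ℕ → Lp (E d) p ((volume.restrict Ω).prod (volume.restrict (unitCell d)))}
  {G : Lp (E d) p ((volume.restrict Ω).prod (volume.restrict (unitCell d)))}
  (hU' : ∀ k, (U' k : E d × E d → E d) =ᵐ[(volume.restrict Ω).prod (volume.restrict (unitCell d))]
    fun z => (P k).unfolding D (w k).grad z.1 z.2)
  (hG : WeakTendsto U' G)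

include hΩ hΩb hD hr₀ hr₁ hε hε₀ hp₁ hp hM hwM hgM hU hW in
-- The weak y-gradient of the limit W vanishes: the localised pairing with ∂_vΨ is at most a
-- constant times ε (1 + ε^{-r}).
theorem integral_unfolded_limit_mul_fderiv {a Ψ : E d → ℝ} (ha : IsTestFunction Ω a)
    (hΨ : IsPeriodicTest Ψ) (v : E d) :
    ∫ z, a z.1 * fderiv ℝ Ψ z.2 v * W z
      ∂((volume.restrict Ω).prod (volume.restrict (unitCell d))) = 0 := by
  have : IsFiniteMeasure (volume.restrict Ω) :=
    ⟨by rw [Measure.restrict_apply_univ]; exact hΩb.measure_lt_top⟩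
  obtain ⟨B, hB₀, hB⟩ := integral_norm_le_of_eLpNorm_le (F := ℝ) (Ω := Ω) hp₁.le hM
  obtain ⟨B', hB₀', hB'⟩ := integral_norm_le_of_eLpNorm_le (F := E d) (Ω := Ω) hp₁.le hM
  obtain ⟨CΨ, hCΨ⟩ := exists_bound_of_periodic hΨ.smooth.continuous hΨ.periodic
  obtain ⟨CΦ, hCΦ⟩ := exists_bound_of_periodic (hΨ.continuous_fderiv v) (hΨ.periodic_fderiv v)
  obtain ⟨C, hC₀, hC⟩ := hD.lipschitz.exists_bound hΩb
  have hCΨ0 : 0 ≤ CΨ := (abs_nonneg _).trans (hCΨ 0)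
  have h1 := tendsto_unfoldedPairing (P := P) hΩ hΩb hU hW ha (hΨ.continuous_fderiv v) hCΦ
    (m := fun _ => (1 : ℝ)) continuous_const (Cm := 1) (fun _ _ => by simp)
  have h2 : CutoffApprox d _ _ := fun κ hκ => exists_transfer (P := P) hΩ hΩb hD hr₀ hr₁ hε hε₀
    hp₁ hp (fun k => (w k).stronglyMeasurable_fn) hM hwM ha (hΨ.continuous_fderiv v)
    (hΨ.periodic_fderiv v) hCΦ (m := fun _ => (1 : ℝ)) uniformContinuous_const (Cm := 1)
    (fun _ _ => by simp) hκ
  have h3 := h2.eq_zero_of_tendsto (fun θ hθ => by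
    obtain ⟨c, hc, hloc⟩ := exists_norm_fderiv_localTest_le (r := r) hθ ha
    refine squeeze_zero_norm (fun k => ?_)
      (tendsto_mul_one_add hr₁ hε hε₀ ((c * CΨ * (C * ‖v‖)) * (B + B')))
    obtain ⟨hi, hib⟩ := hB _ (w k).stronglyMeasurable_fn.aestronglyMeasurable (hwM k)
    obtain ⟨hi', hib'⟩ := hB' _ (w k).stronglyMeasurable_grad.aestronglyMeasurable (hgM k)
    have hs : 0 < (ε k ^ r)⁻¹ := inv_pos.2 (Real.rpow_pos_of_pos (hε k) r)
    have hεk := hε k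
    refine (abs_cutPairing_fn_le hθ ha (hε k) hD.invertible hΩ.measurableSet hΨ.smooth hCΨ hC₀ hC hc
      (hloc (P k) (hε k)) (w k) hi hi' v).trans ?_
    rw [mul_assoc]
    gcongr) h1
  simpa using h3

include hΩ hΩb hD hr₀ hr₁ hε hε₀ hp₁ hp hM hgM hU' hG in
-- The field D_xᵀ G is weakly curl-free in y on the torus; the antisymmetric combination of
-- localised pairings is at most a constant times ε (1 + ε^{-r}).
theorem integral_unfolded_grad_limit_comm {a Ψ : E d → ℝ} (ha : IsTestFunction Ω a)
    (hΨ : IsPeriodicTest Ψ) (v v' : E d) :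
    ∫ z, a z.1 * fderiv ℝ Ψ z.2 v' * inner ℝ (act (D z.1) v) (G z)
      ∂((volume.restrict Ω).prod (volume.restrict (unitCell d))) =
    ∫ z, a z.1 * fderiv ℝ Ψ z.2 v * inner ℝ (act (D z.1) v') (G z)
      ∂((volume.restrict Ω).prod (volume.restrict (unitCell d))) := by
  have : IsFiniteMeasure (volume.restrict Ω) :=
    ⟨by rw [Measure.restrict_apply_univ]; exact hΩb.measure_lt_top⟩
  obtain ⟨B', hB₀', hB'⟩ := integral_norm_le_of_eLpNorm_le (F := E d) (Ω := Ω) hp₁.le hM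
  obtain ⟨CΨ, hCΨ⟩ := exists_bound_of_periodic hΨ.smooth.continuous hΨ.periodic
  obtain ⟨C, hC₀, hC⟩ := hD.lipschitz.exists_bound hΩb
  have hCΨ0 : 0 ≤ CΨ := (abs_nonneg _).trans (hCΨ 0)
  have h1 : ∀ u u' : E d, Tendsto (fun k => (P k).unfoldedPairing D a (fun y => fderiv ℝ Ψ y u')
      (fun x => act (D x) u) (w k).grad) atTop
      (𝓝 (∫ z, a z.1 * fderiv ℝ Ψ z.2 u' * inner ℝ (act (D z.1) u) (G z)
      ∂((volume.restrict Ω).prod (volume.restrict (unitCell d))))) := fun u u' => by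
    obtain ⟨CΦ, hCΦ⟩ := exists_bound_of_periodic (hΨ.continuous_fderiv u') (hΨ.periodic_fderiv u')
    exact tendsto_unfoldedPairing (P := P) hΩ hΩb hU' hG ha (hΨ.continuous_fderiv u') hCΦ
      (hD.lipschitz.uniformContinuous_act u).continuous fun x hx => hC x hx u
  have h2 : ∀ u u' : E d, CutoffApprox d (fun k => (P k).unfoldedPairing D a
      (fun y => fderiv ℝ Ψ y u') (fun x => act (D x) u) (w k).grad)
      (fun θ k => (P k).cutPairing D θ a (fun y => fderiv ℝ Ψ y u') (fun x => act (D x) u)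
        (w k).grad) := fun u u' κ hκ => by
    obtain ⟨CΦ, hCΦ⟩ := exists_bound_of_periodic (hΨ.continuous_fderiv u') (hΨ.periodic_fderiv u')
    exact exists_transfer (P := P) hΩ hΩb hD hr₀ hr₁ hε hε₀ hp₁ hp
      (fun k => (w k).stronglyMeasurable_grad) hM hgM ha (hΨ.continuous_fderiv u')
      (hΨ.periodic_fderiv u') hCΦ (hD.lipschitz.uniformContinuous_act u) (fun x hx => hC x hx u) hκ
  have h3 := ((h2 v v').sub (h2 v' v)).eq_zero_of_tendsto (fun θ hθ => by
    obtain ⟨c, hc, hloc⟩ := exists_norm_fderiv_localTest_le (r := r) hθ ha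
    refine squeeze_zero_norm (fun k => ?_)
      (tendsto_mul_one_add hr₁ hε hε₀ ((2 * c * CΨ * (C * ‖v‖) * (C * ‖v'‖)) * B'))
    obtain ⟨hi', hib'⟩ := hB' _ (w k).stronglyMeasurable_grad.aestronglyMeasurable (hgM k)
    have hs : 0 < (ε k ^ r)⁻¹ := inv_pos.2 (Real.rpow_pos_of_pos (hε k) r)
    have hεk := hε k
    refine (abs_cutPairing_grad_sub_le hθ ha (hε k) hD.invertible hΩ.measurableSet hΨ.smooth hCΨ hC₀
      hC hc (hloc (P k) (hε k)) (w k) hi' v v').trans ?_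
    rw [mul_assoc]
    gcongr) ((h1 v v').sub (h1 v' v))
  linarith

end Gradient

end CubePartition

/-! ### The unit cell as a fundamental domain of ℤ^d -/

section FundamentalDomain

variable {d : ℕ}

theorem intVec_add (ξ η : Fin d → ℤ) : intVec (ξ + η) = intVec ξ + intVec η := by
  ext i; simp

theorem ae_notMem_gridSet : ∀ᵐ y : E d, y ∉ gridSet d :=
  measure_eq_zero_iff_ae_notMem.1 volume_gridSet

/-- The fractional part `y - [y]_Y`. -/
noncomputable def fractPart (y : E d) : E d := y - intPart y

theorem measurable_fractPart : Measurable (fractPart : E d → E d) :=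
  measurable_id.sub CubePartition.measurable_intPart

theorem fractPart_of_mem {y : E d} (hy : y ∈ unitCell d) : fractPart y = y := by
  rw [fractPart, intPart_eq_zero hy, sub_zero]

theorem fractPart_add_intVec (y : E d) (ξ : Fin d → ℤ) : fractPart (y + intVec ξ) = fractPart y := by
  rw [fractPart, intPart_add_intVec, fractPart]
  abel

theorem apply_fractPart {X : Type*} {Ψ : E d → X} (hΨ : ∀ y ξ, Ψ (y + intVec ξ) = Ψ y) (y : E d) :
    Ψ (fractPart y) = Ψ y := by
  conv_rhs => rw [← sub_add_cancel y (intPart y), intPart_eq_intVec, hΨ]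
  rfl

/-- The translates of the unit cell. -/
def cellAt (ξ : Fin d → ℤ) : Set (E d) := (fun y => y - intVec ξ) ⁻¹' unitCell d

theorem measurableSet_cellAt (ξ : Fin d → ℤ) : MeasurableSet (cellAt ξ) :=
  (isOpen_unitCell.preimage (continuous_id.sub continuous_const)).measurableSet

theorem cellAt_disjoint : Pairwise fun ξ η : Fin d → ℤ => Disjoint (cellAt ξ) (cellAt η) := by
  intro ξ η hne
  rw [Set.disjoint_left]
  intro y hy hy'
  have h : ∀ {ζ : Fin d → ℤ}, y ∈ cellAt ζ → intPart y = intVec ζ := fun {ζ} hζ => by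
    have := intPart_add_intVec (y - intVec ζ) ζ
    rwa [sub_add_cancel, intPart_eq_zero hζ, zero_add] at this
  exact hne (intVec_injective ((h hy).symm.trans (h hy')))

theorem mem_cellAt_floor {y : E d} (hy : y ∉ gridSet d) : y ∈ cellAt fun i => ⌊y i⌋ :=
  sub_intPart_mem_unitCell hy

theorem iUnion_cellAt_ae : (⋃ ξ, cellAt ξ : Set (E d)) =ᵐ[volume] univ := by
  filter_upwards [ae_notMem_gridSet] with y hy
  exact eq_true (mem_iUnion.2 ⟨_, mem_cellAt_floor hy⟩) |>.trans (eq_true (mem_univ y)).symm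

theorem lintegral_cellAt (ξ : Fin d → ℤ) (f : E d → ℝ≥0∞) :
    ∫⁻ y in cellAt ξ, f y = ∫⁻ y in unitCell d, f (y + intVec ξ) := by
  rw [← lintegral_indicator (measurableSet_cellAt ξ), ← lintegral_indicator
    isOpen_unitCell.measurableSet, ← lintegral_add_right_eq_self _ (intVec ξ)]
  refine lintegral_congr fun y => ?_
  by_cases hy : y ∈ unitCell d
  · rw [indicator_of_mem hy, indicator_of_mem]
    change y + intVec ξ - intVec ξ ∈ unitCell d
    rwa [add_sub_cancel_right]
  · rw [indicator_of_notMem hy, indicator_of_notMem]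
    intro h
    change y + intVec ξ - intVec ξ ∈ unitCell d at h
    rw [add_sub_cancel_right] at h
    exact hy h

theorem integral_cellAt (ξ : Fin d → ℤ) (f : E d → ℝ) :
    ∫ y in cellAt ξ, f y = ∫ y in unitCell d, f (y + intVec ξ) := by
  rw [← integral_indicator (measurableSet_cellAt ξ), ← integral_indicator
    isOpen_unitCell.measurableSet, ← integral_add_right_eq_self _ (intVec ξ)]
  refine integral_congr_ae (Eventually.of_forall fun y => ?_)
  by_cases hy : y ∈ unitCell d
  · simp only
    rw [indicator_of_mem hy, indicator_of_mem]
    change y + intVec ξ - intVec ξ ∈ unitCell d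
    rwa [add_sub_cancel_right]
  · simp only
    rw [indicator_of_notMem hy, indicator_of_notMem]
    intro h
    change y + intVec ξ - intVec ξ ∈ unitCell d at h
    rw [add_sub_cancel_right] at h
    exact hy h

theorem lintegral_eq_tsum_unitCell (f : E d → ℝ≥0∞) :
    ∫⁻ y, f y = ∑' ξ : Fin d → ℤ, ∫⁻ y in unitCell d, f (y + intVec ξ) := by
  rw [← setLIntegral_univ, ← setLIntegral_congr iUnion_cellAt_ae,
    lintegral_iUnion measurableSet_cellAt cellAt_disjoint]
  exact tsum_congr fun ξ => lintegral_cellAt ξ f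

theorem integral_eq_tsum_unitCell {f : E d → ℝ} (hf : Integrable f) :
    ∫ y, f y = ∑' ξ : Fin d → ℤ, ∫ y in unitCell d, f (y + intVec ξ) := by
  rw [← setIntegral_univ, ← setIntegral_congr_set iUnion_cellAt_ae,
    integral_iUnion measurableSet_cellAt cellAt_disjoint hf.integrableOn]
  exact tsum_congr fun ξ => integral_cellAt ξ f

/-- Integrals of periodic functions over the cell are translation invariant. -/
theorem lintegral_unitCell_sub {f : E d → ℝ≥0∞} (hf : Measurable f)
    (hper : ∀ y ξ, f (y + intVec ξ) = f y) (b : E d) :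
    ∫⁻ y in unitCell d, f (y - b) = ∫⁻ y in unitCell d, f y := by
  have hmY : MeasurableSet (unitCell d) := isOpen_unitCell.measurableSet
  have hg : ∀ ξ : Fin d → ℤ, Measurable fun y : E d =>
      (unitCell d).indicator (fun _ => (1 : ℝ≥0∞)) (y + intVec ξ + b) * f y := fun ξ =>
    ((measurable_const.indicator hmY).comp (by fun_prop)).mul hf
  calc ∫⁻ y in unitCell d, f (y - b)
      = ∫⁻ y, (unitCell d).indicator (fun _ => 1) y * f (y - b) := by
        rw [← lintegral_indicator hmY]
        refine lintegral_congr fun y => ?_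
        by_cases hy : y ∈ unitCell d <;> simp [hy]
    _ = ∫⁻ y, (unitCell d).indicator (fun _ => 1) (y + b) * f y := by
        rw [← lintegral_add_right_eq_self _ b]
        simp
    _ = ∑' ξ : Fin d → ℤ, ∫⁻ y in unitCell d,
          (unitCell d).indicator (fun _ => 1) (y + intVec ξ + b) * f y := by
        rw [lintegral_eq_tsum_unitCell]
        simp only [hper]
    _ = ∫⁻ y in unitCell d, ∑' ξ : Fin d → ℤ,
          (unitCell d).indicator (fun _ => 1) (y + intVec ξ + b) * f y :=
        (lintegral_tsum fun ξ => (hg ξ).aemeasurable).symm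
    _ = ∫⁻ y in unitCell d, f y := by
        have h1 : ∀ᵐ y : E d, y + b ∉ gridSet d :=
          (measurePreserving_add_right volume b).quasiMeasurePreserving.ae ae_notMem_gridSet
        refine lintegral_congr_ae (ae_restrict_of_ae ?_)
        filter_upwards [h1] with y hy
        rw [ENNReal.tsum_mul_right]
        set η : Fin d → ℤ := fun i => -⌊(y + b) i⌋ with hη
        -- For almost every y exactly one integer translate of y + b lies in Y, namely the one by η,
        -- minus the integer part.
        have h2 : ∑' ξ : Fin d → ℤ, (unitCell d).indicator (fun _ => (1 : ℝ≥0∞))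
            (y + intVec ξ + b) = 1 := by
          have h3 : ∀ ξ : Fin d → ℤ, y + intVec ξ + b ∈ unitCell d ↔ y + b ∈ cellAt (-ξ) := by
            intro ξ
            change _ ↔ y + b - intVec (-ξ) ∈ unitCell d
            have : intVec (-ξ) = -intVec ξ := by ext i; simp
            rw [this, sub_neg_eq_add, add_right_comm]
          rw [tsum_eq_single η]
          · refine indicator_of_mem ((h3 η).2 ?_) _
            have : -η = fun i => ⌊(y + b) i⌋ := by funext i; simp [hη]
            rw [this]
            exact mem_cellAt_floor hy
          · intro ξ hξ
            refine indicator_of_notMem (fun h => hξ ?_) _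
            by_contra hne
            have h4 : y + b ∈ cellAt (-η) := by
              have : -η = fun i => ⌊(y + b) i⌋ := by funext i; simp [hη]
              rw [this]
              exact mem_cellAt_floor hy
            exact Set.disjoint_left.1 (cellAt_disjoint fun h => hne (neg_injective h))
              ((h3 ξ).1 h) h4
        rw [h2, one_mul]

/-- Translations of the torus preserve its measure: apply the invariance of periodic integrals to
indicators. -/
theorem measurePreserving_fractPart_sub (b : E d) :
    MeasurePreserving (fun y => fractPart (y - b)) (volume.restrict (unitCell d))
      (volume.restrict (unitCell d)) := by
  have hm : Measurable fun y : E d => fractPart (y - b) :=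
    measurable_fractPart.comp (measurable_id.sub_const b)
  refine ⟨hm, ?_⟩
  ext S hS
  rw [Measure.map_apply hm hS, ← lintegral_indicator_one (hm hS), ← lintegral_indicator_one hS]
  have hf : Measurable fun y : E d => S.indicator (1 : E d → ℝ≥0∞) (fractPart y) :=
    (measurable_one.indicator hS).comp measurable_fractPart
  have h := lintegral_unitCell_sub hf (fun y ξ => by rw [fractPart_add_intVec]) b
  refine Eq.trans (lintegral_congr fun y => ?_) (h.trans ?_)
  · rfl
  · refine setLIntegral_congr_fun isOpen_unitCell.measurableSet fun y hy => ?_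
    simp only [fractPart_of_mem hy]

/-- Translation of a product of a function on the cell with a periodic function. -/
theorem integral_fractPart_sub_mul {f : E d → ℝ} (hf : StronglyMeasurable f) {Ψ : E d → ℝ}
    (hΨ : Continuous Ψ) (hper : ∀ y ξ, Ψ (y + intVec ξ) = Ψ y) (b : E d) :
    ∫ y in unitCell d, f (fractPart (y - b)) * Ψ y = ∫ y in unitCell d, f y * Ψ (y + b) := by
  have hmp := measurePreserving_fractPart_sub b
  have h1 := integral_map (μ := volume.restrict (unitCell d)) hmp.measurable.aemeasurable
    (f := fun y => f y * Ψ (y + b))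
    (hf.mul (hΨ.comp (continuous_id.add continuous_const)).stronglyMeasurable).aestronglyMeasurable
  rw [hmp.map_eq] at h1
  rw [h1]
  refine integral_congr_ae (Eventually.of_forall fun y => ?_)
  simp only
  congr 1
  have h2 : ∀ y ξ, Ψ (y + intVec ξ + b) = Ψ (y + b) := fun y ξ => by
    rw [add_right_comm, hper]
  rw [apply_fractPart (Ψ := fun y => Ψ (y + b)) h2, sub_add_cancel]

theorem integral_unitCell_add {Ψ : E d → ℝ} (hΨ : Continuous Ψ)
    (hper : ∀ y ξ, Ψ (y + intVec ξ) = Ψ y) (b : E d) :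
    ∫ y in unitCell d, Ψ (y + b) = ∫ y in unitCell d, Ψ y := by
  have := integral_fractPart_sub_mul (f := fun _ => 1) stronglyMeasurable_const hΨ hper b
  simpa using this.symm

theorem finite_intVec {S K : Set (E d)} (hS : Bornology.IsBounded S) (hK : Bornology.IsBounded K) :
    {ξ : Fin d → ℤ | ∃ y ∈ S, y + intVec ξ ∈ K}.Finite := by
  obtain ⟨R, hR⟩ := hK.subset_closedBall 0
  obtain ⟨R', hR'⟩ := hS.subset_closedBall 0
  refine (Set.Finite.pi' (t := fun _ : Fin d => {m : ℤ | |(m : ℝ)| ≤ R + R'})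
    fun i => ?_).subset ?_
  · refine (Set.finite_Icc (-⌈R + R'⌉) ⌈R + R'⌉).subset fun m hm => ?_
    have h1 := abs_le.1 (show |(m : ℝ)| ≤ R + R' from hm)
    have h2 := Int.le_ceil (R + R')
    constructor
    · have : (-(⌈R + R'⌉ : ℤ) : ℝ) ≤ m := by linarith
      exact_mod_cast this
    · have : (m : ℝ) ≤ (⌈R + R'⌉ : ℤ) := by linarith
      exact_mod_cast this
  · rintro ξ ⟨y, hy, hyK⟩ i
    have h1 : ‖y‖ ≤ R' := by simpa using hR' hy
    have h2 : ‖y + intVec ξ‖ ≤ R := by simpa using hR hyK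
    have h3 := abs_le.1 ((abs_apply_le_norm (y + intVec ξ) i).trans h2)
    have h4 := abs_le.1 ((abs_apply_le_norm y i).trans h1)
    rw [PiLp.add_apply, intVec_apply] at h3
    change |(ξ i : ℝ)| ≤ R + R'
    rw [abs_le]
    constructor <;> linarith [h4.1, h4.2, h3.1, h3.2]

/-- The periodic extension of an integrable function on the cell is locally integrable. -/
theorem integrableOn_periodic {F : Type*} [NormedAddCommGroup F] {f : E d → F}
    (hf : StronglyMeasurable f)
    (hfi : Integrable f (volume.restrict (unitCell d))) {K : Set (E d)} (hKm : MeasurableSet K)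
    (hK : Bornology.IsBounded K) : IntegrableOn (fun y => f (fractPart y)) K := by
  refine ⟨(hf.comp_measurable measurable_fractPart).aestronglyMeasurable, ?_⟩
  rw [hasFiniteIntegral_iff_enorm, ← lintegral_indicator hKm, lintegral_eq_tsum_unitCell]
  have hfin := finite_intVec isBounded_unitCell hK
  rw [tsum_eq_sum (s := hfin.toFinset)]
  · refine ENNReal.sum_lt_top.2 fun ξ _ => ?_
    refine lt_of_le_of_lt ?_ hfi.2
    refine setLIntegral_mono' isOpen_unitCell.measurableSet fun y hy => ?_
    by_cases h : y + intVec ξ ∈ K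
    · rw [indicator_of_mem h, fractPart_add_intVec, fractPart_of_mem hy]
    · rw [indicator_of_notMem h]
      exact zero_le
  · intro ξ hξ
    rw [← lintegral_zero (μ := volume.restrict (unitCell d))]
    refine setLIntegral_congr_fun isOpen_unitCell.measurableSet fun y hy => ?_
    refine indicator_of_notMem (fun h => hξ ?_) _
    rw [Set.Finite.mem_toFinset]
    exact ⟨y, hy, h⟩

end FundamentalDomain

/-! ### Periodization of compactly supported functions -/

section Periodization

variable {d : ℕ}

/-- The sum of all integer translates of a function. -/
noncomputable def periodize (g : E d → ℝ) (y : E d) : ℝ := ∑ᶠ ξ : Fin d → ℤ, g (y + intVec ξ)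

theorem periodize_add_intVec (g : E d → ℝ) (y : E d) (η : Fin d → ℤ) :
    periodize g (y + intVec η) = periodize g y := by
  unfold periodize
  refine Eq.trans (finsum_congr fun ξ => ?_)
    (finsum_comp_equiv (f := fun ξ : Fin d → ℤ => g (y + intVec ξ)) (Equiv.addLeft η))
  rw [Equiv.coe_addLeft, intVec_add, add_assoc]

/-- Only finitely many translates of a bounded set meet the support. One finite index set serves all
h supported inside the support of g, in particular derivatives of g. -/
theorem exists_finset_periodize {g : E d → ℝ} (hg : HasCompactSupport g) {S : Set (E d)}
    (hS : Bornology.IsBounded S) : ∃ B : Finset (Fin d → ℤ),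
      (∀ ξ ∉ B, ∀ y ∈ S, y + intVec ξ ∉ tsupport g) ∧
      ∀ h : E d → ℝ, tsupport h ⊆ tsupport g → ∀ y ∈ S,
        periodize h y = ∑ ξ ∈ B, h (y + intVec ξ) := by
  have hfin := finite_intVec hS hg.isCompact.isBounded
  have h0 : ∀ ξ ∉ hfin.toFinset, ∀ y ∈ S, y + intVec ξ ∉ tsupport g := by
    intro ξ hξ y hy h
    exact hξ (hfin.mem_toFinset.2 ⟨y, hy, h⟩)
  refine ⟨hfin.toFinset, h0, fun h hh y hy => ?_⟩
  refine finsum_eq_sum_of_support_subset _ fun ξ hξ => ?_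
  by_contra hne
  exact hξ (image_eq_zero_of_notMem_tsupport fun h' => h0 ξ hne y hy (hh h'))

/-- Near each point the sum is finite with fixed index set, so it is smooth and may be
differentiated term by term. -/
theorem isPeriodicTest_periodize {φ : E d → ℝ} (hφ : IsTestFunction univ φ) :
    IsPeriodicTest (periodize φ) ∧
      ∀ y v, fderiv ℝ (periodize φ) y v = periodize (fun z => fderiv ℝ φ z v) y := by
  have hloc : ∀ y₀ : E d, ∃ B : Finset (Fin d → ℤ),
      (periodize φ =ᶠ[𝓝 y₀] fun y => ∑ ξ ∈ B, φ (y + intVec ξ)) ∧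
      ∀ v, periodize (fun z => fderiv ℝ φ z v) y₀ = ∑ ξ ∈ B, fderiv ℝ φ (y₀ + intVec ξ) v := by
    intro y₀
    obtain ⟨B, -, hB⟩ := exists_finset_periodize hφ.2.1 (Metric.isBounded_ball (x := y₀) (r := 1))
    refine ⟨B, ?_, fun v => hB _ (tsupport_fderiv_apply_subset ℝ v) y₀ (Metric.mem_ball_self one_pos)⟩
    filter_upwards [Metric.ball_mem_nhds y₀ one_pos] with y hy
    exact hB φ subset_rfl y hy
  have hd : Differentiable ℝ φ := hφ.1.differentiable (by simp)
  refine ⟨⟨contDiff_iff_contDiffAt.2 fun y₀ => ?_, periodize_add_intVec φ⟩, fun y₀ v => ?_⟩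
  · obtain ⟨B, hB, -⟩ := hloc y₀
    refine ContDiffAt.congr_of_eventuallyEq ?_ hB
    exact (ContDiff.sum fun ξ _ => hφ.1.comp (contDiff_id.add contDiff_const)).contDiffAt
  · obtain ⟨B, hB, hB'⟩ := hloc y₀
    have hdξ : ∀ ξ ∈ B, DifferentiableAt ℝ (fun y => φ (y + intVec ξ)) y₀ := fun ξ _ =>
      (hd _).comp y₀ (differentiableAt_id.add_const (intVec ξ))
    rw [hB.fderiv_eq, hB', fderiv_fun_sum hdξ]
    simp only [sum_apply, fderiv_comp_add_right]

theorem integrable_fractPart_mul {f : E d → ℝ} (hf : StronglyMeasurable f)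
    (hfi : Integrable f (volume.restrict (unitCell d))) {g : E d → ℝ} (hg : Continuous g)
    (hs : HasCompactSupport g) : Integrable fun y => f (fractPart y) * g y := by
  obtain ⟨C, hC⟩ := hs.exists_bound_of_continuous hg
  have h1 := integrableOn_periodic hf hfi (isClosed_tsupport g).measurableSet hs.isCompact.isBounded
  have h2 : IntegrableOn (fun y => f (fractPart y) * g y) (tsupport g) :=
    h1.mul_bdd (c := C) hg.aestronglyMeasurable (Eventually.of_forall hC)
  rwa [integrableOn_iff_integrable_of_support_subset] at h2
  intro y hy
  exact subset_tsupport g (Function.mem_support.2 (right_ne_zero_of_mul hy))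

/-- Split ℝ^d into integer translates of Y; the first factor is the same on all of them, and the
second sums to the periodization. -/
theorem integral_mul_periodize {f : E d → ℝ} (hf : StronglyMeasurable f)
    (hfi : Integrable f (volume.restrict (unitCell d))) {g : E d → ℝ} (hg : Continuous g)
    (hs : HasCompactSupport g) :
    ∫ y, f (fractPart y) * g y = ∫ y in unitCell d, f y * periodize g y := by
  obtain ⟨B, hB, hB'⟩ := exists_finset_periodize hs (isBounded_unitCell (d := d))
  obtain ⟨C, hC⟩ := hs.exists_bound_of_continuous hg
  rw [integral_eq_tsum_unitCell (integrable_fractPart_mul hf hfi hg hs)]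
  have h1 : ∀ ξ : Fin d → ℤ, ∫ y in unitCell d, f (fractPart (y + intVec ξ)) * g (y + intVec ξ) =
      ∫ y in unitCell d, f y * g (y + intVec ξ) := fun ξ =>
    setIntegral_congr_fun isOpen_unitCell.measurableSet fun y hy => by
      simp only [fractPart_add_intVec, fractPart_of_mem hy]
  simp only [h1]
  rw [tsum_eq_sum (s := B)]
  · rw [← integral_finsetSum]
    · refine setIntegral_congr_fun isOpen_unitCell.measurableSet fun y hy => ?_
      simp only [hB' g subset_rfl y hy, Finset.mul_sum]
    · intro ξ _
      exact hfi.mul_bdd (c := C) (hg.comp (continuous_id.add continuous_const)).aestronglyMeasurable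
        (Eventually.of_forall fun y => hC _)
  · intro ξ hξ
    rw [← integral_zero (E d) ℝ]
    refine setIntegral_congr_fun isOpen_unitCell.measurableSet fun y hy => ?_
    simp only [image_eq_zero_of_notMem_tsupport (hB ξ hξ y hy), mul_zero]

end Periodization

theorem ae_eq_zero_of_integral_test {d : ℕ} {U : Set (E d)} (hU : IsOpen U) {f : E d → ℝ}
    (hf : Integrable f (volume.restrict U))
    (h : ∀ φ : E d → ℝ, IsTestFunction U φ → ∫ x in U, φ x * f x = 0) :
    ∀ᵐ x ∂(volume.restrict U), f x = 0 := by
  have h1 := hU.ae_eq_zero_of_integral_contDiff_smul_eq_zero (μ := volume.restrict U)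
    (hf.locallyIntegrable.locallyIntegrableOn U) fun g hg hs hgU => h g ⟨hg, hs, hgU⟩
  filter_upwards [h1, ae_restrict_mem hU.measurableSet] with x hx hx'
  exact hx hx'

/-! ### Translating periodic test functions -/

section Translation

variable {d : ℕ}

instance : IsProbabilityMeasure (volume.restrict (Ioc (0 : ℝ) 1)) :=
  ⟨by simp⟩

theorem IsPeriodicTest.comp_add {Ψ : E d → ℝ} (hΨ : IsPeriodicTest Ψ) (b : E d) :
    IsPeriodicTest fun y => Ψ (y + b) :=
  ⟨hΨ.smooth.comp (contDiff_id.add contDiff_const), fun y ξ => by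
    rw [add_right_comm, hΨ.periodic]⟩

theorem IsPeriodicTest.exists_bound_fderiv {Ψ : E d → ℝ} (hΨ : IsPeriodicTest Ψ) :
    ∃ C : ℝ, ∀ y v, |fderiv ℝ Ψ y v| ≤ C * ‖v‖ := by
  have hc : Continuous (fderiv ℝ Ψ) := hΨ.smooth.continuous_fderiv (by simp)
  obtain ⟨C, hC⟩ := exists_bound_of_periodic (Ψ := fun y => ‖fderiv ℝ Ψ y‖) hc.norm
    (fun y ξ => by
      congr 1
      ext v
      exact hΨ.periodic_fderiv v y ξ)
  refine ⟨C, fun y v => ((fderiv ℝ Ψ y).le_opNorm v).trans ?_⟩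
  exact mul_le_mul_of_nonneg_right ((le_abs_self _).trans (hC y)) (norm_nonneg _)

theorem integral_fderiv_segment {Ψ : E d → ℝ} (hΨ : IsPeriodicTest Ψ) (y s : E d) :
    ∫ t in Ioc (0 : ℝ) 1, fderiv ℝ Ψ (y + t • s) s = Ψ (y + s) - Ψ y := by
  have hd : Differentiable ℝ Ψ := hΨ.smooth.differentiable (by simp)
  have hc : Continuous (fderiv ℝ Ψ) := hΨ.smooth.continuous_fderiv (by simp)
  have h1 : ∀ t ∈ uIcc (0 : ℝ) 1, HasDerivAt (fun t : ℝ => Ψ (y + t • s))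
      (fderiv ℝ Ψ (y + t • s) s) t := fun t _ => by
    have h2 : HasDerivAt (fun t : ℝ => y + t • s) s t := by
      simpa using ((hasDerivAt_id t).smul_const s).const_add y
    exact (hd _).hasFDerivAt.comp_hasDerivAt t h2
  have h3 : Continuous fun t : ℝ => fderiv ℝ Ψ (y + t • s) s :=
    (hc.comp (by fun_prop)).clm_apply continuous_const
  have h4 := intervalIntegral.integral_eq_sub_of_hasDerivAt h1 (h3.intervalIntegrable 0 1)
  rw [intervalIntegral.integral_of_le zero_le_one] at h4
  simpa using h4

/-- Fubini and the fundamental theorem of calculus along the segment from y to y + s. -/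
theorem integral_mul_translate_sub {f : E d → ℝ}
    (hfi : Integrable f (volume.restrict (unitCell d))) {Ψ : E d → ℝ} (hΨ : IsPeriodicTest Ψ)
    (s : E d) :
    ∫ t in Ioc (0 : ℝ) 1, ∫ y in unitCell d, f y * fderiv ℝ Ψ (y + t • s) s =
      (∫ y in unitCell d, f y * Ψ (y + s)) - ∫ y in unitCell d, f y * Ψ y := by
  obtain ⟨C, hC⟩ := hΨ.exists_bound_fderiv
  obtain ⟨C', hC'⟩ := exists_bound_of_periodic hΨ.smooth.continuous hΨ.periodic
  have hΨc := hΨ.smooth.continuous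
  have hc : Continuous (fderiv ℝ Ψ) := hΨ.smooth.continuous_fderiv (by simp)
  have h1 : Integrable (Function.uncurry fun (t : ℝ) (y : E d) => f y * fderiv ℝ Ψ (y + t • s) s)
      ((volume.restrict (Ioc (0 : ℝ) 1)).prod (volume.restrict (unitCell d))) := by
    have h2 : Integrable (fun z : ℝ × E d => f z.2)
        ((volume.restrict (Ioc (0 : ℝ) 1)).prod (volume.restrict (unitCell d))) := hfi.comp_snd _
    refine h2.mul_bdd (c := C * ‖s‖) ?_ (Eventually.of_forall fun z => hC _ _)
    exact (Continuous.clm_apply (hc.comp (by fun_prop)) continuous_const).aestronglyMeasurable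
  rw [integral_integral_swap h1]
  have i1 : Integrable (fun y => f y * Ψ (y + s)) (volume.restrict (unitCell d)) :=
    hfi.mul_bdd (c := C') (by fun_prop) (Eventually.of_forall fun y => hC' _)
  have i2 : Integrable (fun y => f y * Ψ y) (volume.restrict (unitCell d)) :=
    hfi.mul_bdd (c := C') (by fun_prop) (Eventually.of_forall fun y => hC' _)
  rw [← integral_sub i1 i2]
  refine integral_congr_ae (Eventually.of_forall fun y => ?_)
  simp only [integral_const_mul, integral_fderiv_segment hΨ]
  ring

/-- After Fubini the inner integral is the mean of a translate of Ψ, which does not depend on the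
translation. -/
theorem integral_integral_mul_translate {f : E d → ℝ}
    (hfi : Integrable f (volume.restrict (unitCell d))) {Ψ : E d → ℝ} (hΨ : IsPeriodicTest Ψ) :
    Integrable (fun s => ∫ y in unitCell d, f y * Ψ (y + s)) (volume.restrict (unitCell d)) ∧
    ∫ s in unitCell d, ∫ y in unitCell d, f y * Ψ (y + s) =
      (∫ y in unitCell d, f y) * ∫ y in unitCell d, Ψ y := by
  obtain ⟨C', hC'⟩ := exists_bound_of_periodic hΨ.smooth.continuous hΨ.periodic
  have hΨc := hΨ.smooth.continuous
  have h1 : Integrable (Function.uncurry fun (s y : E d) => f y * Ψ (y + s))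
      ((volume.restrict (unitCell d)).prod (volume.restrict (unitCell d))) := by
    have h2 : Integrable (fun z : E d × E d => f z.2)
        ((volume.restrict (unitCell d)).prod (volume.restrict (unitCell d))) := hfi.comp_snd _
    refine h2.mul_bdd (c := C') ?_ (Eventually.of_forall fun z => hC' _)
    exact Continuous.aestronglyMeasurable (by fun_prop)
  refine ⟨h1.integral_prod_left, ?_⟩
  rw [integral_integral_swap h1, ← integral_mul_const]
  refine integral_congr_ae (Eventually.of_forall fun y => ?_)
  simp only [integral_const_mul]
  congr 1
  have := integral_unitCell_add hΨc hΨ.periodic y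
  simpa only [add_comm] using this

/-- A periodic function with vanishing weak gradient is constant. -/
theorem ae_eq_integral_of_fderiv {f : E d → ℝ} (hf : StronglyMeasurable f)
    (hfi : Integrable f (volume.restrict (unitCell d)))
    (h : ∀ Ψ : E d → ℝ, IsPeriodicTest Ψ → ∀ v, ∫ y in unitCell d, f y * fderiv ℝ Ψ y v = 0) :
    ∀ᵐ y ∂(volume.restrict (unitCell d)), f y = ∫ y in unitCell d, f y := by
  set c := ∫ y in unitCell d, f y with hc
  have h1 : ∀ Ψ : E d → ℝ, IsPeriodicTest Ψ →
      ∫ y in unitCell d, f y * Ψ y = c * ∫ y in unitCell d, Ψ y := by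
    intro Ψ hΨ
    -- Vanishing derivatives make the pairing invariant under translations of Ψ; averaging over s in
    -- Y then replaces Ψ by its mean.
    have h2 : ∀ s, ∫ y in unitCell d, f y * Ψ (y + s) = ∫ y in unitCell d, f y * Ψ y := by
      intro s
      have h3 := integral_mul_translate_sub hfi hΨ s
      have h4 : ∀ t : ℝ, ∫ y in unitCell d, f y * fderiv ℝ Ψ (y + t • s) s = 0 := fun t => by
        have := h _ (hΨ.comp_add (t • s)) s
        simpa only [fderiv_comp_add_right] using this
      simp only [h4, integral_zero] at h3
      linarith
    have h5 := (integral_integral_mul_translate hfi hΨ).2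
    simp only [h2, integral_const, probReal_univ, one_smul] at h5
    exact h5
  have hfc : Integrable (fun y => f y - c) (volume.restrict (unitCell d)) :=
    hfi.sub (integrable_const c)
  have hmeas : StronglyMeasurable fun y => f y - c := hf.sub stronglyMeasurable_const
  have h6 : ∀ g : E d → ℝ, ContDiff ℝ ((⊤ : ℕ∞) : WithTop ℕ∞) g → HasCompactSupport g →
      tsupport g ⊆ unitCell d → ∫ y in unitCell d, g y • (f y - c) = 0 := by
    intro g hg hgs hgY
    -- Test functions supported in Y enter through their periodizations.
    have hper := (isPeriodicTest_periodize (φ := g) ⟨hg, hgs, subset_univ _⟩).1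
    obtain ⟨C', hC'⟩ := exists_bound_of_periodic hper.smooth.continuous hper.periodic
    have h7 := integral_mul_periodize hmeas hfc hg.continuous hgs
    have h8 : ∫ y, (f (fractPart y) - c) * g y = ∫ y in unitCell d, g y • (f y - c) := by
      rw [← setIntegral_eq_integral_of_forall_compl_eq_zero (s := unitCell d)]
      · refine setIntegral_congr_fun isOpen_unitCell.measurableSet fun y hy => ?_
        simp only [fractPart_of_mem hy, smul_eq_mul, mul_comm]
      · intro y hy
        rw [image_eq_zero_of_notMem_tsupport fun h' => hy (hgY h'), mul_zero]
    rw [← h8, h7]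
    have i1 : Integrable (fun y => f y * periodize g y) (volume.restrict (unitCell d)) :=
      hfi.mul_bdd (c := C') hper.smooth.continuous.aestronglyMeasurable
        (Eventually.of_forall fun y => hC' _)
    have i2 : Integrable (periodize g) (volume.restrict (unitCell d)) :=
      Integrable.of_bound hper.smooth.continuous.aestronglyMeasurable C'
        (Eventually.of_forall fun y => hC' _)
    simp only [sub_mul]
    rw [integral_sub i1 (i2.const_mul c), integral_const_mul, h1 _ hper, sub_self]
  have h9 := ae_eq_zero_of_integral_test isOpen_unitCell hfc fun φ hφ => h6 φ hφ.1 hφ.2.1 hφ.2.2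
  filter_upwards [h9] with y hy
  exact sub_eq_zero.1 hy

end Translation

/-! ### Averages over a probability space -/

section Average

variable {α β γ : Type*} [MeasurableSpace α] [MeasurableSpace β] [MeasurableSpace γ]
  {μ : Measure α} {π : Measure β} {m : Measure γ}

/-- A family of measure preserving maps, averaged over a probability space. -/
theorem measurePreserving_family [SFinite μ] [IsProbabilityMeasure π] {T : α × β → γ}
    (hT : Measurable T) (h : ∀ b, MeasurePreserving (fun a => T (a, b)) μ m) :
    MeasurePreserving T (μ.prod π) m := by
  refine ⟨hT, ?_⟩
  ext S hS
  rw [Measure.map_apply hT hS, Measure.prod_apply_symm (hT hS)]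
  have h1 : ∀ b, μ ((fun a => (a, b)) ⁻¹' (T ⁻¹' S)) = m S := fun b =>
    (h b).measure_preimage hS.nullMeasurableSet
  simp [h1]

/-- On a probability space the `L^1` norm is at most the `L^p` norm; raise to the power p and use
Tonelli. -/
theorem memLp_integral_prod [SFinite μ] [IsProbabilityMeasure π] {p : ℝ≥0∞} (hp₁ : 1 ≤ p)
    (hp : p ≠ ⊤) {K : α × β → ℝ} (hK : StronglyMeasurable K) (h : MemLp K p (μ.prod π)) :
    MemLp (fun a => ∫ b, K (a, b) ∂π) p μ := by
  have hp0 : p ≠ 0 := (zero_lt_one.trans_le hp₁).ne'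
  refine ⟨hK.integral_prod_right'.aestronglyMeasurable, ?_⟩
  have h1 := (eLpNorm_lt_top_iff_lintegral_rpow_enorm_lt_top hp0 hp).1 h.2
  rw [eLpNorm_lt_top_iff_lintegral_rpow_enorm_lt_top hp0 hp]
  have hpos : 0 < p.toReal := ENNReal.toReal_pos hp0 hp
  have hm : Measurable fun z => ‖K z‖ₑ ^ p.toReal := hK.enorm.pow_const _
  rw [lintegral_prod _ hm.aemeasurable] at h1
  refine lt_of_le_of_lt (lintegral_mono fun a => ?_) h1
  have hKa : AEStronglyMeasurable (fun b => K (a, b)) π :=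
    (hK.comp_measurable measurable_prodMk_left).aestronglyMeasurable
  have h2 : ‖∫ b, K (a, b) ∂π‖ₑ ≤ eLpNorm (fun b => K (a, b)) p π := by
    refine (enorm_integral_le_lintegral_enorm _).trans ?_
    rw [← eLpNorm_one_eq_lintegral_enorm]
    exact eLpNorm_le_eLpNorm_of_exponent_le hp₁ hKa
  calc ‖∫ b, K (a, b) ∂π‖ₑ ^ p.toReal ≤ eLpNorm (fun b => K (a, b)) p π ^ p.toReal :=
        ENNReal.rpow_le_rpow h2 hpos.le
    _ = ∫⁻ b, ‖K (a, b)‖ₑ ^ p.toReal ∂π := by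
        rw [eLpNorm_eq_lintegral_rpow_enorm_toReal hp0 hp, ← ENNReal.rpow_mul,
          one_div_mul_cancel hpos.ne', ENNReal.rpow_one]

end Average

/-! ### The potential of a periodic curl-free field -/

section Potential

variable {d : ℕ}

/-- The measure on the segments `{t s : 0 < t ≤ 1}`, `s ∈ Y`. -/
noncomputable def segmentMeasure (d : ℕ) : Measure (E d × ℝ) :=
  (volume.restrict (unitCell d)).prod (volume.restrict (Ioc (0 : ℝ) 1))

instance : IsProbabilityMeasure (segmentMeasure d) := by
  unfold segmentMeasure
  infer_instance

/-- The potential of a periodic curl-free field. -/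
noncomputable def potential (h : E d → E d) (y : E d) : ℝ :=
  ∫ σ, inner ℝ σ.1 (h (fractPart (y - σ.2 • σ.1))) ∂(segmentMeasure d)

theorem norm_le_of_mem_unitCell {y : E d} (hy : y ∈ unitCell d) : ‖y‖ ≤ d := by
  have := dist_le_of_coord (z := y) (w := 0) zero_le_one fun i => by
    rw [PiLp.zero_apply, sub_zero, abs_of_nonneg (hy i).1.le]
    exact (hy i).2.le
  simpa using this

theorem ae_segmentMeasure : ∀ᵐ σ ∂(segmentMeasure d), ‖σ.1‖ ≤ d := by
  have := (Measure.quasiMeasurePreserving_fst (μ := volume.restrict (unitCell d))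
    (ν := volume.restrict (Ioc (0 : ℝ) 1))).ae (ae_restrict_mem isOpen_unitCell.measurableSet)
  exact this.mono fun σ hσ => norm_le_of_mem_unitCell hσ

theorem measurable_segmentShift :
    Measurable fun z : E d × (E d × ℝ) => fractPart (z.1 - z.2.2 • z.2.1) :=
  measurable_fractPart.comp (by fun_prop)

/-- For each segment parameter the shift on the torus preserves measure, and ‖s‖ ≤ d on Y; hence
composing with the shifts keeps `L^p`. The parameter x is carried along for joint measurability. -/
theorem memLp_segment {X : Type*} [MeasurableSpace X] {μ : Measure X} [SFinite μ]
    {H : X × E d → E d} (hH : StronglyMeasurable H) {p : ℝ≥0∞}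
    (h : MemLp H p (μ.prod (volume.restrict (unitCell d)))) :
    StronglyMeasurable (fun z : (X × E d) × (E d × ℝ) =>
      inner ℝ z.2.1 (H (z.1.1, fractPart (z.1.2 - z.2.2 • z.2.1)))) ∧
    MemLp (fun z : (X × E d) × (E d × ℝ) =>
      inner ℝ z.2.1 (H (z.1.1, fractPart (z.1.2 - z.2.2 • z.2.1)))) p
      ((μ.prod (volume.restrict (unitCell d))).prod (segmentMeasure d)) := by
  have hT : Measurable fun z : (X × E d) × (E d × ℝ) =>
      (z.1.1, fractPart (z.1.2 - z.2.2 • z.2.1)) :=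
    Measurable.prodMk (by fun_prop) (measurable_fractPart.comp (by fun_prop))
  have hmp : MeasurePreserving (fun z : (X × E d) × (E d × ℝ) =>
      (z.1.1, fractPart (z.1.2 - z.2.2 • z.2.1)))
      ((μ.prod (volume.restrict (unitCell d))).prod (segmentMeasure d))
      (μ.prod (volume.restrict (unitCell d))) :=
    measurePreserving_family hT fun σ =>
      (MeasurePreserving.id μ).prod (measurePreserving_fractPart_sub (σ.2 • σ.1))
  have hs : StronglyMeasurable (fun z : (X × E d) × (E d × ℝ) =>
      inner ℝ z.2.1 (H (z.1.1, fractPart (z.1.2 - z.2.2 • z.2.1)))) :=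
    StronglyMeasurable.inner (Measurable.stronglyMeasurable (by fun_prop)) (hH.comp_measurable hT)
  refine ⟨hs, (h.comp_measurePreserving hmp).of_le_mul (c := d) hs.aestronglyMeasurable ?_⟩
  filter_upwards [Measure.quasiMeasurePreserving_snd.ae ae_segmentMeasure] with z hz
  exact (norm_inner_le_norm _ _).trans (mul_le_mul_of_nonneg_right hz (norm_nonneg _))

theorem memLp_potential {X : Type*} [MeasurableSpace X] {μ : Measure X} [SFinite μ]
    {H : X × E d → E d} (hH : StronglyMeasurable H) {p : ℝ≥0∞} (hp₁ : 1 ≤ p) (hp : p ≠ ⊤)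
    (h : MemLp H p (μ.prod (volume.restrict (unitCell d)))) :
    StronglyMeasurable (fun z : X × E d => potential (fun y => H (z.1, y)) z.2) ∧
    MemLp (fun z : X × E d => potential (fun y => H (z.1, y)) z.2) p
      (μ.prod (volume.restrict (unitCell d))) := by
  obtain ⟨h1, h2⟩ := memLp_segment hH h
  exact ⟨h1.integral_prod_right', memLp_integral_prod hp₁ hp h1 h2⟩

theorem integrable_segment {h : E d → E d} (hh : StronglyMeasurable h)
    (hi : Integrable h (volume.restrict (unitCell d))) :
    Integrable (fun z : E d × (E d × ℝ) => inner ℝ z.2.1 (h (fractPart (z.1 - z.2.2 • z.2.1))))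
      ((volume.restrict (unitCell d)).prod (segmentMeasure d)) := by
  have hmp : MeasurePreserving (fun z : E d × (E d × ℝ) => fractPart (z.1 - z.2.2 • z.2.1))
      ((volume.restrict (unitCell d)).prod (segmentMeasure d)) (volume.restrict (unitCell d)) :=
    measurePreserving_family measurable_segmentShift fun σ =>
      measurePreserving_fractPart_sub (σ.2 • σ.1)
  have h1 : Integrable (fun z : E d × (E d × ℝ) => h (fractPart (z.1 - z.2.2 • z.2.1)))
      ((volume.restrict (unitCell d)).prod (segmentMeasure d)) :=
    (hmp.integrable_comp hi.1).2 hi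
  refine (h1.norm.const_mul (d : ℝ)).mono' (StronglyMeasurable.aestronglyMeasurable ?_) ?_
  · exact StronglyMeasurable.inner (Measurable.stronglyMeasurable (by fun_prop))
      (hh.comp_measurable measurable_segmentShift)
  · filter_upwards [Measure.quasiMeasurePreserving_snd.ae ae_segmentMeasure] with z hz
    exact (norm_inner_le_norm _ _).trans (mul_le_mul_of_nonneg_right hz (norm_nonneg _))

/-- A periodic curl-free field with mean value zero is the weak gradient of its potential. -/
theorem integral_potential_mul_fderiv {h : E d → E d} (hh : StronglyMeasurable h)
    (hi : Integrable h (volume.restrict (unitCell d)))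
    (hcurl : ∀ Ψ : E d → ℝ, IsPeriodicTest Ψ → ∀ v v',
      ∫ y in unitCell d, inner ℝ v (h y) * fderiv ℝ Ψ y v' =
        ∫ y in unitCell d, inner ℝ v' (h y) * fderiv ℝ Ψ y v)
    (hmean : ∀ v, ∫ y in unitCell d, inner ℝ v (h y) = 0) {Ψ : E d → ℝ} (hΨ : IsPeriodicTest Ψ)
    (v : E d) :
    ∫ y in unitCell d, potential h y * fderiv ℝ Ψ y v =
      - ∫ y in unitCell d, inner ℝ v (h y) * Ψ y := by
  obtain ⟨C, hC⟩ := hΨ.exists_bound_fderiv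
  have hvi : Integrable (fun y => inner ℝ v (h y)) (volume.restrict (unitCell d)) := hi.const_inner v
  have h1 : Integrable (Function.uncurry fun (y : E d) (σ : E d × ℝ) =>
      inner ℝ σ.1 (h (fractPart (y - σ.2 • σ.1))) * fderiv ℝ Ψ y v)
      ((volume.restrict (unitCell d)).prod (segmentMeasure d)) := by
    refine (integrable_segment hh hi).mul_bdd (c := C * ‖v‖) ?_
      (Eventually.of_forall fun z => hC z.1 v)
    exact ((hΨ.continuous_fderiv v).comp continuous_fst).aestronglyMeasurable
  -- The shift moves onto Ψ, and the curl condition exchanges σ.1 and v. The derivative of Ψ now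
  -- points along the segment, so it integrates in t to a difference of values.
  have h2 : ∀ σ : E d × ℝ, ∫ y in unitCell d,
      inner ℝ σ.1 (h (fractPart (y - σ.2 • σ.1))) * fderiv ℝ Ψ y v =
      ∫ y in unitCell d, inner ℝ v (h y) * fderiv ℝ Ψ (y + σ.2 • σ.1) σ.1 := by
    intro σ
    have e1 := integral_fractPart_sub_mul (f := fun y => inner ℝ σ.1 (h y))
      (stronglyMeasurable_const.inner hh) (hΨ.continuous_fderiv v) (hΨ.periodic_fderiv v)
      (σ.2 • σ.1)
    have e2 := hcurl _ (hΨ.comp_add (σ.2 • σ.1)) σ.1 v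
    simp only [fderiv_comp_add_right] at e2
    exact e1.trans e2
  have h3 := h1.swap.integral_prod_left
  simp only [Function.comp_def, Prod.swap, Function.uncurry, h2] at h3
  calc ∫ y in unitCell d, potential h y * fderiv ℝ Ψ y v
      = ∫ y in unitCell d, ∫ σ, inner ℝ σ.1 (h (fractPart (y - σ.2 • σ.1))) * fderiv ℝ Ψ y v
          ∂(segmentMeasure d) := by
        simp only [potential, integral_mul_const]
    _ = ∫ σ, (∫ y in unitCell d, inner ℝ v (h y) * fderiv ℝ Ψ (y + σ.2 • σ.1) σ.1)
          ∂(segmentMeasure d) := by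
        rw [integral_integral_swap h1]
        simp only [h2]
    _ = ∫ s in unitCell d, ∫ t in Ioc (0 : ℝ) 1, ∫ y in unitCell d,
          inner ℝ v (h y) * fderiv ℝ Ψ (y + t • s) s := by
        rw [segmentMeasure, integral_prod _ h3]
    _ = ∫ s in unitCell d, ((∫ y in unitCell d, inner ℝ v (h y) * Ψ (y + s)) -
          ∫ y in unitCell d, inner ℝ v (h y) * Ψ y) := by
        simp only [integral_mul_translate_sub hvi hΨ]
    _ = _ := by
        -- Averaged over s, the translated term is a product of means and vanishes by `hmean`; only
        -- the term with Ψ(y) is left.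
        obtain ⟨e1, e2⟩ := integral_integral_mul_translate hvi hΨ
        rw [integral_sub e1 (integrable_const _), e2, hmean]
        simp

end Potential

/-! ### Exchanging test functions with almost every parameter -/

section Swap

variable {d : ℕ} {α : Type*} [MeasurableSpace α] {μ : Measure α}

/-- The derivatives, restricted to a closed ball containing Y, lie in a separable metric space of
continuous functions, and a subset of such a space is again separable. -/
theorem exists_countable_dense_periodicTest : ∃ S : Set (E d → ℝ), S.Countable ∧
    (∀ Ψ ∈ S, IsPeriodicTest Ψ) ∧ ∀ Ψ, IsPeriodicTest Ψ → ∀ κ : ℝ, 0 < κ → ∃ Ψ' ∈ S,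
      ∀ y ∈ unitCell d, ‖fderiv ℝ Ψ y - fderiv ℝ Ψ' y‖ ≤ κ := by
  have hprop : ProperSpace (E d →L[ℝ] ℝ) := FiniteDimensional.proper ℝ _
  set X := Metric.closedBall (0 : E d) d with hX
  have : CompactSpace X := isCompact_iff_compactSpace.1 (isCompact_closedBall _ _)
  set R : {Ψ : E d → ℝ // IsPeriodicTest Ψ} → C(X, E d →L[ℝ] ℝ) := fun Ψ =>
    ⟨fun y => fderiv ℝ Ψ.1 y, (Ψ.2.smooth.continuous_fderiv (by simp)).comp
      continuous_subtype_val⟩ with hR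
  obtain ⟨s, hsc, hsd⟩ := TopologicalSpace.exists_countable_dense (range R)
  choose g hg using fun x : range R => x.2
  refine ⟨(fun x => (g x).1) '' s, hsc.image _, ?_, fun Ψ hΨ κ hκ => ?_⟩
  · rintro _ ⟨x, _, rfl⟩
    exact (g x).2
  · have hU : IsOpen {x : range R | dist (R ⟨Ψ, hΨ⟩) x.1 < κ} :=
      isOpen_lt (continuous_const.dist continuous_subtype_val) continuous_const
    obtain ⟨x, hxs, hx⟩ := hsd.inter_open_nonempty _ hU ⟨⟨R ⟨Ψ, hΨ⟩, mem_range_self _⟩, by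
      simpa using hκ⟩
    refine ⟨_, mem_image_of_mem _ hx, fun y hy => ?_⟩
    have hyX : y ∈ X := by
      rw [hX, mem_closedBall_zero_iff]
      exact norm_le_of_mem_unitCell hy
    have h1 := (ContinuousMap.dist_apply_le_dist (f := R ⟨Ψ, hΨ⟩) (g := x.1) ⟨y, hyX⟩).trans (le_of_lt hxs)
    rw [← hg x, dist_eq_norm] at h1
    exact h1

/-- Exchange of "for all test functions" and "for almost every parameter". -/
theorem ae_forall_periodicTest {f : α → E d → E d}
    (hfi : ∀ᵐ x ∂μ, Integrable (f x) (volume.restrict (unitCell d)))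
    (h : ∀ Ψ : E d → ℝ, IsPeriodicTest Ψ →
      ∀ᵐ x ∂μ, ∫ y in unitCell d, fderiv ℝ Ψ y (f x y) = 0) :
    ∀ᵐ x ∂μ, ∀ Ψ : E d → ℝ, IsPeriodicTest Ψ →
      ∫ y in unitCell d, fderiv ℝ Ψ y (f x y) = 0 := by
  obtain ⟨S, hSc, hSt, hS⟩ := exists_countable_dense_periodicTest (d := d)
  have h1 : ∀ᵐ x ∂μ, ∀ Ψ ∈ S, ∫ y in unitCell d, fderiv ℝ Ψ y (f x y) = 0 :=
    (ae_ball_iff hSc).2 fun Ψ hΨ => h Ψ (hSt Ψ hΨ)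
  filter_upwards [h1, hfi] with x hx hix Ψ hΨ
  have hint : ∀ Ψ : E d → ℝ, IsPeriodicTest Ψ →
      Integrable (fun y => fderiv ℝ Ψ y (f x y)) (volume.restrict (unitCell d)) := by
    intro Ψ hΨ
    obtain ⟨C, hC⟩ := hΨ.exists_bound_fderiv
    refine (hix.norm.const_mul C).mono' ?_ (Eventually.of_forall fun y => hC y _)
    have hc : Continuous (fderiv ℝ Ψ) := hΨ.smooth.continuous_fderiv (by simp)
    exact (ContinuousLinearMap.apply ℝ ℝ).flip.aestronglyMeasurable_comp₂
      hc.aestronglyMeasurable hix.1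
  set B := ∫ y in unitCell d, ‖f x y‖ with hB
  have hB0 : 0 ≤ B := integral_nonneg fun _ => norm_nonneg _
  refine abs_nonpos_iff.1 (le_of_forall_pos_le_add fun κ hκ => ?_)
  -- The tolerance κ / (B + 1) keeps the error below κ also when B = 0.
  obtain ⟨Ψ', hΨ', hle⟩ := hS Ψ hΨ (κ / (B + 1)) (div_pos hκ (by linarith))
  have h2 : ∫ y in unitCell d, fderiv ℝ Ψ y (f x y) =
      ∫ y in unitCell d, (fderiv ℝ Ψ y - fderiv ℝ Ψ' y) (f x y) := by
    have e1 := integral_sub (hint Ψ hΨ) (hint Ψ' (hSt _ hΨ'))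
    rw [hx Ψ' hΨ', sub_zero] at e1
    exact e1.symm
  have h3 : |∫ y in unitCell d, (fderiv ℝ Ψ y - fderiv ℝ Ψ' y) (f x y)| ≤
      ∫ y in unitCell d, κ / (B + 1) * ‖f x y‖ := by
    refine norm_integral_le_of_norm_le
      (f := fun y => (fderiv ℝ Ψ y - fderiv ℝ Ψ' y) (f x y)) (hix.norm.const_mul _) ?_
    filter_upwards [ae_restrict_mem isOpen_unitCell.measurableSet] with y hy
    exact ((fderiv ℝ Ψ y - fderiv ℝ Ψ' y).le_opNorm _).trans
      (mul_le_mul_of_nonneg_right (hle y hy) (norm_nonneg _))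
  rw [h2, zero_add]
  refine h3.trans ?_
  rw [integral_const_mul, ← hB]
  calc κ / (B + 1) * B ≤ κ / (B + 1) * (B + 1) :=
        mul_le_mul_of_nonneg_left (by linarith) (div_pos hκ (by linarith)).le
    _ = κ := div_mul_cancel₀ κ (by linarith)

/-- A function on the product whose integrals against test functions in the first variable vanish
has vanishing fibre integrals. -/
theorem ae_integral_eq_zero_of_test {Ω : Set (E d)} (hΩ : IsOpen Ω) {f : E d × E d → ℝ}
    (hf : Integrable f ((volume.restrict Ω).prod (volume.restrict (unitCell d))))
    (h : ∀ a : E d → ℝ, IsTestFunction Ω a →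
      ∫ z, a z.1 * f z ∂((volume.restrict Ω).prod (volume.restrict (unitCell d))) = 0) :
    ∀ᵐ x ∂(volume.restrict Ω), ∫ y in unitCell d, f (x, y) = 0 := by
  refine ae_eq_zero_of_integral_test hΩ hf.integral_prod_left fun a ha => ?_
  obtain ⟨C, hC⟩ := ha.2.1.exists_bound_of_continuous ha.1.continuous
  have h1 := h a ha
  rw [integral_prod] at h1
  · simpa only [integral_const_mul] using h1
  · exact hf.bdd_mul (c := C) (ha.1.continuous.comp continuous_fst).aestronglyMeasurable
      (Eventually.of_forall fun z => hC z.1)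

end Swap

/-! ### Weak gradients of periodic functions -/

section PeriodicGradient

variable {d : ℕ}

/-- The translation identity with f = 1: the difference of the two means is 0, and the t-average on
the left is of a constant. -/
theorem integral_unitCell_fderiv {Ψ : E d → ℝ} (hΨ : IsPeriodicTest Ψ) (v : E d) :
    ∫ y in unitCell d, fderiv ℝ Ψ y v = 0 := by
  have h1 := integral_mul_translate_sub (f := fun _ => (1 : ℝ)) (integrable_const _) hΨ v
  simp only [one_mul] at h1
  rw [integral_unitCell_add hΨ.smooth.continuous hΨ.periodic, sub_self] at h1
  have h2 : ∀ t : ℝ, ∫ y in unitCell d, fderiv ℝ Ψ (y + t • v) v =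
      ∫ y in unitCell d, fderiv ℝ Ψ y v := fun t =>
    integral_unitCell_add (hΨ.continuous_fderiv v) (hΨ.periodic_fderiv v) (t • v)
  simp only [h2, integral_const, probReal_univ, one_smul] at h1
  exact h1

/-- The preimage of a null set of Y meets each integer translate of Y in a translate of that null
set, and there are countably many translates. -/
theorem ae_fractPart {q : E d → Prop} (h : ∀ᵐ y ∂(volume.restrict (unitCell d)), q y) :
    ∀ᵐ y : E d, q (fractPart y) := by
  have hm := measurable_fractPart (d := d)
  have hac : (volume : Measure (E d)).map fractPart ≪ volume.restrict (unitCell d) := by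
    refine Measure.AbsolutelyContinuous.mk fun S hS hS0 => ?_
    rw [Measure.map_apply hm hS, ← lintegral_indicator_one (hm hS), lintegral_eq_tsum_unitCell]
    refine ENNReal.tsum_eq_zero.2 fun ξ => ?_
    rw [← hS0, ← lintegral_indicator_one hS]
    refine setLIntegral_congr_fun isOpen_unitCell.measurableSet fun y hy => ?_
    have h1 : (y + intVec ξ ∈ fractPart ⁻¹' S) ↔ y ∈ S := by
      rw [mem_preimage, fractPart_add_intVec, fractPart_of_mem hy]
    by_cases hyS : y ∈ S
    · rw [indicator_of_mem hyS, indicator_of_mem (h1.2 hyS)]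
      rfl
    · rw [indicator_of_notMem hyS, indicator_of_notMem (fun h => hyS (h1.1 h))]
  exact ae_of_ae_map hm.aemeasurable (hac.ae_le h)

theorem setIntegral_unitCell_eq {f g : E d → ℝ} (hg : tsupport g ⊆ unitCell d) :
    ∫ y in unitCell d, f y * g y = ∫ y, f (fractPart y) * g y := by
  rw [← setIntegral_eq_integral_of_forall_compl_eq_zero (s := unitCell d)
    (f := fun y => f (fractPart y) * g y)]
  · refine setIntegral_congr_fun isOpen_unitCell.measurableSet fun y hy => ?_
    simp only [fractPart_of_mem hy]
  · intro y hy
    rw [image_eq_zero_of_notMem_tsupport fun h' => hy (hg h'), mul_zero]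

/-- The weak gradient of a periodic function, from periodic test functions. -/
theorem hasWeakGradient_of_periodic {u : E d → ℝ} {h : E d → E d} (hu : StronglyMeasurable u)
    (hui : Integrable u (volume.restrict (unitCell d))) (hh : StronglyMeasurable h)
    (hhi : Integrable h (volume.restrict (unitCell d)))
    (H : ∀ Ψ : E d → ℝ, IsPeriodicTest Ψ → ∀ v, ∫ y in unitCell d, u y * fderiv ℝ Ψ y v =
      - ∫ y in unitCell d, inner ℝ v (h y) * Ψ y) :
    HasWeakGradient univ (fun y => u (fractPart y)) (fun y => h (fractPart y)) ∧
      HasWeakGradient (unitCell d) u h := by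
  have key : ∀ φ : E d → ℝ, IsTestFunction univ φ → ∀ i : Fin d,
      ∫ y, u (fractPart y) * pderiv i φ y = - ∫ y, h (fractPart y) i * φ y := by
    intro φ hφ i
    -- Integrals over ℝ^d against φ become integrals over Y against its periodization, where H
    -- applies.
    obtain ⟨hper, hder⟩ := isPeriodicTest_periodize hφ
    have h1 := integral_mul_periodize hu hui (continuous_pderiv hφ i) (hasCompactSupport_pderiv hφ i)
    have hi : StronglyMeasurable fun y => h y i :=
      (EuclideanSpace.proj (𝕜 := ℝ) i).continuous.comp_stronglyMeasurable hh
    have hii : Integrable (fun y => h y i) (volume.restrict (unitCell d)) :=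
      (EuclideanSpace.proj (𝕜 := ℝ) i).integrable_comp hhi
    have h2 := integral_mul_periodize hi hii hφ.1.continuous hφ.2.1
    rw [h1, h2]
    have h3 := H _ hper (EuclideanSpace.single i 1)
    simp only [hder] at h3
    refine h3.trans ?_
    congr 1
    refine integral_congr_ae (Eventually.of_forall fun y => ?_)
    simp [EuclideanSpace.inner_single_left]
  refine ⟨fun φ hφ i => ?_, fun φ hφ i => ?_⟩
  · rw [setIntegral_univ, setIntegral_univ]
    exact key φ hφ i
  · have ht : tsupport (pderiv i φ) ⊆ unitCell d :=
      (tsupport_fderiv_apply_subset ℝ _).trans hφ.2.2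
    rw [setIntegral_unitCell_eq (f := u) ht, setIntegral_unitCell_eq (f := fun y => h y i) hφ.2.2]
    exact key φ (hφ.mono (subset_univ _)) i

theorem integral_mul_fderiv_eq_zero_of_basis {f : E d → ℝ}
    (hf : Integrable f (volume.restrict (unitCell d))) {Ψ : E d → ℝ} (hΨ : IsPeriodicTest Ψ)
    (h : ∀ i : Fin d, ∫ y in unitCell d, f y * fderiv ℝ Ψ y (EuclideanSpace.single i 1) = 0)
    (v : E d) : ∫ y in unitCell d, f y * fderiv ℝ Ψ y v = 0 := by
  obtain ⟨C, hC⟩ := hΨ.exists_bound_fderiv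
  have hi : ∀ i : Fin d, Integrable (fun y => f y * pderiv i Ψ y) (volume.restrict (unitCell d)) :=
    fun i => hf.mul_bdd (hΨ.continuous_fderiv _).aestronglyMeasurable
      (Eventually.of_forall fun y => hC y _)
  simp only [fderiv_eq_sum_pderiv, Finset.mul_sum, mul_left_comm (f _)]
  rw [integral_finsetSum _ fun i _ => (hi i).const_mul _]
  refine Finset.sum_eq_zero fun i _ => ?_
  rw [integral_const_mul]
  exact mul_eq_zero_of_right _ (h i)

/-- Bilinearity reduces all pairs of directions to finitely many, so that one null set of parameters
x suffices. -/
theorem integral_inner_mul_fderiv_comm_of_basis {h : E d → E d}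
    (hh : Integrable h (volume.restrict (unitCell d))) {Ψ : E d → ℝ} (hΨ : IsPeriodicTest Ψ)
    (H : ∀ i j : Fin d, ∫ y in unitCell d, h y i * pderiv j Ψ y =
      ∫ y in unitCell d, h y j * pderiv i Ψ y) (v v' : E d) :
    ∫ y in unitCell d, inner ℝ v (h y) * fderiv ℝ Ψ y v' =
      ∫ y in unitCell d, inner ℝ v' (h y) * fderiv ℝ Ψ y v := by
  obtain ⟨C, hC⟩ := hΨ.exists_bound_fderiv
  have hi : ∀ i j : Fin d, Integrable (fun y => h y i * pderiv j Ψ y)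
      (volume.restrict (unitCell d)) := fun i j =>
    ((EuclideanSpace.proj (𝕜 := ℝ) i).integrable_comp hh).mul_bdd
      (hΨ.continuous_fderiv _).aestronglyMeasurable (Eventually.of_forall fun y => hC y _)
  have key : ∀ u u' : E d, ∫ y in unitCell d, inner ℝ u (h y) * fderiv ℝ Ψ y u' =
      ∑ i, ∑ j, u i * u' j * ∫ y in unitCell d, h y i * pderiv j Ψ y := by
    intro u u'
    have e1 : ∀ y, inner ℝ u (h y) * fderiv ℝ Ψ y u' =
        ∑ i, ∑ j, u i * u' j * (h y i * pderiv j Ψ y) := fun y => by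
      rw [inner_eq_sum, fderiv_eq_sum_pderiv, Finset.sum_mul_sum]
      exact Finset.sum_congr rfl fun i _ => Finset.sum_congr rfl fun j _ => by ring
    simp only [e1]
    rw [integral_finsetSum _ fun i _ => integrable_finsetSum _ fun j _ => (hi i j).const_mul _]
    refine Finset.sum_congr rfl fun i _ => ?_
    rw [integral_finsetSum _ fun j _ => (hi i j).const_mul _]
    exact Finset.sum_congr rfl fun j _ => integral_const_mul _ _
  rw [key, key, Finset.sum_comm]
  refine Finset.sum_congr rfl fun i _ => Finset.sum_congr rfl fun j _ => ?_
  rw [H j i]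
  ring

end PeriodicGradient

/-! ### Transposed matrix action -/

section Transpose

variable {d : ℕ}

theorem inner_act_transpose (A : Mat d) (v g : E d) :
    inner ℝ v (act A.transpose g) = inner ℝ (act A v) g := by
  simp only [inner_eq_sum, act_apply, Finset.mul_sum, Finset.sum_mul, Matrix.transpose_apply]
  rw [Finset.sum_comm]
  exact Finset.sum_congr rfl fun i _ => Finset.sum_congr rfl fun j _ => by ring

theorem stronglyMeasurable_act {α : Type*} [MeasurableSpace α] {A : α → Mat d} {g : α → E d}
    (hA : ∀ i j, Measurable fun x => A x i j) (hg : StronglyMeasurable g) :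
    StronglyMeasurable fun x => act (A x) (g x) := by
  have h1 : ∀ i, Measurable fun x => g x i := fun i =>
    ((EuclideanSpace.proj (𝕜 := ℝ) i).continuous.measurable).comp hg.measurable
  have h2 : Measurable fun x => fun i => ∑ j, A x i j * g x j :=
    measurable_pi_lambda _ fun i => Finset.measurable_fun_sum _ fun j _ => (hA i j).mul (h1 j)
  have h3 : (fun x => act (A x) (g x)) = fun x => WithLp.toLp 2 fun i => ∑ j, A x i j * g x j := by
    funext x; ext i; simp [act_apply]
  rw [h3]
  exact ((WithLp.measurable_toLp 2 (Fin d → ℝ)).comp h2).stronglyMeasurable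

end Transpose

/-! ### The cell gradient of an unfolded function -/

namespace CubePartition

variable {d : ℕ} {Ω : Set (E d)} {r ε : ℝ} (P : CubePartition Ω r ε) (D : E d → Mat d)

/-- The field `D(x_n)ᵀ G(z)`, `z ∈ Ω_n`. -/
noncomputable def localPullback (G : E d → E d) (z : E d) : E d :=
  ∑ n, (P.sub n).indicator (fun z => act (D (P.node n)).transpose (G z)) z

variable {P D}

theorem localPullback_of_mem {G : E d → E d} {n : Fin P.N} {z : E d} (hz : z ∈ P.sub n) :
    P.localPullback D G z = act (D (P.node n)).transpose (G z) := by
  rw [localPullback, sum_eq_of_mem_sub hz fun m hm => indicator_of_notMem hm _, indicator_of_mem hz]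

theorem stronglyMeasurable_localPullback {G : E d → E d} (hG : StronglyMeasurable G) :
    StronglyMeasurable (P.localPullback D G) :=
  Finset.stronglyMeasurable_fun_sum _ fun n _ =>
    ((continuous_act _).comp_stronglyMeasurable hG).indicator (isOpen_sub n).measurableSet

theorem norm_localPullback_le {C : ℝ} (hC₀ : 0 ≤ C)
    (hC : ∀ x ∈ Ω, ∀ v, ‖act (D x).transpose v‖ ≤ C * ‖v‖) (G : E d → E d) (z : E d) :
    ‖P.localPullback D G z‖ ≤ C * ‖G z‖ := by
  by_cases hz : ∃ n, z ∈ P.sub n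
  · obtain ⟨n, hn⟩ := hz
    rw [localPullback_of_mem hn]
    exact hC _ (P.node_mem n).2 _
  · rw [localPullback, Finset.sum_eq_zero fun n _ => indicator_of_notMem (fun h => hz ⟨n, h⟩) _,
      norm_zero]
    positivity

variable {p : ℝ≥0∞} [Fact (1 ≤ p)]

/-- The gradient in `y` of an unfolded function. -/
theorem hasWeakGradient_unfolding (hε : 0 < ε) (hD : ∀ x, IsUnit (D x).det)
    (hΩ : MeasurableSet Ω) (w : W1p Ω p) :
    ∀ᵐ x ∂(volume.restrict Ω), HasWeakGradient (unitCell d) (fun y => P.unfolding D w.fn x y)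
      (fun y => ε • P.unfolding D (P.localPullback D w.grad) x y) := by
  filter_upwards [ae_restrict_of_ae (ae_rescale_notMem (P := P) hε hD)] with x hx
  by_cases hc : x ∈ P.cells D
  · obtain ⟨c, hc'⟩ := mem_iUnion.1 hc
    simp only [unfolding_of_mem hε hD hx hc']
    have h1 := hasWeakGradient_comp_cellMap hε.ne' (hD (P.node c.1)) w hΩ c.2
      ((cell_subset c).trans inter_subset_right)
    refine h1.congr (EventuallyEq.refl _ _) ?_
    filter_upwards [ae_restrict_mem isOpen_unitCell.measurableSet] with y hy
    have h2 : P.cellParam D c y ∈ P.sub c.1 := (cell_subset c (mem_image_of_mem _ hy)).1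
    rw [localPullback_of_mem h2]
    rfl
  · simp only [unfolding_of_notMem hε hD hx hc]
    intro φ _ i
    simp

end CubePartition

/-! ### From integrated identities to almost every fibre -/

section Fibre

variable {d : ℕ} {Ω : Set (E d)} (hΩ : IsOpen Ω)

include hΩ in
theorem ae_integral_inner_eq_of_test {F : Type*} [NormedAddCommGroup F] [InnerProductSpace ℝ F]
    {G : E d × E d → F}
    (hG : Integrable G ((volume.restrict Ω).prod (volume.restrict (unitCell d))))
    {g₀ : E d → F} (hg₀ : Integrable g₀ (volume.restrict Ω)) (e : F)
    (h : ∀ a : E d → ℝ, IsTestFunction Ω a →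
      ∫ z, a z.1 * inner ℝ e (G z) ∂((volume.restrict Ω).prod (volume.restrict (unitCell d))) =
        ∫ z in Ω, a z * inner ℝ e (g₀ z)) :
    ∀ᵐ x ∂(volume.restrict Ω), ∫ y in unitCell d, inner ℝ e (G (x, y)) = inner ℝ e (g₀ x) := by
  have i1 : Integrable (fun z => inner ℝ e (G z))
    ((volume.restrict Ω).prod (volume.restrict (unitCell d))) := hG.const_inner e
  have i2 : Integrable (fun z : E d × E d => inner ℝ e (g₀ z.1))
    ((volume.restrict Ω).prod (volume.restrict (unitCell d))) :=
      Integrable.comp_fst (f := fun x => inner ℝ e (g₀ x)) (hg₀.const_inner e) _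
  have h1 := ae_integral_eq_zero_of_test hΩ (i1.sub i2) fun a ha => by
    obtain ⟨C, hC⟩ := ha.2.1.exists_bound_of_continuous ha.1.continuous
    have hb : ∀ f : E d × E d → ℝ,
        Integrable f ((volume.restrict Ω).prod (volume.restrict (unitCell d))) →
        Integrable (fun z => a z.1 * f z)
          ((volume.restrict Ω).prod (volume.restrict (unitCell d))) := fun f hf =>
      hf.bdd_mul (c := C) (ha.1.continuous.comp continuous_fst).aestronglyMeasurable
        (Eventually.of_forall fun z => hC z.1)
    simp only [Pi.sub_apply, mul_sub]
    rw [integral_sub (hb _ i1) (hb _ i2), h a ha, integral_prod _ (hb _ i2)]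
    simp
  filter_upwards [h1, i1.prod_right_ae] with x hx hix
  simp only [Pi.sub_apply] at hx
  rw [integral_sub hix (integrable_const _)] at hx
  simpa [sub_eq_zero] using hx

include hΩ in
/-- A function on the product whose derivatives in the cell variable vanish weakly against periodic
test functions is equal to its fibre averages. -/
theorem ae_ae_eq_integral_of_test {W : E d × E d → ℝ} (hW : StronglyMeasurable W)
    (hWi : Integrable W ((volume.restrict Ω).prod (volume.restrict (unitCell d))))
    (h : ∀ a Ψ : E d → ℝ, IsTestFunction Ω a → IsPeriodicTest Ψ → ∀ v,
      ∫ z, a z.1 * fderiv ℝ Ψ z.2 v * W z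
        ∂((volume.restrict Ω).prod (volume.restrict (unitCell d))) = 0) :
    ∀ᵐ x ∂(volume.restrict Ω), ∀ᵐ y ∂(volume.restrict (unitCell d)),
      W (x, y) = ∫ y in unitCell d, W (x, y) := by
  -- The scalar condition is written with the field W e_i, so that `ae_forall_periodicTest` applies.
  have h1 : ∀ i : Fin d, ∀ᵐ x ∂(volume.restrict Ω), ∀ Ψ : E d → ℝ, IsPeriodicTest Ψ →
      ∫ y in unitCell d, fderiv ℝ Ψ y (W (x, y) • EuclideanSpace.single i 1) = 0 := fun i => by
    refine ae_forall_periodicTest ?_ fun Ψ hΨ => ?_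
    · filter_upwards [hWi.prod_right_ae] with x hx
      exact hx.smul_const _
    · obtain ⟨C, hC⟩ := hΨ.exists_bound_fderiv
      refine ae_integral_eq_zero_of_test hΩ
        (f := fun z => fderiv ℝ Ψ z.2 (W z • EuclideanSpace.single i 1)) ?_ fun a ha => ?_
      · simp only [map_smul, smul_eq_mul]
        exact hWi.mul_bdd
          ((hΨ.continuous_fderiv _).comp continuous_snd).aestronglyMeasurable
          (Eventually.of_forall fun z => hC z.2 _)
      · rw [← h a Ψ ha hΨ (EuclideanSpace.single i 1)]
        refine integral_congr_ae (Eventually.of_forall fun z => ?_)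
        simp only [map_smul, smul_eq_mul]
        ring
  filter_upwards [ae_all_iff.2 h1, hWi.prod_right_ae] with x hx hix
  refine ae_eq_integral_of_fderiv (hW.comp_measurable measurable_prodMk_left) hix
    fun Ψ hΨ => integral_mul_fderiv_eq_zero_of_basis hix hΨ fun i => ?_
  simpa only [map_smul, smul_eq_mul] using hx i Ψ hΨ

include hΩ in
theorem ae_integral_act_transpose_comm {D : E d → Mat d} (hD : IsLipschitzField D)
    (hΩb : Bornology.IsBounded Ω) {G : E d × E d → E d} (hG : StronglyMeasurable G)
    (hGi : Integrable G ((volume.restrict Ω).prod (volume.restrict (unitCell d))))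
    (h : ∀ a Ψ : E d → ℝ, IsTestFunction Ω a → IsPeriodicTest Ψ → ∀ v v',
      ∫ z, a z.1 * fderiv ℝ Ψ z.2 v' * inner ℝ (act (D z.1) v) (G z)
        ∂((volume.restrict Ω).prod (volume.restrict (unitCell d))) =
      ∫ z, a z.1 * fderiv ℝ Ψ z.2 v * inner ℝ (act (D z.1) v') (G z)
        ∂((volume.restrict Ω).prod (volume.restrict (unitCell d)))) :
    ∀ᵐ x ∂(volume.restrict Ω), ∀ Ψ : E d → ℝ, IsPeriodicTest Ψ → ∀ v v',
      ∫ y in unitCell d, inner ℝ v (act (D x).transpose (G (x, y))) * fderiv ℝ Ψ y v' =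
        ∫ y in unitCell d, inner ℝ v' (act (D x).transpose (G (x, y))) * fderiv ℝ Ψ y v := by
  obtain ⟨C, hC₀, hC⟩ := hD.transpose.exists_bound hΩb
  have hH : StronglyMeasurable fun z : E d × E d => act (D z.1).transpose (G z) :=
    stronglyMeasurable_act (fun i j =>
      ((hD.transpose.continuous_apply i j).comp continuous_fst).measurable) hG
  have hHi : Integrable (fun z : E d × E d => act (D z.1).transpose (G z))
      ((volume.restrict Ω).prod (volume.restrict (unitCell d))) := by
    refine (hGi.norm.const_mul C).mono' hH.aestronglyMeasurable ?_
    have : ∀ᵐ z ∂((volume.restrict Ω).prod (volume.restrict (unitCell d))), z.1 ∈ Ω :=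
      Measure.quasiMeasurePreserving_fst.ae (ae_restrict_mem hΩ.measurableSet)
    filter_upwards [this] with z hz
    exact hC z.1 hz _
  set H : E d × E d → E d := fun z => act (D z.1).transpose (G z)
  have hHc : ∀ i, Integrable (fun z => H z i)
      ((volume.restrict Ω).prod (volume.restrict (unitCell d))) := fun i =>
    (EuclideanSpace.proj (𝕜 := ℝ) i).integrable_comp hHi
  -- The (i, j) curl condition says that ∇Ψ is orthogonal to the single field H_i e_j - H_j e_i, the
  -- form needed for exchanging the quantifiers.
  have h1 : ∀ i j : Fin d, ∀ᵐ x ∂(volume.restrict Ω), ∀ Ψ : E d → ℝ, IsPeriodicTest Ψ →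
      ∫ y in unitCell d, fderiv ℝ Ψ y (H (x, y) i • EuclideanSpace.single j 1
        - H (x, y) j • EuclideanSpace.single i 1) = 0 := fun i j => by
    refine ae_forall_periodicTest ?_ fun Ψ hΨ => ?_
    · filter_upwards [(hHc i).prod_right_ae, (hHc j).prod_right_ae] with x hx hx'
      exact (hx.smul_const _).sub (hx'.smul_const _)
    · obtain ⟨B, hB⟩ := hΨ.exists_bound_fderiv
      have hb : ∀ i j, Integrable (fun z : E d × E d => H z i * pderiv j Ψ z.2)
          ((volume.restrict Ω).prod (volume.restrict (unitCell d))) := fun i j =>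
        (hHc i).mul_bdd ((hΨ.continuous_fderiv _).comp continuous_snd).aestronglyMeasurable
          (Eventually.of_forall fun z => hB z.2 _)
      refine ae_integral_eq_zero_of_test hΩ
        (f := fun z => fderiv ℝ Ψ z.2 (H z i • EuclideanSpace.single j 1
          - H z j • EuclideanSpace.single i 1)) ?_ fun a ha => ?_
      · simp only [map_smul, smul_eq_mul, map_sub]
        exact (hb i j).sub (hb j i)
      · obtain ⟨K, hK⟩ := ha.2.1.exists_bound_of_continuous ha.1.continuous
        have hb' : ∀ i j, Integrable (fun z : E d × E d => a z.1 * (H z i * pderiv j Ψ z.2))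
            ((volume.restrict Ω).prod (volume.restrict (unitCell d))) := fun i j =>
          (hb i j).bdd_mul (ha.1.continuous.comp continuous_fst).aestronglyMeasurable
            (Eventually.of_forall fun z => hK z.1)
        have e1 : ∀ i j, ∫ z, a z.1 * (H z i * pderiv j Ψ z.2)
            ∂((volume.restrict Ω).prod (volume.restrict (unitCell d))) =
            ∫ z, a z.1 * fderiv ℝ Ψ z.2 (EuclideanSpace.single j 1) *
              inner ℝ (act (D z.1) (EuclideanSpace.single i 1)) (G z)
            ∂((volume.restrict Ω).prod (volume.restrict (unitCell d))) := fun i j => by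
          refine integral_congr_ae (Eventually.of_forall fun z => ?_)
          simp only [← inner_act_transpose, EuclideanSpace.inner_single_left, map_one, one_mul,
            pderiv, H]
          ring
        simp only [map_smul, smul_eq_mul, map_sub, mul_sub]
        have e2 := integral_sub (hb' i j) (hb' j i)
        rw [e1, e1, h a Ψ ha hΨ, sub_self] at e2
        exact e2
  filter_upwards [ae_all_iff.2 fun i => ae_all_iff.2 (h1 i), hHi.prod_right_ae] with x hx hix Ψ hΨ
  refine integral_inner_mul_fderiv_comm_of_basis hix hΨ fun i j => ?_
  obtain ⟨B, hB⟩ := hΨ.exists_bound_fderiv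
  have hb : ∀ i j, Integrable (fun y => H (x, y) i * pderiv j Ψ y)
      (volume.restrict (unitCell d)) := fun i j =>
    ((EuclideanSpace.proj (𝕜 := ℝ) i).integrable_comp hix).mul_bdd
      (hΨ.continuous_fderiv _).aestronglyMeasurable (Eventually.of_forall fun y => hB y _)
  have e3 := hx i j Ψ hΨ
  simp only [map_smul, smul_eq_mul, map_sub] at e3
  rw [← sub_eq_zero, ← e3]
  exact (integral_sub (hb i j) (hb j i)).symm

end Fibre

/-! ### Construction of the corrector -/

section Corrector

variable {d : ℕ} {Ω : Set (E d)} (hΩ : IsOpen Ω) (hΩb : Bornology.IsBounded Ω)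
  {p : ℝ≥0∞} [Fact (1 ≤ p)]

include hΩb in
theorem isFiniteMeasure_restrict_of_isBounded : IsFiniteMeasure (volume.restrict Ω) :=
  ⟨by rw [Measure.restrict_apply_univ]; exact hΩb.measure_lt_top⟩

theorem act_inv_transpose_act_transpose {A : Mat d} (hA : IsUnit A.det) (v : E d) :
    act A⁻¹.transpose (act A.transpose v) = v := by
  rw [← act_mul, ← Matrix.transpose_mul, Matrix.mul_nonsing_inv _ hA, Matrix.transpose_one, act_one]

include hΩ hΩb in
/-- A vector field on the product which, up to `D(x)ᵀ`, is weakly curl-free and periodic in the cell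
variable is the sum of its mean and of the transformed gradient of a periodic function. -/
theorem exists_corrector (hp : p ≠ ⊤) {D : E d → Mat d} (hD : IsTransformation Ω D)
    (G : Lp (E d) p ((volume.restrict Ω).prod (volume.restrict (unitCell d))))
    {g₀ : E d → E d} (hg₀ : StronglyMeasurable g₀) (hg₀p : MemLp g₀ p (volume.restrict Ω))
    (hmean : ∀ (a : E d → ℝ) (e : E d), IsTestFunction Ω a →
      ∫ z, a z.1 * inner ℝ e (G z) ∂((volume.restrict Ω).prod (volume.restrict (unitCell d))) =
        ∫ z in Ω, a z * inner ℝ e (g₀ z))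
    (hcurl : ∀ a Ψ : E d → ℝ, IsTestFunction Ω a → IsPeriodicTest Ψ → ∀ v v',
      ∫ z, a z.1 * fderiv ℝ Ψ z.2 v' * inner ℝ (act (D z.1) v) (G z)
        ∂((volume.restrict Ω).prod (volume.restrict (unitCell d))) =
      ∫ z, a z.1 * fderiv ℝ Ψ z.2 v * inner ℝ (act (D z.1) v') (G z)
        ∂((volume.restrict Ω).prod (volume.restrict (unitCell d)))) :
    ∃ (w₁ : E d → E d → ℝ) (g : E d → E d → E d), MemLpW1pPer Ω D p w₁ g ∧
      ∀ z, g₀ z.1 + act (D z.1)⁻¹.transpose (g z.1 z.2) = G z := by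
  have hfin := isFiniteMeasure_restrict_of_isBounded hΩb
  have hGm : StronglyMeasurable G := Lp.stronglyMeasurable G
  have hGi : Integrable G ((volume.restrict Ω).prod (volume.restrict (unitCell d))) :=
    (Lp.memLp G).integrable Fact.out
  have hg₀i := hg₀p.integrable (Fact.out : 1 ≤ p)
  obtain ⟨C, hC₀, hC⟩ := hD.lipschitz.transpose.exists_bound hΩb
  -- Subtracting g₀ removes the mean over Y, which a gradient of a periodic function cannot have;
  -- the transpose turns D_x^{-T} ∇_y into a plain gradient.
  obtain ⟨H, hHdef⟩ : ∃ H : E d × E d → E d,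
      ∀ z, H z = act (D z.1).transpose (G z - g₀ z.1) := ⟨_, fun _ => rfl⟩
  have hH : StronglyMeasurable H := by
    rw [funext hHdef]
    exact stronglyMeasurable_act (fun i j =>
      ((hD.lipschitz.transpose.continuous_apply i j).comp continuous_fst).measurable)
      (hGm.sub (hg₀.comp_measurable measurable_fst))
  have hHp : MemLp H p ((volume.restrict Ω).prod (volume.restrict (unitCell d))) := by
    have h1 : MemLp (fun z : E d × E d => G z - g₀ z.1) p
        ((volume.restrict Ω).prod (volume.restrict (unitCell d))) :=
      (Lp.memLp G).sub (hg₀p.comp_fst (volume.restrict (unitCell d)))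
    refine h1.of_le_mul (c := C) hH.aestronglyMeasurable ?_
    have : ∀ᵐ z ∂((volume.restrict Ω).prod (volume.restrict (unitCell d))), z.1 ∈ Ω :=
      Measure.quasiMeasurePreserving_fst.ae (ae_restrict_mem hΩ.measurableSet)
    filter_upwards [this] with z hz
    rw [hHdef]
    exact hC z.1 hz _
  have hHs : ∀ x, StronglyMeasurable fun y => H (x, y) := fun x =>
    hH.comp_measurable measurable_prodMk_left
  have hHi := hHp.integrable (Fact.out : 1 ≤ p)
  obtain ⟨hu, hup⟩ := memLp_potential hH Fact.out hp hHp
  have hui := hup.integrable (Fact.out : 1 ≤ p)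
  have hm : ∀ᵐ x ∂(volume.restrict Ω), ∀ v, ∫ y in unitCell d, inner ℝ v (H (x, y)) = 0 := by
    have h1 : ∀ᵐ x ∂(volume.restrict Ω), ∀ i : Fin d, ∫ y in unitCell d,
        inner ℝ (EuclideanSpace.single i 1) (G (x, y)) =
          inner ℝ (EuclideanSpace.single i 1) (g₀ x) :=
      ae_all_iff.2 fun i => ae_integral_inner_eq_of_test hΩ hGi hg₀i _ fun a ha => hmean a _ ha
    filter_upwards [h1, hGi.prod_right_ae] with x hx hix v
    have h2 : ∫ y in unitCell d, G (x, y) = g₀ x := by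
      ext i
      have := hx i
      rw [integral_inner hix] at this
      simpa [EuclideanSpace.inner_single_left] using this
    simp only [hHdef, inner_act_transpose, inner_sub_right]
    have i1 : Integrable (fun y => inner ℝ (act (D x) v) (G (x, y)))
      (volume.restrict (unitCell d)) := hix.const_inner _
    rw [integral_sub i1 (integrable_const _), integral_inner hix, h2]
    simp
  have hc := ae_integral_act_transpose_comm hΩ hD.lipschitz hΩb hGm hGi hcurl
  have key : ∀ᵐ x ∂(volume.restrict Ω),
      HasWeakGradient univ (fun y => potential (fun y => H (x, y)) (fractPart y))
        (fun y => H (x, fractPart y)) ∧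
      HasWeakGradient (unitCell d) (potential fun y => H (x, y)) fun y => H (x, y) := by
    filter_upwards [hm, hc, hHi.prod_right_ae, hui.prod_right_ae, hGi.prod_right_ae]
      with x hxm hxc hix hixu hixG
    refine hasWeakGradient_of_periodic (h := fun y => H (x, y))
      (hu.comp_measurable measurable_prodMk_left) hixu (hHs x) hix fun Ψ hΨ v =>
        integral_potential_mul_fderiv (hHs x) hix (fun Ψ hΨ v v' => ?_) hxm hΨ v
    obtain ⟨B, hB⟩ := hΨ.exists_bound_fderiv
    -- H and D_xᵀ G differ by a field constant in y, which is invisible to derivatives of periodic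
    -- functions.
    have e1 : ∀ u u' : E d, ∫ y in unitCell d, inner ℝ u (H (x, y)) * fderiv ℝ Ψ y u' =
        ∫ y in unitCell d, inner ℝ u (act (D x).transpose (G (x, y))) * fderiv ℝ Ψ y u' := by
      intro u u'
      have i1 : Integrable (fun y => inner ℝ u (act (D x).transpose (G (x, y))) * fderiv ℝ Ψ y u')
          (volume.restrict (unitCell d)) := by
        simp only [inner_act_transpose]
        exact (hixG.const_inner _).mul_bdd (hΨ.continuous_fderiv _).aestronglyMeasurable
          (Eventually.of_forall fun y => hB y _)
      have i2 : Integrable (fun y => inner ℝ u (act (D x).transpose (g₀ x)) * fderiv ℝ Ψ y u')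
          (volume.restrict (unitCell d)) :=
        (integrable_const _).mul_bdd (hΨ.continuous_fderiv _).aestronglyMeasurable
          (Eventually.of_forall fun y => hB y _)
      simp only [hHdef, act_sub, inner_sub_right, sub_mul]
      rw [integral_sub i1 i2, integral_const_mul, integral_unitCell_fderiv hΨ, mul_zero, sub_zero]
    rw [e1, e1]
    exact hxc Ψ hΨ v v'
  have ha := ae_ae_of_eq hup.coeFn_toLp
  have hb := ae_ae_of_eq hHp.coeFn_toLp
  obtain ⟨V, hV⟩ := exists_bochner hp (hup.toLp _) (hHp.toLp _) (by
    filter_upwards [key, ha, hb] with x hx hax hbx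
    exact hx.2.congr hax.symm hbx.symm)
  -- w₁ lives on Y_x: composed with D_x it gives back the potential of H(x, ·), whose gradient is g
  -- = H.
  refine ⟨fun x z => potential (fun y => H (x, y)) (act (D x)⁻¹ z), fun x y => H (x, y),
    ⟨V, ?_, ?_⟩, fun z => ?_⟩
  · filter_upwards [bochner_ae hp hV, ha] with x hx hax
    simp only [act_inv_act (hD.invertible x)]
    exact hx.1.trans hax
  · filter_upwards [bochner_ae hp hV, ha, hb, key] with x hx hax hbx hxk
    refine ⟨?_, hx.2.trans hbx⟩
    refine hxk.1.congr ?_ ?_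
    · rw [Measure.restrict_univ]
      exact (ae_fractPart (hx.1.trans hax)).mono fun y hy => hy.symm
    · rw [Measure.restrict_univ]
      exact (ae_fractPart (hx.2.trans hbx)).mono fun y hy => hy.symm
  · simp only [hHdef, act_inv_transpose_act_transpose (hD.invertible z.1), Prod.mk.eta]
    abel

end Corrector

/-! ### Norm bounds and weak convergence against test functions -/

section Bounds

variable {d : ℕ} {Ω : Set (E d)} {p : ℝ≥0∞} [Fact (1 ≤ p)]

theorem W1p.eLpNorm_fn_le {w : W1p Ω p} {M : ℝ} (h : ‖w‖ ≤ M) :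
    eLpNorm w.fn p (volume.restrict Ω) ≤ ENNReal.ofReal M := by
  rw [← ENNReal.ofReal_toReal w.memLp_fn.2.ne]
  exact ENNReal.ofReal_le_ofReal ((le_max_left _ _).trans h)

theorem W1p.eLpNorm_grad_le {w : W1p Ω p} {M : ℝ} (h : ‖w‖ ≤ M) :
    eLpNorm w.grad p (volume.restrict Ω) ≤ ENNReal.ofReal M := by
  rw [← ENNReal.ofReal_toReal w.memLp_grad.2.ne]
  exact ENNReal.ofReal_le_ofReal ((le_max_right _ _).trans h)

omit [Fact (1 ≤ p)] in
theorem norm_toLp_le {α F : Type*} [MeasurableSpace α] {μ : Measure α} [NormedAddCommGroup F]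
    {f : α → F} (hf : MemLp f p μ) {M : ℝ} (hM : 0 ≤ M) (h : eLpNorm f p μ ≤ ENNReal.ofReal M) :
    ‖hf.toLp f‖ ≤ M := by
  rw [Lp.norm_toLp]
  exact ENNReal.toReal_le_of_le_ofReal hM h

theorem weakTendsto_zero_of_norm {X : Type*} [NormedAddCommGroup X] [NormedSpace ℝ X] {u : ℕ → X}
    (h : Tendsto (fun k => ‖u k‖) atTop (𝓝 0)) : WeakTendsto u 0 := by
  rw [weakTendsto_iff]
  exact fun F => (F.continuous.tendsto 0).comp (tendsto_zero_iff_norm_tendsto_zero.2 h)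

theorem WeakTendsto.integral_test_mul_inner [IsFiniteMeasure (volume.restrict Ω)] {F : Type*}
    [NormedAddCommGroup F] [InnerProductSpace ℝ F] {u : ℕ → Lp F p (volume.restrict Ω)}
    {v : Lp F p (volume.restrict Ω)} (hu : WeakTendsto u v) {a : E d → ℝ}
    (ha : IsTestFunction Ω a) (e : F) :
    Tendsto (fun k => ∫ z in Ω, a z * inner ℝ e (u k z)) atTop
      (𝓝 (∫ z in Ω, a z * inner ℝ e (v z))) := by
  obtain ⟨C, hC⟩ := ha.2.1.exists_bound_of_continuous ha.1.continuous
  have h := hu.integral_inner (h := fun z => a z • e) (C := C * ‖e‖)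
    (ha.1.continuous.smul continuous_const).aestronglyMeasurable
    (Eventually.of_forall fun z => by
      rw [norm_smul]
      exact mul_le_mul_of_nonneg_right (hC z) (norm_nonneg e))
  simpa only [real_inner_smul_left] using h

end Bounds

/-! ### Convergence in the Bochner space of Sobolev functions -/

namespace CubePartition

variable {d : ℕ} {Ω : Set (E d)} (hΩ : IsOpen Ω) (hΩb : Bornology.IsBounded Ω) {D : E d → Mat d}
  (hD : IsTransformation Ω D) {r : ℝ} {ε : ℕ → ℝ} (hε : ∀ k, 0 < ε k)
  (hε₀ : Tendsto ε atTop (𝓝 0)) (P : ∀ k, CubePartition Ω r (ε k)) {p : ℝ≥0∞} [Fact (1 ≤ p)]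
  (hp : p ≠ ⊤)

include hΩb hD hε hε₀ in
/-- The gradients in the cell variable of the unfolded functions tend to zero. -/
theorem exists_weakTendsto_unfolding_localPullback {w : ℕ → W1p Ω p} {M : ℝ}
    (hM : ∀ k, ‖w k‖ ≤ M) :
    ∃ S : ℕ → Lp (E d) p ((volume.restrict Ω).prod (volume.restrict (unitCell d))),
      (∀ k, (S k : E d × E d → E d) =ᵐ[(volume.restrict Ω).prod (volume.restrict (unitCell d))]
        fun z => ε k • (P k).unfolding D ((P k).localPullback D (w k).grad) z.1 z.2) ∧
      WeakTendsto S 0 := by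
  have hM₀ : 0 ≤ M := (norm_nonneg _).trans (hM 0)
  obtain ⟨C, hC₀, hC⟩ := hD.lipschitz.transpose.exists_bound hΩb
  have hLs : ∀ k, StronglyMeasurable ((P k).localPullback D (w k).grad) := fun k =>
    stronglyMeasurable_localPullback (w k).stronglyMeasurable_grad
  have hLm : ∀ k, MemLp ((P k).localPullback D (w k).grad) p (volume.restrict Ω) := fun k =>
    (w k).memLp_grad.of_le_mul (hLs k).aestronglyMeasurable
      (Eventually.of_forall fun z => norm_localPullback_le hC₀ hC _ z)
  have hLb : ∀ k, eLpNorm ((P k).localPullback D (w k).grad) p (volume.restrict Ω) ≤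
      ENNReal.ofReal (C * M) := fun k => by
    refine (eLpNorm_le_mul_eLpNorm_of_ae_le_mul (g := (w k).grad)
      (Eventually.of_forall fun z => norm_localPullback_le hC₀ hC _ z) p).trans ?_
    rw [ENNReal.ofReal_mul hC₀]
    gcongr
    exact W1p.eLpNorm_grad_le (hM k)
  have hSm := fun k => memLp_unfolding (P := P k) (hε k) hD.invertible (hLs k) (hLm k)
  -- The chain rule on a cell of size ε gives the factor ε in front of a field bounded in `L^p`, so
  -- the convergence to 0 is even strong.
  have hSb : ∀ k, ‖ε k • (hSm k).toLp _‖ ≤ ε k * (C * M) := fun k => by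
    rw [norm_smul, Real.norm_eq_abs, abs_of_pos (hε k)]
    refine mul_le_mul_of_nonneg_left (norm_toLp_le _ (mul_nonneg hC₀ hM₀) ?_) (hε k).le
    exact (eLpNorm_unfolding_le (P := P k) (hε k) hD.invertible (hLs k) p).trans (hLb k)
  refine ⟨fun k => ε k • (hSm k).toLp _, fun k => ?_,
    weakTendsto_zero_of_norm (squeeze_zero (fun k => norm_nonneg _) hSb ?_)⟩
  · filter_upwards [Lp.coeFn_smul (ε k) ((hSm k).toLp _), (hSm k).coeFn_toLp] with z hz hz'
    rw [hz, Pi.smul_apply, hz']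
  · simpa using hε₀.mul_const (C * M)

include hΩ hΩb hD hε hε₀ hp in
/-- The unfolded functions converge weakly with values in `W^{1,p}(Y)`. -/
theorem exists_weakTendsto_bochner_unfolding {w : ℕ → W1p Ω p} {M : ℝ} (hM : ∀ k, ‖w k‖ ≤ M)
    {U : ℕ → Lp ℝ p ((volume.restrict Ω).prod (volume.restrict (unitCell d)))}
    (hU : ∀ k, (U k : E d × E d → ℝ) =ᵐ[(volume.restrict Ω).prod (volume.restrict (unitCell d))]
      fun z => (P k).unfolding D (w k).fn z.1 z.2)
    {W : Lp ℝ p ((volume.restrict Ω).prod (volume.restrict (unitCell d)))} (hW : WeakTendsto U W)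
    {f₀ : E d → ℝ} (hf₀ : ∀ᵐ x ∂(volume.restrict Ω),
      (fun y => W (x, y)) =ᵐ[volume.restrict (unitCell d)] fun _ => f₀ x) :
    ∃ (V : ℕ → Lp (W1p (unitCell d) p) p (volume.restrict Ω))
      (V₀ : Lp (W1p (unitCell d) p) p (volume.restrict Ω)),
      (∀ k, Represents (V k) ((P k).unfolding D (w k).fn)) ∧
        Represents V₀ (fun x _ => f₀ x) ∧ WeakTendsto V V₀ := by
  have hfin := isFiniteMeasure_restrict_of_isBounded hΩb
  obtain ⟨S, hSk, hS0⟩ := exists_weakTendsto_unfolding_localPullback hΩb hD hε hε₀ P hM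
  have hex : ∀ k, ∃ V : Lp (W1p (unitCell d) p) p (volume.restrict Ω),
      bochnerIncl Ω (unitCell d) p V = bochnerPair hp Ω (unitCell d) (U k, S k) := fun k => by
    refine exists_bochner hp _ _ ?_
    filter_upwards [hasWeakGradient_unfolding (P := P k) (hε k) hD.invertible hΩ.measurableSet (w k),
      ae_ae_of_eq (hU k), ae_ae_of_eq (hSk k)] with x hx hx' hx''
    exact hx.congr hx'.symm hx''.symm
  choose V hV using hex
  have h0 : ((0 : Lp (E d) p ((volume.restrict Ω).prod (volume.restrict (unitCell d)))) :
      E d × E d → E d) =ᵐ[(volume.restrict Ω).prod (volume.restrict (unitCell d))] fun _ => 0 :=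
    Lp.coeFn_zero _ _ _
  -- The limit does not depend on y, so its cell gradient is 0, in agreement with the limit of S.
  obtain ⟨V₀, hV₀⟩ := exists_bochner hp W 0 (by
    filter_upwards [hf₀, ae_ae_of_eq h0] with x hx hx0
    refine HasWeakGradient.congr (u := fun _ => f₀ x) (G := fun _ => 0) ?_ hx.symm hx0.symm
    refine (hasWeakGradient_of_periodic stronglyMeasurable_const (integrable_const _)
      stronglyMeasurable_const (integrable_const _) fun Ψ hΨ v => ?_).2
    rw [integral_const_mul, integral_unitCell_fderiv hΨ]
    simp)
  refine ⟨V, V₀, fun k => ?_, ?_, weakTendsto_bochner hp hW hS0 hV hV₀⟩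
  · filter_upwards [bochner_ae hp (hV k), ae_ae_of_eq (hU k)] with x hx hx'
    exact hx.1.trans hx'
  · filter_upwards [bochner_ae hp hV₀, hf₀] with x hx hx'
    exact hx.1.trans hx'

end CubePartition

end LPUnfold

/-! ### Assembly of the theorem -/

theorem mainTheorem2 {d : ℕ} (hd : 0 < d)
    {Ω : Set (E d)} (hΩ : IsLipschitzDomain Ω) (hΩb : Bornology.IsBounded Ω)
    {D : E d → Mat d} (hD : IsTransformation Ω D)
    {r : ℝ} (hr₀ : 0 < r) (hr₁ : r < 1)
    {p : ℝ≥0∞} [Fact (1 ≤ p)] (hp₁ : 1 < p) (hp₂ : p < ⊤)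
    (ε : ℕ → ℝ) (hε : ∀ k, 0 < ε k) (hε₀ : Tendsto ε atTop (𝓝 0))
    (P : ∀ k, CubePartition Ω r (ε k))
    (w : ℕ → W1p Ω p) (w₀ : W1p Ω p) (hw : WeakTendsto w w₀) :
    ∃ φ : ℕ → ℕ, StrictMono φ ∧
      (∃ (V : ℕ → Lp (W1p (unitCell d) p) p (volume.restrict Ω))
          (V₀ : Lp (W1p (unitCell d) p) p (volume.restrict Ω)),
        (∀ k, Represents (V k) ((P (φ k)).unfolding D (w (φ k)).fn)) ∧
        Represents V₀ (fun x _ => w₀.fn x) ∧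
        WeakTendsto V V₀) ∧
      ∃ (w₁ : E d → E d → ℝ) (g : E d → E d → E d),
        MemLpW1pPer Ω D p w₁ g ∧
        WeakTendstoLp p ((volume.restrict Ω).prod (volume.restrict (unitCell d)))
          (fun k z => (P (φ k)).unfolding D (w (φ k)).grad z.1 z.2)
          (fun z => w₀.grad z.1 + act (D z.1)⁻¹.transpose (g z.1 z.2)) := by
  have hΩo := hΩ.1
  have hp := hp₂.ne
  have hfin := isFiniteMeasure_restrict_of_isBounded hΩb
  obtain ⟨M, hM⟩ := hw.exists_norm_le
  have hM₀ : 0 ≤ M := (norm_nonneg _).trans (hM 0)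
  have hwM := fun k => W1p.eLpNorm_fn_le (hM k)
  have hgM := fun k => W1p.eLpNorm_grad_le (hM k)
  have hFm := fun k => CubePartition.memLp_unfolding (P := P k) (hε k) hD.invertible
    (w k).stronglyMeasurable_fn (w k).memLp_fn
  have hGm := fun k => CubePartition.memLp_unfolding (P := P k) (hε k) hD.invertible
    (w k).stronglyMeasurable_grad (w k).memLp_grad
  -- One subsequence is extracted for functions and gradients; everything after this only identifies
  -- the limits.
  obtain ⟨φ, W, G, hφ, hW, hG⟩ := exists_weakTendsto_subseq_prod hp₁ hp
    (u := fun k => (hFm k).toLp _) (U := fun k => (hGm k).toLp _)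
    (fun k => norm_toLp_le _ hM₀ ((CubePartition.eLpNorm_unfolding_le (P := P k) (hε k)
      hD.invertible (w k).stronglyMeasurable_fn p).trans (hwM k)))
    (fun k => norm_toLp_le _ hM₀ ((CubePartition.eLpNorm_unfolding_le (P := P k) (hε k)
      hD.invertible (w k).stronglyMeasurable_grad p).trans (hgM k)))
  have hεφ : Tendsto (fun k => ε (φ k)) atTop (𝓝 0) := hε₀.comp hφ.tendsto_atTop
  have hwφ := hw.comp_strictMono hφ
  have hwfn := hwφ.map ((ContinuousLinearMap.fst ℝ _ _).comp (sobolevSubmodule Ω p).subtypeL)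
  have hwgrad := hwφ.map ((ContinuousLinearMap.snd ℝ _ _).comp (sobolevSubmodule Ω p).subtypeL)
  have hWi : Integrable W ((volume.restrict Ω).prod (volume.restrict (unitCell d))) :=
    (Lp.memLp W).integrable Fact.out
  have hWmean : ∀ᵐ x ∂(volume.restrict Ω), ∫ y in unitCell d, inner ℝ (1 : ℝ) (W (x, y)) =
      inner ℝ (1 : ℝ) (w₀.fn x) :=
    ae_integral_inner_eq_of_test hΩo hWi (w₀.memLp_fn.integrable Fact.out) 1 fun a ha =>
      CubePartition.integral_unfolded_limit (P := fun k => P (φ k)) hΩo hΩb hD hr₀ hr₁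
        (fun k => hε (φ k)) hεφ hp₁ hp (fun k => (w (φ k)).stronglyMeasurable_fn)
        ENNReal.ofReal_ne_top (fun k => hwM (φ k)) (fun k => (hFm (φ k)).coeFn_toLp) hW ha 1
        (hwfn.integral_test_mul_inner ha 1)
  -- W is constant in y on almost every fibre, hence equal to its mean there, which is w.
  have hWconst : ∀ᵐ x ∂(volume.restrict Ω),
      (fun y => W (x, y)) =ᵐ[volume.restrict (unitCell d)] fun _ => w₀.fn x := by
    filter_upwards [hWmean, ae_ae_eq_integral_of_test hΩo (Lp.stronglyMeasurable W) hWi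
      fun a Ψ ha hΨ v => CubePartition.integral_unfolded_limit_mul_fderiv (P := fun k => P (φ k))
        hΩo hΩb hD hr₀ hr₁ (fun k => hε (φ k)) hεφ hp₁ hp ENNReal.ofReal_ne_top
        (fun k => hwM (φ k)) (fun k => hgM (φ k)) (fun k => (hFm (φ k)).coeFn_toLp) hW ha hΨ v]
      with x hx hx'
    simp only [RCLike.inner_apply, map_one, mul_one] at hx
    filter_upwards [hx'] with y hy
    rw [hy, hx]
  obtain ⟨w₁, g, hw₁, hg⟩ := exists_corrector hΩo hΩb hp hD G w₀.stronglyMeasurable_grad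
    w₀.memLp_grad
    (fun a e ha => CubePartition.integral_unfolded_limit (P := fun k => P (φ k)) hΩo hΩb hD hr₀ hr₁
        (fun k => hε (φ k)) hεφ hp₁ hp (fun k => (w (φ k)).stronglyMeasurable_grad)
        ENNReal.ofReal_ne_top (fun k => hgM (φ k)) (fun k => (hGm (φ k)).coeFn_toLp) hG ha e
        (hwgrad.integral_test_mul_inner ha e))
    (fun a Ψ ha hΨ v v' => CubePartition.integral_unfolded_grad_limit_comm
      (P := fun k => P (φ k)) hΩo hΩb hD hr₀ hr₁ (fun k => hε (φ k)) hεφ hp₁ hp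
      ENNReal.ofReal_ne_top (fun k => hgM (φ k)) (fun k => (hGm (φ k)).coeFn_toLp) hG ha hΨ v v')
  refine ⟨φ, hφ, CubePartition.exists_weakTendsto_bochner_unfolding hΩo hΩb hD
    (fun k => hε (φ k)) hεφ (fun k => P (φ k)) hp (fun k => hM (φ k))
    (fun k => (hFm (φ k)).coeFn_toLp) hW hWconst, w₁, g, hw₁, ?_⟩
  -- The corrector identity holds at every point for the chosen representatives, so the limit is
  -- literally G.
  rw [funext hg]
  refine ⟨fun k => hGm (φ k), Lp.memLp G, ?_⟩
  rw [Lp.toLp_coeFn]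
  exact hG
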